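/- Represent $\mathbb{RP}^3$ by homogeneous coordinates $[x:y:z:w]$ (equivalently, as the ball $D^3$ with antipodal points of the boundary sphere identified), and let $\pi:\mathbb{RP}^3\setminus\{[0:0:1:0]\}\to\mathbb{RP}^2$, $[x:y:z:w]\mapsto[x:y:w]$, be the projection from the image of the poles of the ball. Let $\ell_\infty=\{w=0\}\subset\mathbb{RP}^2$ be the line at infinity, i.e. the boundary circle of the equatorial disk $D^2$ with antipodal points identified. A based oriented knot diagram $D$ consists of a smooth immersion $c:S^1\to\mathbb{RP}^2$ of the oriented circle (equivalently, of the system of arcs in $D^2$ into which $\ell_\infty$ cuts it) whose only multiple points are transverse double points (the crossings), which is transverse to $\ell_\infty$ and has no crossings on $\ell_\infty$; for each crossing, the choice of one of its two branches as the over-branch; and a basepoint $b\in S^1$ whose image is neither a crossing nor on $\ell_\infty$. It is a diagram of a knot $K$ (a smooth embedding $K:S^1\to\mathbb{RP}^3$ avoiding $[0:0:1:0]$) if $\pi\circ K=c$ and, at each crossing, the over-branch is the one with the larger value of $z/w$ on $K$. The arc distance from $b$ to a point $p\in S^1$ with $c(p)\notin\ell_\infty$ is the number of times $c$ crosses $\ell_\infty$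 on the way from $b$ to $p$ in the direction of the orientation. $D$ is descending if, for every crossing, the branch passed first when starting from $b$ in the direction of the orientation is the over-branch when its arc distance from $b$ is even, and the under-branch when it is odd. Theorem. Let $D$ be a based oriented diagram of a knot in $\mathbb{RP}^3$. If $D$ is descending, then $D$ is a diagram of an unknot: there is a knot with diagram $D$, and every knot with diagram $D$ is carried by a smooth ambient isotopy of $\mathbb{RP}^3$ onto a planar circle $\{z=0,\ x^2+y^2=w^2\}$ or onto a projective line $\{y=z=0\}$. -/

import Mathlib

open scoped ContDiff LinearAlgebra.Projectivization

noncomputable section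

namespace ProjKnot

/-- The real projective plane, with homogeneous coordinates `[x : y : w]` (indices `0, 1, 2`).
It is the closed disk with antipodal boundary points identified: the disk is the affine chart
`w ≠ 0` together with its boundary circle, which becomes the line at infinity `w = 0`. -/
abbrev RP2 := ℙ ℝ (Fin 3 → ℝ)

/-- Real projective 3-space, with homogeneous coordinates `[x : y : z : w]`
(indices `0, 1, 2, 3`). The ball `D³` with antipodal boundary points identified is mapped onto it by
`u ↦ [2u : 1 - |u|²]`; the metric circles through the two poles of the ball become the
projective lines through the point `[0 : 0 : 1 : 0]`, which is the image of the poles. -/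
abbrev RP3 := ℙ ℝ (Fin 4 → ℝ)

/-! ### Smooth curves in projective space -/

/-- `γ` is a smooth lift to homogeneous coordinates of the closed curve `f : ℝ/ℤ → ℝPⁿ⁻¹`, and
`f` is an immersion. (The velocity of `f` at `t` is the class of `γ' t` modulo the line spanned by
`γ t`, so it is nonzero exactly when `γ t` and `γ' t` are linearly independent; a curve in
projective space is smooth if and only if it has a smooth lift over `ℝ`.) -/
def IsImmersedLift {n : ℕ} (f : UnitAddCircle → ℙ ℝ (Fin n → ℝ)) (γ : ℝ → Fin n → ℝ) : Prop :=
  ContDiff ℝ ∞ γ ∧ ∀ t : ℝ, LinearIndependent ℝ ![γ t, deriv γ t] ∧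
    ∃ h : γ t ≠ 0, f (t : UnitAddCircle) = Projectivization.mk ℝ (γ t) h

/-- A parametrized knot in `ℝP³`: a smooth embedding of the circle `ℝ/ℤ`. -/
structure Knot where
  toFun : UnitAddCircle → RP3
  smooth_immersion : ∃ γ : ℝ → Fin 4 → ℝ, IsImmersedLift toFun γ
  injective : Function.Injective toFun

/-! ### Ambient isotopy and unknots -/

/-- A map `ℝP³ → ℝP³` is smooth: it is induced by a smooth map `ℝ⁴ ∖ 0 → ℝ⁴ ∖ 0`. -/
def IsSmoothMap (f : RP3 → RP3) : Prop :=
  ∃ F : (Fin 4 → ℝ) → (Fin 4 → ℝ), ContDiffOn ℝ ∞ F {0}ᶜ ∧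
    ∀ (x : Fin 4 → ℝ) (hx : x ≠ 0), ∃ h : F x ≠ 0,
      f (Projectivization.mk ℝ x hx) = Projectivization.mk ℝ (F x) h

/-- A family of maps `ℝP³ → ℝP³` with parameter in `[0, 1]` is smooth, jointly in the parameter
and the point. -/
def IsSmoothFamily (f : ℝ → RP3 → RP3) : Prop :=
  ∃ F : ℝ × (Fin 4 → ℝ) → (Fin 4 → ℝ), ContDiffOn ℝ ∞ F (Set.Icc 0 1 ×ˢ {0}ᶜ) ∧
    ∀ t ∈ Set.Icc (0 : ℝ) 1, ∀ (x : Fin 4 → ℝ) (hx : x ≠ 0), ∃ h : F (t, x) ≠ 0,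
      f t (Projectivization.mk ℝ x hx) = Projectivization.mk ℝ (F (t, x)) h

/-- Two subsets of `ℝP³` are ambient isotopic: a smooth family of diffeomorphisms `Φ t`,
`t ∈ [0, 1]`, starts at the identity and ends with one that carries `A` onto `B`. -/
def AmbientIsotopic (A B : Set RP3) : Prop :=
  ∃ Φ : ℝ → Equiv.Perm RP3,
    IsSmoothFamily (fun t => Φ t) ∧
    (∀ t ∈ Set.Icc (0 : ℝ) 1, IsSmoothMap (Φ t).symm) ∧
    (∀ P, Φ 0 P = P) ∧ Φ 1 '' A = B

/-- A planar circle: `x² + y² = 1`, `z = 0` in the affine chart `w = 1`. -/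
def planarCircle : Set RP3 :=
  {P | ∀ v ∈ P.submodule, v 2 = 0 ∧ v 0 ^ 2 + v 1 ^ 2 = v 3 ^ 2}

/-- A projective line: the closure `y = z = 0` of the `x`-axis of the affine chart. -/
def projectiveLine : Set RP3 :=
  {P | ∀ v ∈ P.submodule, v 1 = 0 ∧ v 2 = 0}

/-- A knot is an unknot if it is ambient isotopic to a planar circle or to a projective line. -/
def Knot.IsUnknot (K : Knot) : Prop :=
  AmbientIsotopic (Set.range K.toFun) planarCircle ∨
    AmbientIsotopic (Set.range K.toFun) projectiveLine

/-! ### Diagrams -/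

/-- The line `w = 0` in the projective plane. -/
def lineAtInfinity : Set RP2 := {P | ∀ v ∈ P.submodule, v 2 = 0}

/-- A based oriented knot diagram in the disk, given by its net, i.e. by the curve in `ℝP²` that
arises when antipodal boundary points of the disk are identified. The orientation is the
direction of the parametrization. -/
structure KnotDiagram where
  /-- the net -/
  net : UnitAddCircle → RP2
  /-- The net is a smooth immersion, its double points are transverse (the two tangent directions
  differ), and it is transverse to the line at infinity. -/
  generic : ∃ γ : ℝ → Fin 3 → ℝ, IsImmersedLift net γ ∧
    (∀ s t : ℝ, (s : UnitAddCircle) ≠ (t : UnitAddCircle) →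
      net (s : UnitAddCircle) = net (t : UnitAddCircle) →
        LinearIndependent ℝ ![γ s, deriv γ s, deriv γ t]) ∧
    ∀ t : ℝ, γ t 2 = 0 → deriv γ t 2 ≠ 0
  no_triple_point : ∀ p q r : UnitAddCircle, p ≠ q → q ≠ r → p ≠ r → net p = net q → net q ≠ net r
  no_crossing_at_infinity : ∀ p q : UnitAddCircle, p ≠ q → net p = net q → net p ∉ lineAtInfinity
  /-- The crossing information: where `p ≠ q` and `net p = net q`, `isOver p q` says that the branch
  at `p` is over the branch at `q`; for other pairs it has no meaning. -/
  isOver : UnitAddCircle → UnitAddCircle → Prop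
  isOver_iff : ∀ p q : UnitAddCircle, p ≠ q → net p = net q → (isOver p q ↔ ¬ isOver q p)
  /-- the basepoint, distinct from crossings and from endpoints of arcs -/
  basepoint : UnitAddCircle
  basepoint_not_crossing : ∀ p : UnitAddCircle, p ≠ basepoint → net p ≠ net basepoint
  basepoint_not_at_infinity : net basepoint ∉ lineAtInfinity

/-- The parameter length in `[0, 1)` of the path from `p` to `q` in the positive direction. -/
def travelTime (p q : UnitAddCircle) : ℝ := (AddCircle.equivIco (1 : ℝ) 0 (q - p) : ℝ)

namespace KnotDiagram

variable (D : KnotDiagram)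

/-- `p` and `q` are the two branches of a crossing. -/
def IsCrossing (p q : UnitAddCircle) : Prop := p ≠ q ∧ D.net p = D.net q

/-- The number of times the line at infinity is crossed on the way from `p` to `q` in the direction
of the orientation. (For a diagram this set is finite, by transversality.) -/
def arcDistance (p q : UnitAddCircle) : ℕ :=
  {r : UnitAddCircle | D.net r ∈ lineAtInfinity ∧ travelTime p r < travelTime p q}.ncard

/-- At each crossing, the branch `p` that is passed first from the basepoint is over or under the
other branch `q` according as the arc distance from the basepoint to `p` is even or odd. -/
def IsDescending : Prop :=
  ∀ p q : UnitAddCircle, D.IsCrossing p q →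
    travelTime D.basepoint p < travelTime D.basepoint q →
      (Even (D.arcDistance D.basepoint p) → D.isOver p q) ∧
      (Odd (D.arcDistance D.basepoint p) → D.isOver q p)

end KnotDiagram

/-! ### Diagrams of knots -/

/-- `Q` is the image of `P` under the projection `[x : y : z : w] ↦ [x : y : w]` from the point
`[0 : 0 : 1 : 0]`. In particular `P` differs from that point. -/
def ProjectsTo (P : RP3) (Q : RP2) : Prop :=
  P.submodule.map (LinearMap.funLeft ℝ ℝ ![(0 : Fin 4), 1, 3]) = Q.submodule

/-- The height `z / w` of a point in the affine chart `w ≠ 0`. It decreases along the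
arcs in the ball from the north pole to the south pole. -/
def height (P : RP3) : ℝ := P.rep 2 / P.rep 3

theorem height_mk (v : Fin 4 → ℝ) (hv : v ≠ 0) :
    height (Projectivization.mk ℝ v hv) = v 2 / v 3 := by
  obtain ⟨a, ha⟩ := Projectivization.exists_smul_eq_mk_rep ℝ v hv
  rw [height, ← ha]
  simp only [Units.smul_def, Pi.smul_apply, smul_eq_mul]
  exact mul_div_mul_left _ _ a.ne_zero

/-- `D` is a diagram of the knot `K`: the knot projects onto the net of `D`, and at each crossing
the over-branch is the one with the larger height. -/
def KnotDiagram.IsDiagramOf (D : KnotDiagram) (K : Knot) : Prop :=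
  (∀ p : UnitAddCircle, ProjectsTo (K.toFun p) (D.net p)) ∧
    ∀ p q : UnitAddCircle, D.IsCrossing p q →
      (D.isOver p q ↔ height (K.toFun q) < height (K.toFun p))

end ProjKnot

end

open scoped ContDiff LinearAlgebra.Projectivization RealInnerProductSpace Topology NNReal
open Metric

noncomputable section

namespace ProjKnot

/-! ### Homogeneous maps and the relation of ambient isotopy -/

/-! Lift the net to the unit sphere, starting at the basepoint with `w > 0`. This gives a curve `c`
with `c (t + 1) = ε • c t`, where `ε = 1` or `ε = -1`, and a knot over the net becomes `[c : ζ]` for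
a smooth height `ζ` with the same equivariance (`NormalizedLift.exists_isHeight`). As `c` is
transverse to `w = 0`, the sign of `w` at a parameter is the parity of the arc distance
(`even_ncard_zeros_iff`). At a crossing `c t = a • c s` with `s < t`, clearing the denominator `w`
turns the even and the odd clause of the definition of descending into one and the same inequality
`a * ζ t < |a| * ζ s` (`NormalizedLift.isDescendingPair`). From here on the line at infinity plays
no role.

This condition is convex in `ζ`, so a descending height may be replaced by any other one over the
same curve (`IsDescendingPair.ambientIsotopic`). The convenient choice is `modelHeight`: positive
and falling from about 2 to about 1 during one period, cut off to zero near the basepoint. Over it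
the projection can be moved almost at will. At a crossing with `a > 0` the two heights differ by
monotonicity, and at one with `a < 0` they differ in sign after rescaling. So the curve can be
pulled linearly towards the point `-c 0` away from the basepoint: the net passes the basepoint only
once, hence the pull never meets the ray of `c 0`, and where the projection stops the falling height
keeps the knot immersed (`exists_isKnotPair_pushAway`). The result depends only on the germ of `c`
at the basepoint. That germ can first be made equal to the germ of a conic (`ε = 1`) or of a line
(`ε = -1`) with the same velocity (`exists_straighten`). The conic or line can be pulled to the same
final curve, so the knot is isotopic to it (`IsDescendingPair.ambientIsotopic_model`). Both models
are linear images of the standard unknots. Linear automorphisms do not change the ambient isotopy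
class of these, because they are symmetric under reflections in the coordinates
(`ambientIsotopic_linPerm`).

Isotopies of embedded curves are turned into ambient ones by `ambientIsotopic_of_isotopy`. For
nearby parameters the displacement of the curve is extended to an odd map of `ℝ⁴` and then made
homogeneous; added to the identity, it is a small Lipschitz perturbation and hence a diffeomorphism.

For the existence of a knot, the model height with a short enough cutoff is descending over `c`, and
the resulting curve is embedded with the prescribed crossings (`NormalizedLift.exists_isDiagramOf`).
-/

/-- `F` commutes with nonzero scalars and has no zeros outside the origin. -/
structure IsHomogeneous (F : (Fin 4 → ℝ) → (Fin 4 → ℝ)) : Prop where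
  ne_zero : ∀ x, x ≠ 0 → F x ≠ 0
  map_smul : ∀ (a : ℝ) (x), a ≠ 0 → x ≠ 0 → F (a • x) = a • F x

/-- The map of projective space induced by a homogeneous map. -/
def projMap (F : (Fin 4 → ℝ) → (Fin 4 → ℝ)) (hF : IsHomogeneous F) : RP3 → RP3 :=
  Projectivization.lift (fun v => Projectivization.mk ℝ (F v.1) (hF.ne_zero _ v.2)) (by
    rintro ⟨a, ha⟩ ⟨b, hb⟩ t h
    have h' : a = t • b := h
    have ht : t ≠ 0 := by
      rintro rfl
      exact ha (by simpa using h')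
    rw [Projectivization.mk_eq_mk_iff']
    exact ⟨t, by simp only [h']; rw [hF.map_smul t b ht hb]⟩)

theorem projMap_mk (F : (Fin 4 → ℝ) → (Fin 4 → ℝ)) (hF : IsHomogeneous F) (x : Fin 4 → ℝ)
    (hx : x ≠ 0) :
    projMap F hF (Projectivization.mk ℝ x hx) = Projectivization.mk ℝ (F x) (hF.ne_zero x hx) :=
  rfl

/-- The permutation of projective space induced by a homogeneous map and its inverse. -/
def projPerm (F G : (Fin 4 → ℝ) → (Fin 4 → ℝ)) (hF : IsHomogeneous F) (hG : IsHomogeneous G)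
    (hGF : ∀ x, x ≠ 0 → G (F x) = x) (hFG : ∀ x, x ≠ 0 → F (G x) = x) : Equiv.Perm RP3 where
  toFun := projMap F hF
  invFun := projMap G hG
  left_inv P := by
    induction P using Projectivization.ind with
    | h v hv => simp only [projMap_mk, hGF v hv]
  right_inv P := by
    induction P using Projectivization.ind with
    | h v hv => simp only [projMap_mk, hFG v hv]

/-! ### Smooth families of maps, and ambient isotopy as an equivalence relation. -/

theorem IsSmoothMap.comp {f g : RP3 → RP3} (hg : IsSmoothMap g) (hf : IsSmoothMap f) :
    IsSmoothMap (g ∘ f) := by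
  obtain ⟨F, hF, hF'⟩ := hf
  obtain ⟨G, hG, hG'⟩ := hg
  refine ⟨G ∘ F, hG.comp hF fun x hx => (hF' x hx).1, fun x hx => ?_⟩
  obtain ⟨h1, h2⟩ := hF' x hx
  obtain ⟨h3, h4⟩ := hG' _ h1
  exact ⟨h3, by rw [Function.comp_apply, h2, h4]; rfl⟩

theorem isSmoothMap_projMap {F : (Fin 4 → ℝ) → (Fin 4 → ℝ)} (hF : IsHomogeneous F)
    (h : ContDiffOn ℝ ∞ F {0}ᶜ) : IsSmoothMap (projMap F hF) :=
  ⟨F, h, fun x hx => ⟨hF.ne_zero x hx, rfl⟩⟩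

theorem IsSmoothFamily.isSmoothMap {f : ℝ → RP3 → RP3} (hf : IsSmoothFamily f) {t : ℝ}
    (ht : t ∈ Set.Icc (0 : ℝ) 1) : IsSmoothMap (f t) := by
  obtain ⟨F, hF, hF'⟩ := hf
  refine ⟨fun x => F (t, x), ?_, hF' t ht⟩
  exact hF.comp (contDiffOn_const.prodMk contDiffOn_id) fun x hx => ⟨ht, hx⟩

theorem IsSmoothFamily.comp {f g : ℝ → RP3 → RP3} (hg : IsSmoothFamily g)
    (hf : IsSmoothFamily f) : IsSmoothFamily (fun t => g t ∘ f t) := by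
  obtain ⟨F, hF, hF'⟩ := hf
  obtain ⟨G, hG, hG'⟩ := hg
  refine ⟨fun p => G (p.1, F p), hG.comp (contDiffOn_fst.prodMk hF) fun p hp => ?_,
    fun t ht x hx => ?_⟩
  · exact ⟨hp.1, (hF' p.1 hp.1 p.2 hp.2).1⟩
  · obtain ⟨h1, h2⟩ := hF' t ht x hx
    obtain ⟨h3, h4⟩ := hG' t ht _ h1
    exact ⟨h3, by change g t (f t _) = _; rw [h2, h4]⟩

theorem IsSmoothMap.isSmoothFamily_const {f : RP3 → RP3} (hf : IsSmoothMap f) :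
    IsSmoothFamily (fun _ => f) := by
  obtain ⟨F, hF, hF'⟩ := hf
  exact ⟨fun p => F p.2, hF.comp contDiffOn_snd fun p hp => hp.2, fun _ _ x hx => hF' x hx⟩

theorem IsSmoothFamily.reverse {f : ℝ → RP3 → RP3} (hf : IsSmoothFamily f) :
    IsSmoothFamily (fun t => f (1 - t)) := by
  obtain ⟨F, hF, hF'⟩ := hf
  have hI : ∀ t ∈ Set.Icc (0 : ℝ) 1, 1 - t ∈ Set.Icc (0 : ℝ) 1 := fun t ht =>
    ⟨by linarith [ht.2], by linarith [ht.1]⟩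
  refine ⟨fun p => F (1 - p.1, p.2),
    hF.comp ((contDiffOn_const.sub contDiffOn_fst).prodMk contDiffOn_snd) fun p hp =>
      ⟨hI _ hp.1, hp.2⟩, fun t ht x hx => hF' (1 - t) (hI t ht) x hx⟩

/-- The two isotopies are composed at each parameter instead of being concatenated, so no smoothing
at a junction is needed. -/
theorem AmbientIsotopic.trans {A B C : Set RP3} (h₁ : AmbientIsotopic A B)
    (h₂ : AmbientIsotopic B C) : AmbientIsotopic A C := by
  obtain ⟨Φ, h1, h2, h3, h4⟩ := h₁
  obtain ⟨Ψ, k1, k2, k3, k4⟩ := h₂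
  refine ⟨fun t => Ψ t * Φ t, k1.comp h1, fun t ht => (h2 t ht).comp (k2 t ht),
    fun P => ?_, ?_⟩
  · rw [Equiv.Perm.mul_apply, h3, k3]
  · rw [← k4, ← h4, Set.image_image]
    rfl

theorem AmbientIsotopic.symm {A B : Set RP3} (h : AmbientIsotopic A B) :
    AmbientIsotopic B A := by
  obtain ⟨Φ, h1, h2, h3, h4⟩ := h
  have hI : (1 : ℝ) ∈ Set.Icc (0 : ℝ) 1 := by simp
  -- The reversed family starts at `Φ 1`; the factor `(Φ 1)⁻¹` makes it start at the identity.
  refine ⟨fun t => Φ (1 - t) * (Φ 1)⁻¹,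
    h1.reverse.comp (h2 1 hI).isSmoothFamily_const, fun t ht => ?_, fun P => ?_, ?_⟩
  · exact (h1.isSmoothMap hI).comp (h2 (1 - t) ⟨by linarith [ht.2], by linarith [ht.1]⟩)
  · simp
  · have h0 : Φ 0 = 1 := Equiv.ext h3
    rw [← h4, Set.image_image]
    simp [h0]

/-- A smooth family of homogeneous maps with smooth inverses is an ambient isotopy. -/
theorem ambientIsotopic_of_family (F G : ℝ → (Fin 4 → ℝ) → (Fin 4 → ℝ))
    (hF : ∀ s ∈ Set.Icc (0 : ℝ) 1, IsHomogeneous (F s))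
    (hG : ∀ s ∈ Set.Icc (0 : ℝ) 1, IsHomogeneous (G s))
    (hGF : ∀ s ∈ Set.Icc (0 : ℝ) 1, ∀ x, x ≠ 0 → G s (F s x) = x)
    (hFG : ∀ s ∈ Set.Icc (0 : ℝ) 1, ∀ x, x ≠ 0 → F s (G s x) = x)
    (hFs : ContDiffOn ℝ ∞ (fun p : ℝ × (Fin 4 → ℝ) => F p.1 p.2) (Set.Icc 0 1 ×ˢ {0}ᶜ))
    (hGs : ∀ s ∈ Set.Icc (0 : ℝ) 1, ContDiffOn ℝ ∞ (G s) {0}ᶜ)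
    (hF0 : ∀ x, x ≠ 0 → F 0 x = x) {A B : Set RP3}
    (hAB : ∀ (x : Fin 4 → ℝ) (hx : x ≠ 0) (hFx : F 1 x ≠ 0),
      Projectivization.mk ℝ x hx ∈ A ↔ Projectivization.mk ℝ (F 1 x) hFx ∈ B) :
    AmbientIsotopic A B := by
  classical
  let Φ : ℝ → Equiv.Perm RP3 := fun s =>
    if h : s ∈ Set.Icc (0 : ℝ) 1 then projPerm (F s) (G s) (hF s h) (hG s h) (hGF s h) (hFG s h)
    else 1
  have hΦ : ∀ s (h : s ∈ Set.Icc (0 : ℝ) 1),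
      Φ s = projPerm (F s) (G s) (hF s h) (hG s h) (hGF s h) (hFG s h) := fun s h => dif_pos h
  have hI0 : (0 : ℝ) ∈ Set.Icc (0 : ℝ) 1 := by simp
  have hI1 : (1 : ℝ) ∈ Set.Icc (0 : ℝ) 1 := by simp
  refine ⟨Φ, ⟨fun p => F p.1 p.2, hFs, fun s hs x hx => ⟨(hF s hs).ne_zero x hx, ?_⟩⟩,
    fun s hs => ?_, fun P => ?_, ?_⟩
  · simp only [hΦ s hs]; rfl
  · rw [hΦ s hs]
    exact isSmoothMap_projMap (hG s hs) (hGs s hs)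
  · rw [hΦ 0 hI0]
    induction P using Projectivization.ind with
    | h v hv =>
      change Projectivization.mk ℝ (F 0 v) _ = _
      simp only [hF0 v hv]
  · rw [hΦ 1 hI1]
    ext P
    rw [Equiv.image_eq_preimage_symm, Set.mem_preimage]
    obtain ⟨Q, rfl⟩ := (projPerm (F 1) (G 1) (hF 1 hI1) (hG 1 hI1) (hGF 1 hI1)
      (hFG 1 hI1)).surjective P
    rw [Equiv.symm_apply_apply]
    induction Q using Projectivization.ind with
    | h v hv => exact hAB v hv _

/-! ### Linear images of the standard unknots -/

/-- The subset of `ℝP³` determined by a set of homogeneous coordinates. -/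
def projSet (X : Set (Fin 4 → ℝ)) : Set RP3 :=
  {P | ∃ x : Fin 4 → ℝ, ∃ h : x ≠ 0, x ∈ X ∧ P = Projectivization.mk ℝ x h}

theorem mk_mem_projSet {X : Set (Fin 4 → ℝ)} (hX : ∀ (a : ℝ) (x), x ∈ X → a • x ∈ X)
    (x : Fin 4 → ℝ) (hx : x ≠ 0) : Projectivization.mk ℝ x hx ∈ projSet X ↔ x ∈ X := by
  constructor
  · rintro ⟨y, hy, hyX, h⟩
    obtain ⟨a, rfl⟩ := (Projectivization.mk_eq_mk_iff' ℝ x y hx hy).1 h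
    exact hX a y hyX
  · exact fun h => ⟨x, hx, h, rfl⟩

theorem isHomogeneous_of_linear (A : (Fin 4 → ℝ) ≃ₗ[ℝ] (Fin 4 → ℝ)) :
    IsHomogeneous A :=
  ⟨fun x hx => by simpa using hx, fun a x _ _ => by simp⟩

theorem contDiff_of_linear {n m : ℕ} (A : (Fin n → ℝ) →ₗ[ℝ] (Fin m → ℝ)) : ContDiff ℝ ∞ A :=
  (LinearMap.toContinuousLinearMap A).contDiff

/-- The permutation of projective space induced by a linear automorphism. -/
def linPerm (A : (Fin 4 → ℝ) ≃ₗ[ℝ] (Fin 4 → ℝ)) : Equiv.Perm RP3 :=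
  projPerm A A.symm (isHomogeneous_of_linear A) (isHomogeneous_of_linear A.symm)
    (fun x _ => A.symm_apply_apply x) (fun x _ => A.apply_symm_apply x)

theorem linPerm_mk (A : (Fin 4 → ℝ) ≃ₗ[ℝ] (Fin 4 → ℝ)) (x : Fin 4 → ℝ) (hx : x ≠ 0) :
    linPerm A (Projectivization.mk ℝ x hx) =
      Projectivization.mk ℝ (A x) ((isHomogeneous_of_linear A).ne_zero x hx) := rfl

theorem linPerm_mul (A B : (Fin 4 → ℝ) ≃ₗ[ℝ] (Fin 4 → ℝ)) :
    linPerm (A * B) = linPerm A * linPerm B := by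
  ext P
  induction P using Projectivization.ind with
  | h v hv => rfl

theorem AmbientIsotopic.linPerm {X Y : Set RP3} (h : AmbientIsotopic X Y)
    (A : (Fin 4 → ℝ) ≃ₗ[ℝ] (Fin 4 → ℝ)) :
    AmbientIsotopic (linPerm A '' X) (linPerm A '' Y) := by
  obtain ⟨Φ, h1, h2, h3, h4⟩ := h
  have hA : IsSmoothMap (ProjKnot.linPerm A) :=
    isSmoothMap_projMap (isHomogeneous_of_linear A) (contDiff_of_linear A.toLinearMap).contDiffOn
  have hA' : IsSmoothMap (ProjKnot.linPerm A).symm :=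
    isSmoothMap_projMap (isHomogeneous_of_linear A.symm)
      (contDiff_of_linear A.symm.toLinearMap).contDiffOn
  refine ⟨fun t => ProjKnot.linPerm A * Φ t * (ProjKnot.linPerm A)⁻¹,
    (hA.isSmoothFamily_const.comp h1).comp hA'.isSmoothFamily_const,
    fun t ht => hA.comp ((h2 t ht).comp hA'), fun P => ?_, ?_⟩
  · simp [h3]
  · rw [← h4]
    simp [Set.image_image]

/-- A linear automorphism joined to the identity by a smooth path. -/
theorem ambientIsotopic_linPerm_of_path (M N : ℝ → Matrix (Fin 4) (Fin 4) ℝ)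
    (hM : ∀ i j, ContDiff ℝ ∞ fun s => M s i j)
    (hMN : ∀ s ∈ Set.Icc (0 : ℝ) 1, M s * N s = 1) (hM0 : M 0 = 1)
    (A : (Fin 4 → ℝ) ≃ₗ[ℝ] (Fin 4 → ℝ)) (hA : ∀ x, A x = (M 1).mulVec x) (X : Set RP3) :
    AmbientIsotopic X (linPerm A '' X) := by
  have hNM : ∀ s ∈ Set.Icc (0 : ℝ) 1, N s * M s = 1 := fun s hs =>
    mul_eq_one_comm.1 (hMN s hs)
  have key : ∀ P Q : Matrix (Fin 4) (Fin 4) ℝ, P * Q = 1 → IsHomogeneous Q.mulVec := by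
    intro P Q h
    refine ⟨fun x hx h0 => hx ?_, fun a x _ _ => Matrix.mulVec_smul _ _ _⟩
    have := congrArg P.mulVec h0
    simpa [Matrix.mulVec_mulVec, h] using this
  refine ambientIsotopic_of_family (fun s => (M s).mulVec) (fun s => (N s).mulVec)
    (fun s hs => key _ _ (hNM s hs)) (fun s hs => key _ _ (hMN s hs))
    (fun s hs x _ => by simp [Matrix.mulVec_mulVec, hNM s hs])
    (fun s hs x _ => by simp [Matrix.mulVec_mulVec, hMN s hs]) ?_ ?_ ?_ ?_
  · refine ContDiff.contDiffOn (contDiff_pi.2 fun i => ?_)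
    simp only [Matrix.mulVec, dotProduct]
    refine ContDiff.sum fun j _ => ((hM i j).comp contDiff_fst).mul ?_
    exact (contDiff_apply ℝ ℝ j).comp contDiff_snd
  · exact fun s _ => (contDiff_of_linear (Matrix.mulVecLin (N s))).contDiffOn
  · simp [hM0]
  · intro x hx hFx
    have : Projectivization.mk ℝ ((M 1).mulVec x) hFx =
        linPerm A (Projectivization.mk ℝ x hx) := by
      rw [linPerm_mk]
      simp only [hA]
    rw [this, (linPerm A).injective.mem_set_image]

theorem exists_linearEquiv_of_det_ne_zero (M : Matrix (Fin 4) (Fin 4) ℝ) (h : M.det ≠ 0) :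
    ∃ A : (Fin 4 → ℝ) ≃ₗ[ℝ] (Fin 4 → ℝ), ∀ x, A x = M.mulVec x :=
  ⟨Matrix.toLinearEquiv' M (M.invertibleOfIsUnitDet (isUnit_iff_ne_zero.2 h)), fun _ => rfl⟩

/-- A set that is invariant under changes of signs of the coordinates is ambient isotopic to its
images under linear automorphisms. -/
theorem ambientIsotopic_linPerm (X : Set (Fin 4 → ℝ))
    (hX' : ∀ σ : Fin 4 → ℝ, (∀ i, σ i = 1 ∨ σ i = -1) → ∀ x ∈ X, (fun i => σ i * x i) ∈ X)
    (A : (Fin 4 → ℝ) ≃ₗ[ℝ] (Fin 4 → ℝ)) :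
    AmbientIsotopic (linPerm A '' projSet X) (projSet X) := by
  suffices H : ∀ M : Matrix (Fin 4) (Fin 4) ℝ, M.det ≠ 0 →
      ∀ A : (Fin 4 → ℝ) ≃ₗ[ℝ] (Fin 4 → ℝ), (∀ x, A x = M.mulVec x) →
        AmbientIsotopic (linPerm A '' projSet X) (projSet X) by
    refine H (LinearMap.toMatrix' A.toLinearMap) ?_ A fun x => ?_
    · rw [LinearMap.det_toMatrix']
      exact (LinearEquiv.isUnit_det' A).ne_zero
    · rw [LinearMap.toMatrix'_mulVec]; rfl
  intro M hM
  -- Invertible matrices are products of transvections and diagonal matrices. A transvection is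
  -- joined to the identity by scaling its entry, a positive diagonal matrix by a segment. The signs
  -- of the diagonal entries, which obstruct connectedness of the linear group, are absorbed by the
  -- symmetry of `X`.
  refine Matrix.diagonal_transvection_induction_of_det_ne_zero
    (fun M => ∀ A : (Fin 4 → ℝ) ≃ₗ[ℝ] (Fin 4 → ℝ), (∀ x, A x = M.mulVec x) →
        AmbientIsotopic (linPerm A '' projSet X) (projSet X)) M hM ?_ ?_ ?_
  · intro D hD A hA
    have hD' : ∀ i, D i ≠ 0 := by
      rw [Matrix.det_diagonal] at hD
      exact fun i => (Finset.prod_ne_zero_iff.1 hD) i (Finset.mem_univ i)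
    have habs : ∀ i, 0 < |D i| := fun i => abs_pos.2 (hD' i)
    obtain ⟨B, hB⟩ := exists_linearEquiv_of_det_ne_zero (Matrix.diagonal fun i => |D i|) (by
      rw [Matrix.det_diagonal]
      exact Finset.prod_ne_zero_iff.2 fun i _ => (habs i).ne')
    have h1 : linPerm A '' projSet X = linPerm B '' projSet X := by
      have key : ∀ σ : Fin 4 → ℝ, (∀ i, σ i = 1 ∨ σ i = -1) →
          ∀ A B : (Fin 4 → ℝ) ≃ₗ[ℝ] (Fin 4 → ℝ), (∀ x, A x = B (fun i => σ i * x i)) →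
          linPerm A '' projSet X ⊆ linPerm B '' projSet X := by
        rintro σ hσ A B hAB _ ⟨_, ⟨x, hx, hxX, rfl⟩, rfl⟩
        have hne : (fun i => σ i * x i) ≠ 0 := by
          intro h0
          apply hx
          have := hAB x
          rw [h0] at this
          simpa using this
        refine ⟨_, ⟨_, hne, hX' σ hσ x hxX, rfl⟩, ?_⟩
        simp only [linPerm_mk, hAB]
      have hσ : ∀ i, SignType.sign (D i) = (1 : ℝ) ∨ SignType.sign (D i) = (-1 : ℝ) := by
        intro i
        rcases lt_or_gt_of_ne (hD' i) with h | h
        · right; simp [sign_neg h]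
        · left; simp [sign_pos h]
      have hsg : ∀ i, |D i| * (SignType.sign (D i) : ℝ) = D i := fun i => by
        rw [mul_comm]; exact sign_mul_abs (D i)
      have hsg' : ∀ i, D i * (SignType.sign (D i) : ℝ) = |D i| := fun i => self_mul_sign (D i)
      refine Set.Subset.antisymm (key (fun i => SignType.sign (D i)) hσ A B fun x => ?_)
        (key (fun i => SignType.sign (D i)) hσ B A fun x => ?_)
      · rw [hA, hB]; ext i
        rw [Matrix.mulVec_diagonal, Matrix.mulVec_diagonal, ← mul_assoc, hsg]
      · rw [hA, hB]; ext i
        rw [Matrix.mulVec_diagonal, Matrix.mulVec_diagonal, ← mul_assoc, hsg']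
    rw [h1]
    have hpos : ∀ s ∈ Set.Icc (0 : ℝ) 1, ∀ i, 1 + s * (|D i| - 1) ≠ 0 := by
      intro s hs i
      have := habs i
      rcases eq_or_lt_of_le hs.1 with h | h
      · simp [← h]
      · nlinarith [hs.2, mul_pos h this]
    refine (ambientIsotopic_linPerm_of_path
      (fun s => Matrix.diagonal fun i => 1 + s * (|D i| - 1))
      (fun s => Matrix.diagonal fun i => (1 + s * (|D i| - 1))⁻¹) ?_ ?_ ?_ B ?_ _).symm
    · intro i j
      by_cases hij : i = j
      · subst hij
        simp only [Matrix.diagonal_apply_eq]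
        fun_prop
      · simp only [Matrix.diagonal_apply_ne _ hij]
        fun_prop
    · intro s hs
      rw [Matrix.diagonal_mul_diagonal]
      simp [mul_inv_cancel₀ (hpos s hs _)]
    · simp
    · intro x
      rw [hB]
      simp
  · intro t A hA
    refine (ambientIsotopic_linPerm_of_path
      (fun s => Matrix.transvection t.i t.j (s * t.c))
      (fun s => Matrix.transvection t.i t.j (-(s * t.c))) ?_ ?_ ?_ A ?_ _).symm
    · intro i j
      simp only [Matrix.transvection, Matrix.add_apply, Matrix.single_apply]
      split_ifs <;> fun_prop
    · intro s _
      rw [Matrix.transvection_mul_transvection_same _ _ t.hij]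
      simp
    · simp
    · intro x
      rw [hA]
      simp [Matrix.TransvectionStruct.toMatrix]
  · intro P Q hP hQ hP' hQ' A hA
    obtain ⟨B, hB⟩ := exists_linearEquiv_of_det_ne_zero P hP
    obtain ⟨C, hC⟩ := exists_linearEquiv_of_det_ne_zero Q hQ
    have hABC : A = B * C := by
      ext1 x
      rw [hA]
      change _ = B (C x)
      rw [hB, hC, Matrix.mulVec_mulVec]
    rw [hABC, linPerm_mul, Equiv.Perm.coe_mul, Set.image_comp]
    exact ((hQ' C hC).linPerm B).trans (hP' B hB)

theorem planarCircle_eq_projSet :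
    planarCircle = projSet {v | v 2 = 0 ∧ v 0 ^ 2 + v 1 ^ 2 = v 3 ^ 2} := by
  ext P
  induction P using Projectivization.ind with
  | h v hv =>
    rw [mk_mem_projSet]
    · simp only [planarCircle, Set.mem_ofPred_eq, Projectivization.submodule_mk]
      constructor
      · exact fun h => h v (Submodule.mem_span_singleton_self v)
      · intro h w hw
        obtain ⟨a, rfl⟩ := Submodule.mem_span_singleton.1 hw
        refine ⟨by simp [h.1], ?_⟩
        simp only [Pi.smul_apply, smul_eq_mul]
        linear_combination a ^ 2 * h.2
    · rintro a x ⟨h1, h2⟩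
      refine ⟨by simp [h1], ?_⟩
      simp only [Pi.smul_apply, smul_eq_mul]
      linear_combination a ^ 2 * h2

theorem projectiveLine_eq_projSet :
    projectiveLine = projSet {v | v 1 = 0 ∧ v 2 = 0} := by
  ext P
  induction P using Projectivization.ind with
  | h v hv =>
    rw [mk_mem_projSet]
    · simp only [projectiveLine, Set.mem_ofPred_eq, Projectivization.submodule_mk]
      constructor
      · exact fun h => h v (Submodule.mem_span_singleton_self v)
      · intro h w hw
        obtain ⟨a, rfl⟩ := Submodule.mem_span_singleton.1 hw
        exact ⟨by simp [h.1], by simp [h.2]⟩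
    · rintro a x ⟨h1, h2⟩
      exact ⟨by simp [h1], by simp [h2]⟩

theorem ambientIsotopic_linPerm_planarCircle (A : (Fin 4 → ℝ) ≃ₗ[ℝ] (Fin 4 → ℝ)) :
    AmbientIsotopic (linPerm A '' planarCircle) planarCircle := by
  rw [planarCircle_eq_projSet]
  refine ambientIsotopic_linPerm _ ?_ A
  · rintro σ hσ x ⟨h1, h2⟩
    have h : ∀ i, σ i ^ 2 = 1 := fun i => by rcases hσ i with h | h <;> simp [h]
    exact ⟨by simp [h1], by simp only [mul_pow, h, one_mul]; exact h2⟩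

theorem ambientIsotopic_linPerm_projectiveLine (A : (Fin 4 → ℝ) ≃ₗ[ℝ] (Fin 4 → ℝ)) :
    AmbientIsotopic (linPerm A '' projectiveLine) projectiveLine := by
  rw [projectiveLine_eq_projSet]
  refine ambientIsotopic_linPerm _ ?_ A
  · rintro σ hσ x ⟨h1, h2⟩
    exact ⟨by simp [h1], by simp [h2]⟩

/-! ### Homogeneous perturbations of the identity -/

section Homogenize

variable {E : Type*} [NormedAddCommGroup E] [InnerProductSpace ℝ E]

/-- The extension of the restriction of `φ` to the unit sphere that is positively homogeneous of
degree one. -/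
def homogenize (φ : E → E) (x : E) : E := ‖x‖ • φ (‖x‖⁻¹ • x)

theorem norm_smul_inv_norm_smul (x : E) : ‖x‖ • ‖x‖⁻¹ • x = x := by
  rcases eq_or_ne x 0 with rfl | hx
  · simp
  · rw [smul_smul, mul_inv_cancel₀ (norm_ne_zero_iff.2 hx), one_smul]

theorem inv_norm_smul_mem_closedBall (x : E) : ‖x‖⁻¹ • x ∈ closedBall (0 : E) 1 := by
  rw [mem_closedBall_zero_iff, norm_smul, norm_inv, norm_norm]
  exact inv_mul_le_one

/-- Split the difference into a change of radius in a fixed direction and a change of direction at a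
fixed radius. The first costs `κ`. The second costs `2 * κ`, because `‖y‖ * ‖u - v‖ ≤ 2 * ‖x - y‖`
for the normalized vectors `u` and `v`. -/
theorem lipschitzWith_homogenize {φ : E → E} {κ : ℝ≥0}
    (h₁ : ∀ x ∈ closedBall (0 : E) 1, ‖φ x‖ ≤ κ)
    (h₂ : LipschitzOnWith κ φ (closedBall 0 1)) : LipschitzWith (3 * κ) (homogenize φ) := by
  refine LipschitzWith.of_dist_le_mul fun x y => ?_
  simp only [dist_eq_norm, homogenize]
  set u := ‖x‖⁻¹ • x with hu
  set v := ‖y‖⁻¹ • y with hv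
  have hxu : ‖x‖ • u = x := norm_smul_inv_norm_smul x
  have hyv : ‖y‖ • v = y := norm_smul_inv_norm_smul y
  have hu1 := inv_norm_smul_mem_closedBall x
  have hv1 := inv_norm_smul_mem_closedBall y
  have hun : ‖u‖ ≤ 1 := mem_closedBall_zero_iff.1 hu1
  have e1 : ‖x‖ • φ u - ‖y‖ • φ v = (‖x‖ - ‖y‖) • φ u + ‖y‖ • (φ u - φ v) := by
    module
  have e2 : ‖y‖ • (u - v) = (‖y‖ - ‖x‖) • u + (x - y) := by
    rw [smul_sub, hyv, sub_smul, hxu]; abel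
  have h3 : ‖y‖ * ‖u - v‖ ≤ 2 * ‖x - y‖ := by
    calc ‖y‖ * ‖u - v‖ = ‖‖y‖ • (u - v)‖ := by rw [norm_smul, norm_norm]
      _ ≤ |‖y‖ - ‖x‖| * ‖u‖ + ‖x - y‖ := by
        rw [e2]; refine (norm_add_le _ _).trans ?_
        rw [norm_smul, Real.norm_eq_abs]
      _ ≤ ‖x - y‖ * 1 + ‖x - y‖ := by
        gcongr
        rw [norm_sub_rev]; exact abs_norm_sub_norm_le y x
      _ = 2 * ‖x - y‖ := by ring
  have h4 : ‖φ u - φ v‖ ≤ κ * ‖u - v‖ := by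
    have := h₂.dist_le_mul _ hu1 _ hv1
    rwa [dist_eq_norm, dist_eq_norm] at this
  calc ‖‖x‖ • φ u - ‖y‖ • φ v‖ ≤ |‖x‖ - ‖y‖| * ‖φ u‖ + ‖y‖ * ‖φ u - φ v‖ := by
        rw [e1]; refine (norm_add_le _ _).trans ?_
        rw [norm_smul, norm_smul, norm_norm, Real.norm_eq_abs]
    _ ≤ ‖x - y‖ * κ + ‖y‖ * (κ * ‖u - v‖) := by
        gcongr
        · exact abs_norm_sub_norm_le x y
        · exact h₁ _ hu1
    _ = ‖x - y‖ * κ + κ * (‖y‖ * ‖u - v‖) := by ring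
    _ ≤ ‖x - y‖ * κ + κ * (2 * ‖x - y‖) := by gcongr
    _ = ↑(3 * κ) * ‖x - y‖ := by push_cast; ring

theorem homogenize_smul {φ : E → E} (hφ : ∀ x, φ (-x) = -φ x) (a : ℝ) (ha : a ≠ 0) (x : E) :
    homogenize φ (a • x) = a • homogenize φ x := by
  simp only [homogenize, norm_smul, Real.norm_eq_abs, mul_inv]
  rcases lt_or_gt_of_ne ha with h | h
  · have : (|a|⁻¹ * ‖x‖⁻¹) • a • x = -(‖x‖⁻¹ • x) := by
      rw [abs_of_neg h, smul_smul, ← neg_smul]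
      congr 1
      field_simp
    rw [this, hφ, abs_of_neg h]
    module
  · have : (|a|⁻¹ * ‖x‖⁻¹) • a • x = ‖x‖⁻¹ • x := by
      rw [abs_of_pos h, smul_smul]
      congr 1
      field_simp
    rw [this, abs_of_pos h]
    module

theorem contDiffAt_homogenize {φ : E → E} (hφ : ContDiff ℝ ∞ φ) {x : E} (hx : x ≠ 0) :
    ContDiffAt ℝ ∞ (homogenize φ) x := by
  have h1 : ContDiffAt ℝ ∞ (fun y : E => ‖y‖) x := contDiffAt_norm ℝ hx
  exact h1.smul (hφ.contDiffAt.comp x ((h1.inv (norm_ne_zero_iff.2 hx)).smul contDiffAt_id))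

theorem homogenize_const_smul (φ : E → E) (s : ℝ) (x : E) :
    homogenize (fun y => s • φ y) x = s • homogenize φ x := by
  simp only [homogenize]
  rw [smul_comm]

theorem homogenize_zero_vec (φ : E → E) : homogenize φ 0 = 0 := by simp [homogenize]

/-- A small homogeneous perturbation of the identity is a diffeomorphism outside the origin. -/
theorem exists_inverse_add_homogenize [CompleteSpace E] {φ : E → E} {κ : ℝ≥0}
    (hφ : ContDiff ℝ ∞ φ) (h₁ : ∀ x ∈ closedBall (0 : E) 1, ‖φ x‖ ≤ κ)
    (h₂ : LipschitzOnWith κ φ (closedBall 0 1)) (hκ : 3 * κ < 1) :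
    ∃ G : E → E, (∀ x, G (x + homogenize φ x) = x) ∧ (∀ x, G x + homogenize φ (G x) = x) ∧
      ContDiffOn ℝ ∞ G {0}ᶜ := by
  have hlip := lipschitzWith_homogenize h₁ h₂
  set H : E → E := fun x => x + homogenize φ x with hH
  have happ : ApproximatesLinearOn H (ContinuousLinearEquiv.refl ℝ E : E →L[ℝ] E) Set.univ
      (3 * κ) := by
    intro x _ y _
    have := hlip.dist_le_mul x y
    rw [dist_eq_norm, dist_eq_norm] at this
    simpa [hH, add_sub_add_comm] using this
  have hc : Subsingleton E ∨
      3 * κ < ‖((ContinuousLinearEquiv.refl ℝ E).symm : E →L[ℝ] E)‖₊⁻¹ := by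
    rcases subsingleton_or_nontrivial E with h | h
    · exact Or.inl h
    · right
      have : ‖((ContinuousLinearEquiv.refl ℝ E).symm : E →L[ℝ] E)‖₊ = 1 := by
        simp
      rw [this, inv_one]; exact hκ
  let e := happ.toHomeomorph H hc
  have he : ∀ x, e x = H x := fun x => rfl
  refine ⟨e.symm, fun x => e.symm_apply_apply x, fun x => e.apply_symm_apply x, fun y hy => ?_⟩
  have hx0 : e.symm y ≠ 0 := by
    intro h0
    apply hy
    have := e.apply_symm_apply y
    rw [h0, he] at this
    rw [Set.mem_singleton_iff, ← this]
    simp [hH, homogenize_zero_vec]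
  have hd := contDiffAt_homogenize hφ hx0
  have hd' : HasFDerivAt (homogenize φ) (fderiv ℝ (homogenize φ) (e.symm y)) (e.symm y) :=
    (hd.differentiableAt (by simp)).hasFDerivAt
  have hT : ‖-fderiv ℝ (homogenize φ) (e.symm y)‖ < 1 := by
    rw [norm_neg]
    refine lt_of_le_of_lt (hd'.le_of_lipschitz hlip) ?_
    exact_mod_cast hκ
  -- The Lipschitz bound makes the derivative of the perturbation smaller than one in norm, so the
  -- derivative of the sum is invertible by the Neumann series. Hence the inverse homeomorphism is
  -- smooth.
  let U := ContinuousLinearEquiv.ofUnit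
    (Units.oneSub (-fderiv ℝ (homogenize φ) (e.symm y)) hT)
  have hU : (U : E →L[ℝ] E) =
      ContinuousLinearMap.id ℝ E + fderiv ℝ (homogenize φ) (e.symm y) := by
    ext v
    change ((Units.oneSub (-fderiv ℝ (homogenize φ) (e.symm y)) hT : (E →L[ℝ] E)ˣ) :
      E →L[ℝ] E) v = _
    simp
  refine ContDiffAt.contDiffWithinAt ?_
  refine OpenPartialHomeomorph.contDiffAt_symm e.toOpenPartialHomeomorph (f₀' := U) (a := y)
    (by simp) ?_ ?_
  · rw [hU]
    exact (hasFDerivAt_id _).add hd'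
  · exact contDiffAt_id.add hd

end Homogenize

/-! ### Extension of functions from an embedded curve -/

theorem equivariant_int {E : Type*} [AddCommGroup E] [Module ℝ E] {ε : ℝ} (hε : ε = 1 ∨ ε = -1)
    {f : ℝ → E} (hf : ∀ t, f (t + 1) = ε • f t) (k : ℤ) (t : ℝ) : f (t + k) = ε ^ k • f t := by
  have hε0 : ε ≠ 0 := by rcases hε with h | h <;> simp [h]
  induction k using Int.induction_on generalizing t with
  | zero => simp
  | succ n ih =>
    rw [zpow_add_one₀ hε0, mul_comm, mul_smul, ← ih, ← hf]
    push_cast; ring_nf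
  | pred n ih =>
    have h1 := hf (t + ((-(n : ℤ) - 1 : ℤ) : ℝ))
    have h2 : t + ((-(n : ℤ) - 1 : ℤ) : ℝ) + 1 = t + ((-(n : ℤ) : ℤ) : ℝ) := by push_cast; ring
    rw [h2, ih] at h1
    rw [zpow_sub_one₀ hε0, mul_comm, mul_smul, h1, smul_smul, inv_mul_cancel₀ hε0, one_smul]

theorem zpow_eq_one_or_neg_one {ε : ℝ} (hε : ε = 1 ∨ ε = -1) (k : ℤ) :
    ε ^ k = 1 ∨ ε ^ k = -1 := by
  rcases hε with rfl | rfl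
  · simp
  · rcases Int.even_or_odd k with h | h
    · left; exact h.neg_one_zpow
    · right; exact h.neg_one_zpow

section Extension

variable {E : Type*} [NormedAddCommGroup E] [InnerProductSpace ℝ E]

/-- Orthogonal projection to the tangent direction at `t₀`, restricted to the curve, has nonzero
derivative at `t₀`. Its local inverse recovers the parameter from the position. -/
theorem exists_local_parameter {γ : ℝ → E} (hγ : ContDiff ℝ ∞ γ) {t₀ : ℝ}
    (hd : deriv γ t₀ ≠ 0) :
    ∃ η > 0, ∃ θ : E → ℝ, ∃ U : Set E, IsOpen U ∧ γ t₀ ∈ U ∧ ContDiffOn ℝ ∞ θ U ∧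
      ∀ t, |t - t₀| < η → θ (γ t) = t := by
  set ψ : ℝ → ℝ := fun t => ⟪deriv γ t₀, γ t⟫ with hψ
  have hψs : ContDiff ℝ ∞ ψ := contDiff_const.inner ℝ hγ
  have hψd : HasDerivAt ψ (deriv ψ t₀) t₀ := (hψs.differentiable (by simp) t₀).hasDerivAt
  have hψ0 : deriv ψ t₀ ≠ 0 := by
    have h1 : HasDerivAt γ (deriv γ t₀) t₀ := (hγ.differentiable (by simp) t₀).hasDerivAt
    have h2 := (hasDerivAt_const t₀ (deriv γ t₀)).inner ℝ h1
    rw [h2.deriv]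
    simpa using hd
  let e := ContDiffAt.toOpenPartialHomeomorph ψ hψs.contDiffAt
    (hψd.hasFDerivAt_equiv hψ0) (n := ∞) (by simp)
  have he : ∀ t, e t = ψ t := fun t => rfl
  have hsrc : t₀ ∈ e.source :=
    ContDiffAt.mem_toOpenPartialHomeomorph_source hψs.contDiffAt
      (hψd.hasFDerivAt_equiv hψ0) (n := ∞) (by simp)
  have hcont : Continuous (deriv ψ) := hψs.continuous_deriv (by simp)
  have hnb : e.source ∩ {t | deriv ψ t ≠ 0} ∈ 𝓝 t₀ :=
    Filter.inter_mem (e.open_source.mem_nhds hsrc)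
      ((isOpen_ne.preimage hcont).mem_nhds hψ0)
  obtain ⟨η, hη, hball⟩ := Metric.mem_nhds_iff.1 hnb
  have hopen : IsOpen (e '' ball t₀ η) :=
    e.isOpen_image_of_subset_source isOpen_ball fun t ht => (hball ht).1
  refine ⟨η, hη, fun x => e.symm ⟪deriv γ t₀, x⟫, (fun x => ⟪deriv γ t₀, x⟫) ⁻¹' (e '' ball t₀ η),
    hopen.preimage (by fun_prop), ⟨t₀, mem_ball_self hη, rfl⟩, ?_, ?_⟩
  · rintro x ⟨t, ht, hx⟩
    have hx' : ψ t = ⟪deriv γ t₀, x⟫ := hx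
    refine ContDiffAt.contDiffWithinAt ?_
    refine ContDiffAt.comp x (g := e.symm) ?_ (contDiffAt_const.inner ℝ contDiffAt_id)
    have hs : e.symm ⟪deriv γ t₀, x⟫ = t := by
      rw [← hx', ← he, e.left_inv (hball ht).1]
    refine e.contDiffAt_symm_deriv (f₀' := deriv ψ t) (hball ht).2 ?_ ?_ ?_
    · rw [← hx', ← he]; exact e.map_source (hball ht).1
    · rw [hs]; exact (hψs.differentiable (by simp) t).hasDerivAt
    · rw [hs]; exact hψs.contDiffAt
  · intro t ht
    exact e.left_inv (hball (by rwa [mem_ball, Real.dist_eq])).1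

/-- Modulo the period, the pairs `(σ, t)` with a distant parameter or the wrong sign form a compact
set. Embeddedness keeps its image away from `σ₀ • γ t₀`, so the complement of the image is the
neighbourhood sought. -/
theorem exists_nhds_eq_smul {ε : ℝ} (hε : ε = 1 ∨ ε = -1) {γ : ℝ → E} (hγ : Continuous γ)
    (hper : ∀ t, γ (t + 1) = ε • γ t) (hne : ∀ t, γ t ≠ 0)
    (hinj : ∀ s t, (γ s = γ t ∨ γ s = -γ t) → ∃ k : ℤ, s = t + k)
    (t₀ : ℝ) {σ₀ : ℝ} (hσ₀ : σ₀ = 1 ∨ σ₀ = -1) {η : ℝ} (hη : 0 < η) :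
    ∃ U ∈ 𝓝 (σ₀ • γ t₀), ∀ σ t, (σ = 1 ∨ σ = -1) → σ • γ t ∈ U →
      ∃ k : ℤ, |t + k - t₀| < η ∧ σ = σ₀ * ε ^ k := by
  set I := Set.Icc (t₀ - 1 / 2) (t₀ + 1 / 2)
  set S : Set (ℝ × ℝ) := (({1, -1} : Set ℝ) ×ˢ (I ∩ {t | η ≤ |t - t₀|})) ∪ ({-σ₀} ×ˢ I) with hS
  have hSc : IsCompact S := by
    refine IsCompact.union (IsCompact.prod (Set.toFinite _).isCompact ?_)
      (isCompact_singleton.prod isCompact_Icc)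
    exact isCompact_Icc.inter_right (isClosed_le continuous_const (by fun_prop))
  have hf : Continuous fun p : ℝ × ℝ => p.1 • γ p.2 :=
    continuous_fst.smul (hγ.comp continuous_snd)
  have hK := (hSc.image hf).isClosed
  have hx0 : σ₀ • γ t₀ ∉ (fun p : ℝ × ℝ => p.1 • γ p.2) '' S := by
    rintro ⟨⟨σ, t⟩, hst, h⟩
    simp only at h
    have hσ : σ = 1 ∨ σ = -1 := by
      rcases hst with h | h
      · simpa using h.1
      · have h' : σ = -σ₀ := by simpa using h.1
        rcases hσ₀ with h2 | h2 <;> rw [h', h2] <;> simp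
    have htI : t ∈ I := by rcases hst with h | h; exacts [h.2.1, h.2]
    have : γ t = γ t₀ ∨ γ t = -γ t₀ := by
      rcases hσ with rfl | rfl <;> rcases hσ₀ with rfl | rfl
      · left; simpa using h
      · right; simpa using h
      · right
        have h' : -γ t = γ t₀ := by simpa using h
        rw [← h', neg_neg]
      · left; simpa using h
    obtain ⟨k, hk⟩ := hinj t t₀ this
    have hk0 : k = 0 := by
      have h1 : (k : ℝ) ≤ 1 / 2 := by have := htI.2; linarith
      have h2 : -(1 / 2) ≤ (k : ℝ) := by have := htI.1; linarith
      have h3 : (k : ℝ) < 1 := by linarith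
      have h4 : (-1 : ℝ) < k := by linarith
      have h5 : k < 1 := by exact_mod_cast h3
      have h6 : -1 < k := by exact_mod_cast h4
      omega
    have htt : t = t₀ := by rw [hk, hk0]; simp
    subst htt
    rcases hst with h3 | h3
    · have : η ≤ |t - t| := h3.2.2
      simp at this; linarith
    · have h' : σ = -σ₀ := by simpa using h3.1
      rw [h'] at h
      have h4 : (σ₀ + σ₀) • γ t = 0 := by
        rw [add_smul]; nth_rewrite 1 [← h]; rw [← add_smul]; simp
      have h5 : σ₀ + σ₀ = 0 := (smul_eq_zero.1 h4).resolve_right (hne t)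
      rcases hσ₀ with h6 | h6 <;> rw [h6] at h5 <;> norm_num at h5
  refine ⟨_, hK.isOpen_compl.mem_nhds hx0, fun σ t hσ hU => ?_⟩
  -- This shift moves `t` into the period centred at `t₀`, at the price of the sign `ε ^ k`.
  set k : ℤ := round (t₀ - t) with hk
  have hround : |t₀ - t - k| ≤ 1 / 2 := abs_sub_round (t₀ - t)
  obtain ⟨hr1, hr2⟩ := abs_le.1 hround
  have hkI : t + k ∈ I := ⟨by linarith, by linarith⟩
  have hεk := zpow_eq_one_or_neg_one hε k
  have hεk2 : ε ^ k * ε ^ k = 1 := by rcases hεk with h | h <;> rw [h] <;> norm_num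
  have hval : (σ * ε ^ k) • γ (t + k) = σ • γ t := by
    rw [equivariant_int hε hper, smul_smul, mul_assoc, hεk2, mul_one]
  have hpm : σ * ε ^ k = 1 ∨ σ * ε ^ k = -1 := by
    rcases hσ with rfl | rfl <;> rcases hεk with h | h <;> rw [h] <;> norm_num
  refine ⟨k, ?_, ?_⟩
  · by_contra hcon
    exact hU ⟨(σ * ε ^ k, t + k), Or.inl ⟨by simpa using hpm, hkI, not_lt.1 hcon⟩, hval⟩
  · by_contra hcon
    have h1 : σ * ε ^ k = -σ₀ := by
      have h2 : σ * ε ^ k ≠ σ₀ := by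
        intro h; apply hcon; rw [← h, mul_assoc, hεk2, mul_one]
      rcases hpm with h | h <;> rcases hσ₀ with h' | h' <;>
        first | exact absurd (h.trans h'.symm) h2 | linarith
    exact hU ⟨(σ * ε ^ k, t + k), Or.inr ⟨by simpa using h1, hkI⟩, hval⟩

/-- Values are prescribed along both `γ` and `-γ`, and at each point the prescription is a convex
condition, so local solutions can be glued by a partition of unity. Near the curve a local solution
reads the parameter off with `exists_local_parameter`; elsewhere zero will do. Oddness is what will
let the extension act on projective space. -/
theorem exists_odd_extension [FiniteDimensional ℝ E] {ε : ℝ} (hε : ε = 1 ∨ ε = -1) {γ : ℝ → E}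
    (hγ : ContDiff ℝ ∞ γ) (hper : ∀ t, γ (t + 1) = ε • γ t) (hne : ∀ t, γ t ≠ 0)
    (hd : ∀ t, deriv γ t ≠ 0)
    (hinj : ∀ s t, (γ s = γ t ∨ γ s = -γ t) → ∃ k : ℤ, s = t + k)
    {Γ : ℝ × ℝ → E} (hΓ : ContDiff ℝ ∞ Γ) (hΓper : ∀ τ t, Γ (τ, t + 1) = ε • Γ (τ, t)) :
    ∃ g : ℝ × E → E, ContDiff ℝ ∞ g ∧ (∀ τ t, g (τ, γ t) = Γ (τ, t)) ∧
      ∀ τ x, g (τ, -x) = -g (τ, x) := by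
  let C : ℝ × E → Set E := fun p =>
    {y | ∀ σ t : ℝ, (σ = 1 ∨ σ = -1) → p.2 = σ • γ t → y = σ • Γ (p.1, t)}
  have hC : ∀ p, Convex ℝ (C p) := by
    intro p y₁ h₁ y₂ h₂ a b _ _ hab σ t hσ hp
    rw [h₁ σ t hσ hp, h₂ σ t hσ hp, ← add_smul, hab, one_smul]
  have hloc : ∀ p : ℝ × E, ∃ U ∈ 𝓝 p, ∃ g : ℝ × E → E, ContDiffOn ℝ ∞ g U ∧ ∀ q ∈ U, g q ∈ C q := by
    rintro ⟨τ₀, x₀⟩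
    by_cases hx : ∃ σ₀ t₀ : ℝ, (σ₀ = 1 ∨ σ₀ = -1) ∧ x₀ = σ₀ • γ t₀
    · obtain ⟨σ₀, t₀, hσ₀, rfl⟩ := hx
      obtain ⟨η, hη, θ, U, hUo, hU, hθ, hθγ⟩ := exists_local_parameter hγ (hd t₀)
      obtain ⟨V, hV, hVγ⟩ := exists_nhds_eq_smul hε hγ.continuous hper hne hinj t₀ hσ₀ hη
      have hσσ : σ₀ * σ₀ = 1 := by rcases hσ₀ with h | h <;> rw [h] <;> norm_num
      have hcs : Continuous fun p : ℝ × E => σ₀ • p.2 := continuous_snd.const_smul σ₀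
      refine ⟨(fun p : ℝ × E => σ₀ • p.2) ⁻¹' U ∩ Prod.snd ⁻¹' V, Filter.inter_mem
        ((hUo.preimage hcs).mem_nhds ?_) (continuous_snd.continuousAt.preimage_mem_nhds hV),
        fun p => σ₀ • Γ (p.1, θ (σ₀ • p.2)), ?_, ?_⟩
      · simpa [smul_smul, hσσ] using hU
      · refine ContDiffOn.const_smul σ₀ (hΓ.comp_contDiffOn (contDiffOn_fst.prodMk ?_))
        exact hθ.comp (contDiff_snd.const_smul σ₀).contDiffOn fun p hp => hp.1
      · rintro ⟨τ, x⟩ ⟨hqU, hqV⟩ σ t hσ hx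
        simp only at hx hqV ⊢
        subst hx
        obtain ⟨k, hk, hσk⟩ := hVγ σ t hσ hqV
        have hεk := zpow_eq_one_or_neg_one hε k
        have hεk2 : ε ^ k * ε ^ k = 1 := by rcases hεk with h | h <;> rw [h] <;> norm_num
        have e1 : σ₀ • σ • γ t = γ (t + k) := by
          rw [equivariant_int hε hper, smul_smul, hσk, ← mul_assoc, hσσ, one_mul]
        rw [e1, hθγ _ hk, equivariant_int hε (f := fun t => Γ (τ, t)) (hΓper τ), smul_smul, ← hσk]
    · set S : Set E := (fun p : ℝ × ℝ => p.1 • γ p.2) '' (({1, -1} : Set ℝ) ×ˢ Set.Icc 0 1)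
      have hSc : IsClosed S := by
        refine (IsCompact.image ((Set.toFinite _).isCompact.prod isCompact_Icc) ?_).isClosed
        exact continuous_fst.smul (hγ.continuous.comp continuous_snd)
      have hmem : ∀ σ t : ℝ, (σ = 1 ∨ σ = -1) → σ • γ t ∈ S := by
        intro σ t hσ
        have h1 : γ t = ε ^ ⌊t⌋ • γ (Int.fract t) := by
          rw [← equivariant_int hε hper, Int.fract_add_floor]
        refine ⟨(σ * ε ^ ⌊t⌋, Int.fract t), ⟨?_, Int.fract_nonneg t, (Int.fract_lt_one t).le⟩, ?_⟩
        · have hεk := zpow_eq_one_or_neg_one hε ⌊t⌋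
          rcases hσ with rfl | rfl <;> rcases hεk with h | h <;> rw [h] <;> norm_num
        · simp only [mul_smul]
          rw [← h1]
      have hxS : x₀ ∉ S := by
        rintro ⟨⟨σ, t⟩, ⟨h1, h2⟩, h3⟩
        exact hx ⟨σ, t, by simpa using h1, h3.symm⟩
      refine ⟨Prod.snd ⁻¹' Sᶜ, (hSc.isOpen_compl.preimage continuous_snd).mem_nhds hxS,
        fun _ => 0, contDiffOn_const, ?_⟩
      intro q hq σ t hσ hqx
      exact absurd (hqx ▸ hmem σ t hσ) hq
  obtain ⟨g, hg⟩ := exists_contMDiffMap_forall_mem_convex_of_local (n := (⊤ : ℕ∞))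
    (modelWithCornersSelf ℝ (ℝ × E)) (t := C) hC (fun p => by
      obtain ⟨U, hU, f, hf, hfC⟩ := hloc p
      exact ⟨U, hU, f, contMDiffOn_iff_contDiffOn.2 hf, hfC⟩)
  have hgs : ContDiff ℝ ∞ g := contMDiff_iff_contDiff.1 g.contMDiff
  -- The prescribed values at opposite points are already opposite, so taking the odd part does not
  -- change them.
  refine ⟨fun p => (2⁻¹ : ℝ) • (g p - g (p.1, -p.2)), ?_, fun τ t => ?_, fun τ x => ?_⟩
  · exact (hgs.sub (hgs.comp (contDiff_fst.prodMk contDiff_snd.neg))).const_smul _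
  · have h1 := hg (τ, γ t) 1 t (Or.inl rfl) (by simp)
    have h2 := hg (τ, -γ t) (-1) t (Or.inr rfl) (by simp)
    simp only at h1 h2 ⊢
    rw [h1, h2]
    module
  · simp only [neg_neg]
    module

end Extension

/-! ### Isotopy extension for curves in projective space -/

/-- `γ` is a lift to homogeneous coordinates of an embedded closed curve in `ℝP³`. -/
structure IsClosedCurve (ε : ℝ) (γ : ℝ → Fin 4 → ℝ) : Prop where
  smooth : ContDiff ℝ ∞ γ
  periodic : ∀ t, γ (t + 1) = ε • γ t
  ne_zero : ∀ t, γ t ≠ 0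
  immersed : ∀ (t a : ℝ), deriv γ t ≠ a • γ t
  inj : ∀ s t a : ℝ, γ s = a • γ t → ∃ k : ℤ, s = t + k

/-- The subset of `ℝP³` traced by a curve given in homogeneous coordinates. -/
def curveSet (γ : ℝ → Fin 4 → ℝ) : Set RP3 :=
  {P | ∃ t, ∃ h : γ t ≠ 0, P = Projectivization.mk ℝ (γ t) h}

/-- The isotopy is `x + s • homogenize φ x` for `s` from 0 to 1. Oddness makes each stage commute
with negative scalars as well, so that it descends to projective space; the bound on `κ` makes each
stage invertible. -/
theorem ambientIsotopic_of_homogenize {φ : EuclideanSpace ℝ (Fin 4) → EuclideanSpace ℝ (Fin 4)}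
    {κ : ℝ≥0} (hφ : ContDiff ℝ ∞ φ) (hodd : ∀ x, φ (-x) = -φ x)
    (h₁ : ∀ x ∈ closedBall (0 : EuclideanSpace ℝ (Fin 4)) 1, ‖φ x‖ ≤ κ)
    (h₂ : LipschitzOnWith κ φ (closedBall 0 1)) (hκ : 3 * κ < 1) {γ γ' : ℝ → Fin 4 → ℝ}
    (hγ : ∀ t, γ t ≠ 0) (hγ' : ∀ t, WithLp.toLp 2 (γ t) + homogenize φ (WithLp.toLp 2 (γ t)) =
      WithLp.toLp 2 (γ' t)) :
    AmbientIsotopic (curveSet γ) (curveSet γ') := by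
  let L : EuclideanSpace ℝ (Fin 4) ≃L[ℝ] (Fin 4 → ℝ) := EuclideanSpace.equiv (Fin 4) ℝ
  have key : ∀ s : ℝ, ∃ G : EuclideanSpace ℝ (Fin 4) → EuclideanSpace ℝ (Fin 4),
      s ∈ Set.Icc (0 : ℝ) 1 → (∀ x, G (x + s • homogenize φ x) = x) ∧
        (∀ x, G x + s • homogenize φ (G x) = x) ∧ ContDiffOn ℝ ∞ G {0}ᶜ := by
    intro s
    by_cases hs : s ∈ Set.Icc (0 : ℝ) 1
    · have hs1 : ‖s‖₊ ≤ 1 := by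
        rw [← NNReal.coe_le_coe, coe_nnnorm, Real.norm_of_nonneg hs.1]
        exact hs.2
      obtain ⟨G, hG⟩ := exists_inverse_add_homogenize (φ := fun y => s • φ y) (κ := κ)
        (hφ.const_smul s) (fun x hx => by
          rw [norm_smul]
          have h3 : ‖s‖ ≤ 1 := hs1
          calc ‖s‖ * ‖φ x‖ ≤ 1 * κ := by
                gcongr
                exact h₁ x hx
            _ = κ := one_mul _) (by
          refine LipschitzOnWith.weaken (K := ‖s‖₊ * κ) ?_ (by
            calc ‖s‖₊ * κ ≤ 1 * κ := by gcongr
              _ = κ := one_mul _)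
          exact (lipschitzWith_smul s).comp_lipschitzOnWith h₂) hκ
      simp only [homogenize_const_smul] at hG
      exact ⟨G, fun _ => hG⟩
    · exact ⟨id, fun h => absurd h hs⟩
  choose G hG using key
  have hFsm : ∀ (s a : ℝ) (x : EuclideanSpace ℝ (Fin 4)), a ≠ 0 →
      a • x + s • homogenize φ (a • x) = a • (x + s • homogenize φ x) := by
    intro s a x ha
    rw [homogenize_smul hodd a ha]
    module
  have hG0 : ∀ s ∈ Set.Icc (0 : ℝ) 1, G s 0 = 0 := by
    intro s hs
    have := (hG s hs).1 0
    simpa [homogenize_zero_vec] using this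
  have hF1 : ∀ t, L (L.symm (γ t) + (1 : ℝ) • homogenize φ (L.symm (γ t))) = γ' t := by
    intro t
    rw [one_smul]
    exact congrArg L (hγ' t)
  have hI1 : (1 : ℝ) ∈ Set.Icc (0 : ℝ) 1 := by simp
  refine ambientIsotopic_of_family
    (fun s x => L (L.symm x + s • homogenize φ (L.symm x))) (fun s x => L (G s (L.symm x)))
    ?_ ?_ ?_ ?_ ?_ ?_ ?_ ?_
  · intro s hs
    refine ⟨fun x hx h0 => hx ?_, fun a x ha _ => ?_⟩
    · have h1 : L.symm x + s • homogenize φ (L.symm x) = 0 := by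
        simpa only [map_eq_zero_iff L L.injective] using h0
      have h2 := (hG s hs).1 (L.symm x)
      rw [h1, hG0 s hs] at h2
      simpa using h2.symm
    · simp only [map_smul]
      rw [hFsm s a _ ha, map_smul]
  · intro s hs
    refine ⟨fun x hx h0 => hx ?_, fun a x ha _ => ?_⟩
    · have h1 : G s (L.symm x) = 0 := by
        simpa only [map_eq_zero_iff L L.injective] using h0
      have h2 := (hG s hs).2.1 (L.symm x)
      rw [h1, homogenize_zero_vec] at h2
      simpa using h2.symm
    · simp only [map_smul]
      rw [← map_smul L]
      congr 1
      rw [← (hG s hs).1 (a • G s (L.symm x)), hFsm s a _ ha, (hG s hs).2.1]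
  · intro s hs x _
    simp only [ContinuousLinearEquiv.symm_apply_apply, (hG s hs).1,
      ContinuousLinearEquiv.apply_symm_apply]
  · intro s hs x _
    simp only [ContinuousLinearEquiv.symm_apply_apply, (hG s hs).2.1,
      ContinuousLinearEquiv.apply_symm_apply]
  · rintro ⟨s, x⟩ ⟨_, hx⟩
    refine ContDiffAt.contDiffWithinAt (L.contDiff.contDiffAt.comp _ ?_)
    have hx' : L.symm x ≠ 0 := by simpa using hx
    have h3 : ContDiffAt ℝ ∞ (fun p : ℝ × (Fin 4 → ℝ) => L.symm p.2) (s, x) :=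
      L.symm.contDiff.contDiffAt.comp _ contDiffAt_snd
    have h4 : ContDiffAt ℝ ∞ (fun p : ℝ × (Fin 4 → ℝ) => homogenize φ (L.symm p.2)) (s, x) :=
      ContDiffAt.comp (s, x) (g := homogenize φ) (contDiffAt_homogenize hφ hx') h3
    exact h3.add (contDiffAt_fst.smul h4)
  · intro s hs
    refine L.contDiff.comp_contDiffOn ((hG s hs).2.2.comp L.symm.contDiff.contDiffOn ?_)
    intro x hx
    simpa using hx
  · intro x _
    simp
  · intro x hx hFx
    constructor
    · rintro ⟨t, ht, h⟩
      obtain ⟨a, rfl⟩ := (Projectivization.mk_eq_mk_iff' ℝ x (γ t) hx ht).1 h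
      have ha : a ≠ 0 := by rintro rfl; simp at hx
      have e : L (L.symm (a • γ t) + (1 : ℝ) • homogenize φ (L.symm (a • γ t))) = a • γ' t := by
        rw [map_smul, hFsm 1 a _ ha, map_smul, hF1]
      have ht' : γ' t ≠ 0 := by
        intro h0
        rw [e, h0] at hFx
        simp at hFx
      refine ⟨t, ht', ?_⟩
      rw [Projectivization.mk_eq_mk_iff']
      exact ⟨a, e.symm⟩
    · rintro ⟨t, ht, h⟩
      obtain ⟨a, ha⟩ := (Projectivization.mk_eq_mk_iff' ℝ _ (γ' t) hFx ht).1 h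
      have ha0 : a ≠ 0 := by
        rintro rfl
        rw [zero_smul] at ha
        exact hFx ha.symm
      refine ⟨t, hγ t, ?_⟩
      rw [Projectivization.mk_eq_mk_iff']
      refine ⟨a, L.symm.injective ?_⟩
      have h4 : L.symm (a • γ t) + (1 : ℝ) • homogenize φ (L.symm (a • γ t)) =
          L.symm x + (1 : ℝ) • homogenize φ (L.symm x) := by
        apply L.injective
        rw [map_smul, hFsm 1 a _ ha0, map_smul, hF1, ha]
      rw [← (hG 1 hI1).1 (L.symm (a • γ t)), h4, (hG 1 hI1).1]

/-- This is isotopy extension for nearby parameters. The moving curve is extended to an odd map `g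
(τ, ·)`, and by compactness `g (τ, ·) - g (τ₀, ·)` and its derivative are uniformly small on the
unit ball when `τ` is close to `τ₀`. -/
theorem eventually_ambientIsotopic {ε : ℝ} (hε : ε = 1 ∨ ε = -1) {Γ : ℝ × ℝ → Fin 4 → ℝ}
    (hΓ : ContDiff ℝ ∞ Γ) (hper : ∀ τ t, Γ (τ, t + 1) = ε • Γ (τ, t)) {τ₀ : ℝ}
    (h₀ : IsClosedCurve ε fun t => Γ (τ₀, t)) :
    ∀ᶠ τ in 𝓝 τ₀, AmbientIsotopic (curveSet fun t => Γ (τ₀, t)) (curveSet fun t => Γ (τ, t)) := by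
  let L : EuclideanSpace ℝ (Fin 4) ≃L[ℝ] (Fin 4 → ℝ) := EuclideanSpace.equiv (Fin 4) ℝ
  set c : ℝ → EuclideanSpace ℝ (Fin 4) := fun t => L.symm (Γ (τ₀, t)) with hc
  have hcs : ContDiff ℝ ∞ c := L.symm.contDiff.comp h₀.smooth
  have hc0 : ∀ t, c t ≠ 0 := fun t => by simpa [hc] using h₀.ne_zero t
  have hn0 : ∀ t, ‖c t‖ ≠ 0 := fun t => norm_ne_zero_iff.2 (hc0 t)
  have hns : ContDiff ℝ ∞ fun t => ‖c t‖⁻¹ := (hcs.norm ℝ hc0).inv hn0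
  have hcper : ∀ t, c (t + 1) = ε • c t := fun t => by simp [hc, hper]
  have hε1 : ‖ε‖ = 1 := by rcases hε with h | h <;> simp [h]
  have hnper : ∀ t, ‖c (t + 1)‖ = ‖c t‖ := fun t => by rw [hcper, norm_smul, hε1, one_mul]
  have hscale : ∀ s t a : ℝ, c s = a • c t → ∃ k : ℤ, s = t + k := by
    intro s t a h
    refine h₀.inj s t a (L.symm.injective ?_)
    rw [map_smul]
    exact h
  obtain ⟨g, hgs, hg, hgodd⟩ := exists_odd_extension (E := EuclideanSpace ℝ (Fin 4)) hε
    (γ := fun t => ‖c t‖⁻¹ • c t)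
    (hns.smul hcs) (fun t => by rw [hnper, hcper, smul_comm])
    (fun t => smul_ne_zero (inv_ne_zero (hn0 t)) (hc0 t))
    (fun t h => by
      have h1 : HasDerivAt (fun t => ‖c t‖⁻¹) (deriv (fun t => ‖c t‖⁻¹) t) t :=
        (hns.differentiable (by simp) t).hasDerivAt
      have h2 : HasDerivAt c (deriv c t) t := (hcs.differentiable (by simp) t).hasDerivAt
      rw [(h1.fun_smul h2).deriv] at h
      have h3 : deriv c t = (-(‖c t‖ * deriv (fun t => ‖c t‖⁻¹) t)) • c t := by
        have h4 := congrArg (fun x => ‖c t‖ • x) h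
        simp only [smul_add, smul_smul, smul_zero, mul_inv_cancel₀ (hn0 t), one_smul] at h4
        rw [neg_smul]
        exact eq_neg_of_add_eq_zero_left h4
      have h5 : HasDerivAt (fun t => Γ (τ₀, t)) (L (deriv c t)) t := by
        have := L.hasFDerivAt.comp_hasDerivAt t h2
        simpa [hc, Function.comp_def] using this
      refine h₀.immersed t (-(‖c t‖ * deriv (fun t => ‖c t‖⁻¹) t)) ?_
      rw [h5.deriv, h3, map_smul]
      simp [hc])
    (fun s t h => by
      rcases h with h | h
      · refine hscale s t (‖c s‖ * ‖c t‖⁻¹) ?_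
        rw [mul_smul, ← h, smul_smul, mul_inv_cancel₀ (hn0 s), one_smul]
      · refine hscale s t (-(‖c s‖ * ‖c t‖⁻¹)) ?_
        rw [neg_smul, mul_smul, ← smul_neg, ← h, smul_smul, mul_inv_cancel₀ (hn0 s), one_smul])
    -- The scale is the norm at `τ₀` for every `τ`. Homogenizing multiplies by this same norm again,
    -- so the perturbation carries `Γ (τ₀, t)` exactly to `Γ (τ, t)`.
    (Γ := fun p => ‖c p.2‖⁻¹ • L.symm (Γ p))
    ((hns.comp contDiff_snd).smul (L.symm.contDiff.comp hΓ))
    (fun τ t => by simp only [hnper, hper, map_smul]; rw [smul_comm])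
  let E := EuclideanSpace ℝ (Fin 4)
  let dg : ℝ × E → (E →L[ℝ] E) := fun p =>
    (fderiv ℝ g p).comp (ContinuousLinearMap.inr ℝ ℝ E)
  have hdgc : Continuous dg :=
    (hgs.continuous_fderiv (by simp)).clm_comp continuous_const
  have hdg : ∀ τ x, HasFDerivAt (fun x => g (τ, x)) (dg (τ, x)) x := by
    intro τ x
    have h1 : HasFDerivAt g (fderiv ℝ g (τ, x)) (τ, x) :=
      (hgs.differentiable (by simp) _).hasFDerivAt
    exact h1.comp x (hasFDerivAt_prodMk_right τ x)
  have hsmall : ∀ᶠ τ in 𝓝 τ₀, ∀ x ∈ closedBall (0 : E) 1,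
      ‖g (τ, x) - g (τ₀, x)‖ < 1 / 4 ∧ ‖dg (τ, x) - dg (τ₀, x)‖ < 1 / 4 := by
    refine (isCompact_closedBall (0 : E) 1).eventually_forall_of_forall_eventually ?_
    intro x _
    have c1 : Continuous fun z : ℝ × E => ‖g (z.1, z.2) - g (τ₀, z.2)‖ := by
      have := hgs.continuous
      fun_prop
    have c2 : Continuous fun z : ℝ × E => ‖dg (z.1, z.2) - dg (τ₀, z.2)‖ := by
      fun_prop
    refine Filter.Eventually.and ?_ ?_
    · exact c1.continuousAt.eventually_lt continuousAt_const (by simp)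
    · exact c2.continuousAt.eventually_lt continuousAt_const (by simp)
  filter_upwards [hsmall] with τ hτ
  have h4 : ((1 / 4 : ℝ≥0) : ℝ) = 1 / 4 := by norm_num
  refine ambientIsotopic_of_homogenize (φ := fun x => g (τ, x) - g (τ₀, x)) (κ := 1 / 4) ?_ ?_ ?_
    ?_ ?_ h₀.ne_zero ?_
  · exact (hgs.comp (contDiff_const.prodMk contDiff_id)).sub
      (hgs.comp (contDiff_const.prodMk contDiff_id))
  · intro x
    simp only [hgodd]
    abel
  · intro x hx
    rw [h4]; exact (hτ x hx).1.le
  · refine Convex.lipschitzOnWith_of_nnnorm_hasFDerivWithin_le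
      (f' := fun x => dg (τ, x) - dg (τ₀, x))
      (fun x _ => ((hdg τ x).sub (hdg τ₀ x)).hasFDerivWithinAt) (fun x hx => ?_)
      (convex_closedBall 0 1)
    rw [← NNReal.coe_le_coe, coe_nnnorm, h4]; exact (hτ x hx).2.le
  · rw [← NNReal.coe_lt_coe]; push_cast; norm_num
  · intro t
    have e1 : (WithLp.toLp 2 (Γ (τ₀, t)) : E) = c t := rfl
    have e2 : (WithLp.toLp 2 (Γ (τ, t)) : E) = L.symm (Γ (τ, t)) := rfl
    rw [e1, e2, homogenize]
    simp only [hg]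
    rw [smul_sub, smul_smul, smul_smul, mul_inv_cancel₀ (hn0 t), one_smul, one_smul]
    change c t + (L.symm (Γ (τ, t)) - c t) = _
    abel

/-- Isotopic embedded curves are ambient isotopic. -/
theorem ambientIsotopic_of_isotopy {ε : ℝ} (hε : ε = 1 ∨ ε = -1) {Γ : ℝ × ℝ → Fin 4 → ℝ}
    (hΓ : ContDiff ℝ ∞ Γ) (h : ∀ τ, IsClosedCurve ε fun t => Γ (τ, t)) :
    AmbientIsotopic (curveSet fun t => Γ (0, t)) (curveSet fun t => Γ (1, t)) := by
  -- Ambient isotopy is an equivalence relation that is locally constant in the parameter, and the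
  -- line is connected.
  refine isPreconnected_univ.induction₂ (α := ℝ)
    (fun a b => AmbientIsotopic (curveSet fun t => Γ (a, t)) (curveSet fun t => Γ (b, t)))
    (fun τ _ => ?_) (fun _ _ _ _ _ _ h1 h2 => h1.trans h2) (fun _ _ _ _ h1 => h1.symm)
    (Set.mem_univ 0) (Set.mem_univ 1)
  rw [nhdsWithin_univ]
  exact eventually_ambientIsotopic hε hΓ (fun τ t => (h τ).periodic t) (h τ)

/-! ### Curves given by a plane projection and a height -/

/-- Homogeneous coordinates `[x : y : z : w]` from `(x, y, w)` and `z`. -/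
def embL : (EuclideanSpace ℝ (Fin 3) × ℝ) →L[ℝ] (Fin 4 → ℝ) :=
  LinearMap.toContinuousLinearMap
    { toFun := fun p => ![p.1 0, p.1 1, p.2, p.1 2]
      map_add' := fun p q => by ext i; fin_cases i <;> simp
      map_smul' := fun a p => by ext i; fin_cases i <;> simp }

theorem embL_apply (x : EuclideanSpace ℝ (Fin 3)) (z : ℝ) :
    embL (x, z) = ![x 0, x 1, z, x 2] := rfl

theorem embL_injective : Function.Injective embL := by
  rintro ⟨x, z⟩ ⟨y, w⟩ h
  rw [embL_apply, embL_apply] at h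
  have h0 := congrFun h 0
  have h1 := congrFun h 1
  have h2 := congrFun h 2
  have h3 := congrFun h 3
  simp at h0 h1 h2 h3
  refine Prod.ext ?_ h2
  ext i
  fin_cases i <;> assumption

theorem embL_eq_smul {x y : EuclideanSpace ℝ (Fin 3)} {z w a : ℝ} :
    embL (x, z) = a • embL (y, w) ↔ x = a • y ∧ z = a * w := by
  rw [← map_smul, embL_injective.eq_iff, Prod.smul_mk, Prod.mk.injEq, smul_eq_mul]

/-- The curve with projection `c` and height `ζ`, measured relative to `‖c‖`. -/
def knotCurve (c : ℝ → EuclideanSpace ℝ (Fin 3)) (ζ : ℝ → ℝ) (t : ℝ) : Fin 4 → ℝ :=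
  embL (c t, ‖c t‖ * ζ t)

/-- The curve with projection `c` and height `ζ` is a knot. -/
structure IsKnotPair (ε : ℝ) (c : ℝ → EuclideanSpace ℝ (Fin 3)) (ζ : ℝ → ℝ) : Prop where
  smooth : ContDiff ℝ ∞ c
  smooth_height : ContDiff ℝ ∞ ζ
  periodic : ∀ t, c (t + 1) = ε • c t
  periodic_height : ∀ t, ζ (t + 1) = ε * ζ t
  ne_zero : ∀ t, c t ≠ 0
  immersed : ∀ t, ∃ k : ℤ, ∀ a : ℝ, deriv c (t + k) = a • c (t + k) → deriv ζ (t + k) ≠ 0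
  inj : ∀ s t a : ℝ, 0 ≤ s → s < t → t < 1 → c t = a • c s → |a| * ζ s ≠ a * ζ t

theorem deriv_equivariant {E : Type*} [NormedAddCommGroup E] [NormedSpace ℝ E] {ε : ℝ}
    {f : ℝ → E} (hf : ∀ t, f (t + 1) = ε • f t) (t : ℝ) : deriv f (t + 1) = ε • deriv f t := by
  have h : (fun t => f (t + 1)) = fun t => ε • f t := funext hf
  rw [← deriv_comp_add_const (f := f) 1, h, deriv_fun_const_smul_field]

theorem ne_zero_of_sign {ε : ℝ} (hε : ε = 1 ∨ ε = -1) : ε ≠ 0 := by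
  rcases hε with h | h <;> simp [h]

/-- Because the height is measured relative to `‖c‖`, points over `c t = a • c s` coincide exactly
when `a * ζ t = |a| * ζ s`, a condition that sees only the sign of `a`. Likewise, where `c' = a • c`
the norm satisfies `‖c‖' = a * ‖c‖`, and what is left of the velocity is `‖c‖ * ζ'`. -/
theorem IsKnotPair.isClosedCurve {ε : ℝ} (hε : ε = 1 ∨ ε = -1)
    {c : ℝ → EuclideanSpace ℝ (Fin 3)} {ζ : ℝ → ℝ} (h : IsKnotPair ε c ζ) :
    IsClosedCurve ε (knotCurve c ζ) := by
  have hε0 : ε ≠ 0 := ne_zero_of_sign hε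
  have hε1 : ‖ε‖ = 1 := by rcases hε with h | h <;> simp [h]
  have hns : ContDiff ℝ ∞ fun t => ‖c t‖ := h.smooth.norm ℝ h.ne_zero
  have hper : ∀ t, knotCurve c ζ (t + 1) = ε • knotCurve c ζ t := by
    intro t
    rw [knotCurve, knotCurve, embL_eq_smul, h.periodic, h.periodic_height, norm_smul, hε1]
    exact ⟨rfl, by ring⟩
  refine ⟨embL.contDiff.comp (h.smooth.prodMk (hns.mul h.smooth_height)), hper, ?_, ?_, ?_⟩
  · intro t h0
    have h1 : embL (c t, ‖c t‖ * ζ t) = (0 : ℝ) • embL (0, 0) := by rw [zero_smul]; exact h0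
    have h2 := (embL_eq_smul.1 h1).1
    rw [zero_smul] at h2
    exact h.ne_zero t h2
  · intro t a hcon
    obtain ⟨k, hk⟩ := h.immersed t
    have hcon' : deriv (knotCurve c ζ) (t + k) = a • knotCurve c ζ (t + k) := by
      rw [equivariant_int hε hper, equivariant_int hε (deriv_equivariant hper), hcon, smul_comm]
    set u := t + (k : ℝ)
    have hc : HasDerivAt c (deriv c u) u := (h.smooth.differentiable (by simp) u).hasDerivAt
    have hζ : HasDerivAt ζ (deriv ζ u) u :=
      (h.smooth_height.differentiable (by simp) u).hasDerivAt
    have hn : HasDerivAt (fun t => ‖c t‖) (deriv (fun t => ‖c t‖) u) u :=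
      (hns.differentiable (by simp) u).hasDerivAt
    have hd : HasDerivAt (knotCurve c ζ)
        (embL (deriv c u, deriv (fun t => ‖c t‖) u * ζ u + ‖c u‖ * deriv ζ u)) u :=
      embL.hasFDerivAt.comp_hasDerivAt u (hc.prodMk (hn.mul hζ))
    rw [hd.deriv] at hcon'
    obtain ⟨h1, h2⟩ := embL_eq_smul.1 hcon'
    have hn0 : ‖c u‖ ≠ 0 := norm_ne_zero_iff.2 (h.ne_zero u)
    have h3 : deriv (fun t => ‖c t‖) u = a * ‖c u‖ := by
      have e1 : HasDerivAt (fun t => ‖c t‖ ^ 2) (2 * ⟪c u, deriv c u⟫) u := hc.norm_sq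
      have e2 : HasDerivAt (fun t => ‖c t‖ ^ 2) _ u := hn.fun_pow 2
      have e3 := e1.unique e2
      rw [h1, inner_smul_right, real_inner_self_eq_norm_sq] at e3
      have e4 : ‖c u‖ * (deriv (fun t => ‖c t‖) u - a * ‖c u‖) = 0 := by
        push_cast at e3
        linear_combination (-1 / 2) * e3
      linarith [(mul_eq_zero.1 e4).resolve_left hn0]
    rw [h3] at h2
    refine hk a h1 ?_
    have h4 : ‖c u‖ * deriv ζ u = 0 := by linear_combination h2
    exact (mul_eq_zero.1 h4).resolve_left hn0
  · intro s t a hst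
    have es : knotCurve c ζ s = ε ^ ⌊s⌋ • knotCurve c ζ (Int.fract s) := by
      rw [← equivariant_int hε hper, Int.fract_add_floor]
    have et : knotCurve c ζ t = ε ^ ⌊t⌋ • knotCurve c ζ (Int.fract t) := by
      rw [← equivariant_int hε hper, Int.fract_add_floor]
    rw [es, et] at hst
    have hz : ε ^ ⌊s⌋ ≠ 0 := zpow_ne_zero _ hε0
    obtain ⟨b, hb⟩ : ∃ b : ℝ, knotCurve c ζ (Int.fract s) = b • knotCurve c ζ (Int.fract t) := by
      refine ⟨(ε ^ ⌊s⌋)⁻¹ * (a * ε ^ ⌊t⌋), ?_⟩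
      rw [mul_smul, mul_smul, ← hst, smul_smul, inv_mul_cancel₀ hz, one_smul]
    obtain ⟨h1, h2⟩ := embL_eq_smul.1 hb
    have hb0 : b ≠ 0 := by
      rintro rfl
      rw [zero_smul] at h1
      exact h.ne_zero _ h1
    have hn0 : ‖c (Int.fract t)‖ ≠ 0 := norm_ne_zero_iff.2 (h.ne_zero _)
    have h3 : |b| * ζ (Int.fract s) = b * ζ (Int.fract t) := by
      rw [h1, norm_smul, Real.norm_eq_abs] at h2
      have : ‖c (Int.fract t)‖ * (|b| * ζ (Int.fract s) - b * ζ (Int.fract t)) = 0 := by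
        linear_combination h2
      linarith [(mul_eq_zero.1 this).resolve_left hn0]
    have hbb : |b| * |b| = b * b := abs_mul_abs_self b
    rcases lt_trichotomy (Int.fract s) (Int.fract t) with hlt | heq | hgt
    · exfalso
      refine h.inj _ _ b⁻¹ (Int.fract_nonneg s) hlt (Int.fract_lt_one t) ?_ ?_
      · rw [h1, smul_smul, inv_mul_cancel₀ hb0, one_smul]
      · rw [abs_inv]
        have hab : |b| ≠ 0 := abs_ne_zero.2 hb0
        field_simp
        have : |b| * (ζ (Int.fract s) * b - |b| * ζ (Int.fract t)) = 0 := by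
          linear_combination b * h3 - ζ (Int.fract t) * hbb
        linarith [(mul_eq_zero.1 this).resolve_left hab]
    · refine ⟨⌊s⌋ - ⌊t⌋, ?_⟩
      have := Int.fract_add_floor s
      have := Int.fract_add_floor t
      push_cast
      linarith
    · exfalso
      refine h.inj _ _ b (Int.fract_nonneg t) hgt (Int.fract_lt_one s) h1 ?_
      have : |b| * (|b| * ζ (Int.fract t) - b * ζ (Int.fract s)) = 0 := by
        linear_combination (-b) * h3 + ζ (Int.fract t) * hbb
      linarith [(mul_eq_zero.1 this).resolve_left (abs_ne_zero.2 hb0)]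

/-- Isotopy extension asks for embedded curves at all real parameters. The smooth transition
function maps the line into `[0, 1]` and fixes both endpoints. -/
theorem ambientIsotopic_of_knotPair {ε : ℝ} (hε : ε = 1 ∨ ε = -1)
    {c : ℝ × ℝ → EuclideanSpace ℝ (Fin 3)} {ζ : ℝ × ℝ → ℝ} (hc : ContDiff ℝ ∞ c)
    (hζ : ContDiff ℝ ∞ ζ)
    (h : ∀ τ ∈ Set.Icc (0 : ℝ) 1, IsKnotPair ε (fun t => c (τ, t)) (fun t => ζ (τ, t))) :
    AmbientIsotopic (curveSet (knotCurve (fun t => c (0, t)) (fun t => ζ (0, t))))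
      (curveSet (knotCurve (fun t => c (1, t)) (fun t => ζ (1, t)))) := by
  have hσ : ∀ τ, Real.smoothTransition τ ∈ Set.Icc (0 : ℝ) 1 := fun τ =>
    ⟨Real.smoothTransition.nonneg τ, Real.smoothTransition.le_one τ⟩
  have hs : ContDiff ℝ ∞ fun p : ℝ × ℝ => (Real.smoothTransition p.1, p.2) :=
    (Real.smoothTransition.contDiff.comp contDiff_fst).prodMk contDiff_snd
  have hcs := hc.comp hs
  have h0 : ∀ p : ℝ × ℝ, c (Real.smoothTransition p.1, p.2) ≠ 0 := fun p =>
    (h _ (hσ p.1)).ne_zero p.2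
  have key := ambientIsotopic_of_isotopy hε
    (Γ := fun p => embL (c (Real.smoothTransition p.1, p.2),
      ‖c (Real.smoothTransition p.1, p.2)‖ * ζ (Real.smoothTransition p.1, p.2)))
    (embL.contDiff.comp (hcs.prodMk ((hcs.norm ℝ h0).mul (hζ.comp hs))))
    (fun τ => (h _ (hσ τ)).isClosedCurve hε)
  simp only [Real.smoothTransition.zero, Real.smoothTransition.one] at key
  exact key

/-! ### Periodic cutoff functions -/

/-- The extension of `u`, restricted to `[0, 1)`, with `f (t + 1) = ε * f t`. -/
def periodize (ε : ℝ) (u : ℝ → ℝ) (t : ℝ) : ℝ := ε ^ ⌊t⌋ * u (Int.fract t)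

theorem periodize_add_one {ε : ℝ} (hε : ε ≠ 0) (u : ℝ → ℝ) (t : ℝ) :
    periodize ε u (t + 1) = ε * periodize ε u t := by
  rw [periodize, periodize, Int.floor_add_one, Int.fract_add_one, zpow_add_one₀ hε]
  ring

theorem periodize_of_mem {ε : ℝ} {u : ℝ → ℝ} {t : ℝ} (h0 : 0 ≤ t) (h1 : t < 1) :
    periodize ε u t = u t := by
  have hf : ⌊t⌋ = 0 := Int.floor_eq_zero_iff.2 ⟨h0, h1⟩
  rw [periodize, Int.fract, hf]
  simp

theorem periodize_of_mem_neg {ε : ℝ} {u : ℝ → ℝ} {t : ℝ} (h0 : -1 ≤ t) (h1 : t < 0) :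
    periodize ε u t = ε⁻¹ * u (t + 1) := by
  have hf : ⌊t⌋ = -1 := Int.floor_eq_iff.2 ⟨by push_cast; linarith, by push_cast; linarith⟩
  rw [periodize, Int.fract, hf]
  simp

theorem periodize_eventuallyEq {ε : ℝ} {u : ℝ → ℝ} {t : ℝ} (h0 : 0 < t) (h1 : t < 1) :
    periodize ε u =ᶠ[𝓝 t] u := by
  filter_upwards [Ioo_mem_nhds h0 h1] with x hx
  exact periodize_of_mem hx.1.le hx.2

theorem periodize_eq_zero {ε a : ℝ} {u : ℝ → ℝ} (ha1 : a ≤ 1)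
    (hu0 : ∀ t ≤ a, u t = 0) (hu1 : ∀ t, 1 - a ≤ t → u t = 0) {t : ℝ} (ht : |t| < a) :
    periodize ε u t = 0 := by
  obtain ⟨h1, h2⟩ := abs_lt.1 ht
  rcases lt_or_ge t 0 with h | h
  · rw [periodize_of_mem_neg (by linarith) h, hu1 _ (by linarith), mul_zero]
  · rw [periodize_of_mem h (by linarith), hu0 _ h2.le]

theorem contDiff_periodize {ε a : ℝ} (hε : ε ≠ 0) {u : ℝ → ℝ} (hu : ContDiff ℝ ∞ u) (ha : 0 < a)
    (ha1 : a ≤ 1) (hu0 : ∀ t ≤ a, u t = 0) (hu1 : ∀ t, 1 - a ≤ t → u t = 0) :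
    ContDiff ℝ ∞ (periodize ε u) := by
  have hbase : ∀ t, 0 ≤ t → t < 1 → ContDiffAt ℝ ∞ (periodize ε u) t := by
    intro t h0 h1
    rcases h0.eq_or_lt with rfl | h0
    · refine (contDiffAt_const (c := (0 : ℝ))).congr_of_eventuallyEq ?_
      filter_upwards [Ioo_mem_nhds (neg_lt_zero.2 ha) ha] with x hx
      exact periodize_eq_zero ha1 hu0 hu1 (abs_lt.2 hx)
    · exact hu.contDiffAt.congr_of_eventuallyEq (periodize_eventuallyEq h0 h1)
  rw [contDiff_iff_contDiffAt]
  intro t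
  have h1 : periodize ε u = fun x => ε ^ ⌊t⌋ * periodize ε u (x - ⌊t⌋) := by
    funext x
    simp only [periodize, Int.floor_sub_intCast, Int.fract_sub_intCast]
    rw [← mul_assoc, ← zpow_add₀ hε]
    congr 2
    ring
  rw [h1]
  refine contDiffAt_const.mul ?_
  have h2 : ContDiffAt ℝ ∞ (periodize ε u) (t - ⌊t⌋) :=
    hbase _ (Int.fract_nonneg t) (Int.fract_lt_one t)
  exact ContDiffAt.comp t (g := periodize ε u) h2 (contDiffAt_id.sub contDiffAt_const)

/-- A smooth function that is `1` on `[η / 2, 1 - η / 2]` and `0` outside `[η / 4, 1 - η / 4]`. -/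
def bump (η t : ℝ) : ℝ :=
  Real.smoothTransition (4 * t / η - 1) * Real.smoothTransition (4 * (1 - t) / η - 1)

theorem contDiff_bump (η : ℝ) : ContDiff ℝ ∞ (bump η) :=
  (Real.smoothTransition.contDiff.comp
    (((contDiff_const.mul contDiff_id).div_const η).sub contDiff_const)).mul
  (Real.smoothTransition.contDiff.comp
    (((contDiff_const.mul (contDiff_const.sub contDiff_id)).div_const η).sub contDiff_const))

theorem bump_nonneg (η t : ℝ) : 0 ≤ bump η t :=
  mul_nonneg (Real.smoothTransition.nonneg _) (Real.smoothTransition.nonneg _)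

theorem bump_le_one (η t : ℝ) : bump η t ≤ 1 :=
  mul_le_one₀ (Real.smoothTransition.le_one _) (Real.smoothTransition.nonneg _)
    (Real.smoothTransition.le_one _)

theorem bump_eq_zero_left {η : ℝ} (hη : 0 < η) {t : ℝ} (ht : t ≤ η / 4) : bump η t = 0 := by
  rw [bump, Real.smoothTransition.zero_of_nonpos, zero_mul]
  rw [sub_nonpos, div_le_one hη]; linarith

theorem bump_eq_zero_right {η : ℝ} (hη : 0 < η) {t : ℝ} (ht : 1 - η / 4 ≤ t) :
    bump η t = 0 := by
  rw [bump, Real.smoothTransition.zero_of_nonpos (x := 4 * (1 - t) / η - 1), mul_zero]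
  rw [sub_nonpos, div_le_one hη]; linarith

theorem bump_eq_one {η : ℝ} (hη : 0 < η) {t : ℝ} (ht : η / 2 ≤ t) (ht' : t ≤ 1 - η / 2) :
    bump η t = 1 := by
  rw [bump, Real.smoothTransition.one_of_one_le, Real.smoothTransition.one_of_one_le, one_mul]
  · rw [le_sub_iff_add_le, le_div_iff₀ hη]; linarith
  · rw [le_sub_iff_add_le, le_div_iff₀ hη]; linarith

theorem exists_deriv_smoothTransition_le : ∃ C : ℝ, 0 ≤ C ∧ ∀ x,
    |deriv Real.smoothTransition x| ≤ C := by
  have hs : ContDiff ℝ ∞ Real.smoothTransition := Real.smoothTransition.contDiff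
  have hc : Continuous (deriv Real.smoothTransition) := hs.continuous_deriv (by simp)
  obtain ⟨C, hC⟩ := (isCompact_Icc (a := (0 : ℝ)) (b := 1)).exists_bound_of_continuousOn
    hc.continuousOn
  have hC0 : 0 ≤ C := (norm_nonneg _).trans (hC 0 (by simp))
  refine ⟨C, hC0, fun x => ?_⟩
  rcases lt_or_ge x 0 with h | h
  · have : Real.smoothTransition =ᶠ[𝓝 x] fun _ => 0 := by
      filter_upwards [Iio_mem_nhds h] with y hy
      exact Real.smoothTransition.zero_of_nonpos (le_of_lt hy)
    rw [this.deriv_eq]; simpa using hC0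
  · rcases lt_or_ge 1 x with h' | h'
    · have : Real.smoothTransition =ᶠ[𝓝 x] fun _ => 1 := by
        filter_upwards [Ioi_mem_nhds h'] with y hy
        exact Real.smoothTransition.one_of_one_le (le_of_lt hy)
      rw [this.deriv_eq]; simpa using hC0
    · exact hC x ⟨h, h'⟩

/-- The constant does not depend on `η`. In `exists_straighten` the slope `C / δ` is compensated by
a displacement at most proportional to `δ`. -/
theorem exists_deriv_bump_le : ∃ C : ℝ, 0 ≤ C ∧ ∀ η, 0 < η → ∀ t, |deriv (bump η) t| ≤ C / η := by
  obtain ⟨C, hC0, hC⟩ := exists_deriv_smoothTransition_le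
  refine ⟨8 * C, by positivity, fun η hη t => ?_⟩
  have hs : ∀ x, HasDerivAt Real.smoothTransition (deriv Real.smoothTransition x) x := fun x =>
    ((Real.smoothTransition.contDiff (n := ⊤)).differentiable (by simp) x).hasDerivAt
  have h1 : HasDerivAt (fun t : ℝ => 4 * t / η - 1) (4 / η) t := by
    have := (((hasDerivAt_id t).const_mul 4).div_const η).sub_const 1
    simpa using this
  have h2 : HasDerivAt (fun t : ℝ => 4 * (1 - t) / η - 1) (-(4 / η)) t := by
    have := ((((hasDerivAt_id t).const_sub 1).const_mul 4).div_const η).sub_const 1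
    simpa [neg_div] using this
  have h3 : HasDerivAt (bump η) _ t := ((hs _).comp t h1).mul ((hs _).comp t h2)
  rw [h3.deriv]
  set A := deriv Real.smoothTransition (4 * t / η - 1)
  set B := deriv Real.smoothTransition (4 * (1 - t) / η - 1)
  have hA : |A| ≤ C := hC _
  have hB : |B| ≤ C := hC _
  have hS : ∀ x, |Real.smoothTransition x| ≤ 1 := fun x => by
    rw [abs_of_nonneg (Real.smoothTransition.nonneg x)]; exact Real.smoothTransition.le_one x
  have h4 : |4 / η| = 4 / η := abs_of_pos (by positivity)
  calc _ ≤ |A * (4 / η)| * |Real.smoothTransition (4 * (1 - t) / η - 1)| +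
        |Real.smoothTransition (4 * t / η - 1)| * |B * -(4 / η)| := by
        refine (abs_add_le _ _).trans ?_
        rw [abs_mul _ (B * _), abs_mul (A * _)]
        rfl
    _ ≤ C * (4 / η) * 1 + 1 * (C * (4 / η)) := by
        rw [abs_mul, abs_mul, abs_neg, h4]
        gcongr
        · exact hS _
        · exact hS _
    _ = 8 * C / η := by ring

/-- The equivariant cutoff function which vanishes near the integers. -/
def cutoff (ε η t : ℝ) : ℝ := periodize ε (bump η) t

section cutoff

variable {ε η : ℝ}

theorem contDiff_cutoff (hε : ε ≠ 0) (hη : 0 < η) (hη1 : η ≤ 1) :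
    ContDiff ℝ ∞ (cutoff ε η) :=
  contDiff_periodize hε (contDiff_bump η) (a := η / 4) (by positivity) (by linarith)
    (fun _ h => bump_eq_zero_left hη h) fun _ h => bump_eq_zero_right hη h

theorem cutoff_eq_zero (hη : 0 < η) (hη1 : η ≤ 1) {t : ℝ} (ht : |t| < η / 4) :
    cutoff ε η t = 0 :=
  periodize_eq_zero (by linarith) (fun _ h => bump_eq_zero_left hη h)
    (fun _ h => bump_eq_zero_right hη h) ht

theorem cutoff_add_one (hε : ε ≠ 0) (t : ℝ) : cutoff ε η (t + 1) = ε * cutoff ε η t :=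
  periodize_add_one hε _ t

theorem cutoff_of_mem {t : ℝ} (h0 : 0 ≤ t) (h1 : t < 1) : cutoff ε η t = bump η t :=
  periodize_of_mem h0 h1

theorem cutoff_one_mem (t : ℝ) : cutoff 1 η t ∈ Set.Icc (0 : ℝ) 1 := by
  rw [cutoff, periodize, one_zpow, one_mul]
  exact ⟨bump_nonneg _ _, bump_le_one _ _⟩

theorem cutoff_one_eq_one (hη : 0 < η) {t : ℝ} (ht : η / 2 ≤ |t|) (ht' : |t| ≤ 1 - η / 2) :
    cutoff 1 η t = 1 := by
  rcases lt_or_ge t 0 with h | h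
  · rw [abs_of_neg h] at ht ht'
    rw [cutoff, periodize_of_mem_neg (by linarith) h, bump_eq_one hη (by linarith) (by linarith)]
    simp
  · rw [abs_of_nonneg h] at ht ht'
    rw [cutoff_of_mem h (by linarith), bump_eq_one hη ht ht']

theorem abs_deriv_cutoff_one_le {C : ℝ} (hη : 0 < η) (hη1 : η ≤ 1) (hC0 : 0 ≤ C)
    (hC : ∀ t, |deriv (bump η) t| ≤ C / η) {t : ℝ} (ht : |t| < 1) :
    |deriv (cutoff 1 η) t| ≤ C / η := by
  obtain ⟨h1, h2⟩ := abs_lt.1 ht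
  rcases lt_trichotomy t 0 with h | h | h
  · have : cutoff 1 η =ᶠ[𝓝 t] fun x => bump η (x + 1) := by
      filter_upwards [Ioo_mem_nhds h1 h] with x hx
      rw [cutoff, periodize_of_mem_neg hx.1.le hx.2]; simp
    rw [this.deriv_eq, deriv_comp_add_const]
    exact hC _
  · have : cutoff 1 η =ᶠ[𝓝 t] fun _ => 0 := by
      rw [h]
      filter_upwards [Ioo_mem_nhds (a := -(η / 4)) (b := η / 4) (x := (0 : ℝ)) (by linarith)
        (by linarith)] with x hx
      exact cutoff_eq_zero hη hη1 (abs_lt.2 hx)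
    rw [this.deriv_eq]
    simp only [deriv_const, abs_zero]
    positivity
  · have : cutoff 1 η =ᶠ[𝓝 t] bump η := periodize_eventuallyEq h h2
    rw [this.deriv_eq]
    exact hC _

end cutoff

/-- The model height: it decreases from about `2` to about `1` on `(0, 1)`, and vanishes near the
integers. -/
def modelHeight (ε η t : ℝ) : ℝ := periodize ε (fun t => bump η t * (2 - t)) t

section modelHeight

variable {ε η : ℝ}

theorem contDiff_modelHeight (hε : ε ≠ 0) (hη : 0 < η) (hη1 : η ≤ 1) :
    ContDiff ℝ ∞ (modelHeight ε η) :=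
  contDiff_periodize hε ((contDiff_bump η).mul (contDiff_const.sub contDiff_id)) (a := η / 4)
    (by positivity) (by linarith)
    (fun _ h => by simp [bump_eq_zero_left hη h]) fun _ h => by simp [bump_eq_zero_right hη h]

theorem modelHeight_add_one (hε : ε ≠ 0) (t : ℝ) :
    modelHeight ε η (t + 1) = ε * modelHeight ε η t :=
  periodize_add_one hε _ t

theorem modelHeight_nonneg {t : ℝ} (h0 : 0 ≤ t) (h1 : t < 1) : 0 ≤ modelHeight ε η t := by
  rw [modelHeight, periodize_of_mem h0 h1]
  exact mul_nonneg (bump_nonneg _ _) (by linarith)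

theorem modelHeight_le {t : ℝ} (h0 : 0 ≤ t) (h1 : t < 1) : modelHeight ε η t ≤ 2 - t := by
  rw [modelHeight, periodize_of_mem h0 h1]
  exact mul_le_of_le_one_left (by linarith) (bump_le_one _ _)

theorem modelHeight_eq (hη : 0 < η) {t : ℝ} (ht : η / 2 ≤ t) (ht' : t ≤ 1 - η / 2) :
    modelHeight ε η t = 2 - t := by
  rw [modelHeight, periodize_of_mem (by linarith) (by linarith), bump_eq_one hη ht ht', one_mul]

theorem deriv_modelHeight (hη : 0 < η) {t : ℝ} (ht : η / 2 < t) (ht' : t < 1 - η / 2) :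
    deriv (modelHeight ε η) t = -1 := by
  have : modelHeight ε η =ᶠ[𝓝 t] fun x => 2 - x := by
    filter_upwards [Ioo_mem_nhds ht ht'] with x hx
    exact modelHeight_eq hη hx.1.le hx.2.le
  rw [this.deriv_eq]
  simp

/-- At a crossing whose first branch lies in the region where the model height decreases, the
first branch is above. -/
theorem modelHeight_lt (hη : 0 < η) {s t a : ℝ} (ha : a ≠ 0) (hs : η / 2 ≤ s)
    (hs' : s ≤ 1 - η / 2) (hst : s < t) (ht : t < 1) :
    a * modelHeight ε η t < |a| * modelHeight ε η s := by
  rw [modelHeight_eq hη hs hs']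
  have h1 : modelHeight ε η t ≤ 2 - t := modelHeight_le (by linarith) ht
  have h2 : 0 ≤ modelHeight ε η t := modelHeight_nonneg (by linarith) ht
  have h3 : 0 < |a| := abs_pos.2 ha
  calc a * modelHeight ε η t ≤ |a| * modelHeight ε η t := by
        gcongr; exact le_abs_self a
    _ < |a| * (2 - s) := by gcongr; linarith

end modelHeight

/-! ### Straightening a curve near the basepoint -/

section Straighten

variable {E : Type*} [NormedAddCommGroup E] [InnerProductSpace ℝ E]

/-- A multiple of `x` points mostly along `e`, while `v` is orthogonal to `e`. Pairing with `e`
gives `|a| ≤ 2 * κ`, hence `‖w‖ ≤ 3 * κ`, and `r • v` is within `κ` of `w`. Both injectivity and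
immersion in projective space near the basepoint follow from this estimate. -/
theorem norm_le_of_smul_near {e x w v : E} {a κ r : ℝ} (he : ‖e‖ = 1) (hev : ⟪e, v⟫ = 0)
    (hx : ‖x - e‖ ≤ 1 / 2) (hw : a • x = w) (hwv : ‖w - r • v‖ ≤ κ) : |r| * ‖v‖ ≤ 4 * κ := by
  have h1 : 1 / 2 ≤ ⟪e, x⟫ := by
    have h2 : ⟪e, x⟫ = 1 + ⟪e, x - e⟫ := by
      rw [inner_sub_right, real_inner_self_eq_norm_sq, he]; ring
    have h3 := abs_real_inner_le_norm e (x - e)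
    rw [he, one_mul] at h3
    have := (abs_le.1 (h3.trans hx)).1
    linarith
  have h2 : |a| * (1 / 2) ≤ κ := by
    have h3 : a * ⟪e, x⟫ = ⟪e, w - r • v⟫ := by
      rw [inner_sub_right, inner_smul_right, hev, mul_zero, sub_zero, ← hw, inner_smul_right]
    have h4 := abs_real_inner_le_norm e (w - r • v)
    rw [he, one_mul, ← h3, abs_mul] at h4
    have h5 : |⟪e, x⟫| = ⟪e, x⟫ := abs_of_nonneg (by linarith)
    rw [h5] at h4
    calc |a| * (1 / 2) ≤ |a| * ⟪e, x⟫ := by gcongr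
      _ ≤ κ := h4.trans hwv
  have h3 : ‖x‖ ≤ 3 / 2 := by
    have := norm_add_le (x - e) e
    rw [sub_add_cancel, he] at this
    linarith
  calc |r| * ‖v‖ = ‖r • v‖ := by rw [norm_smul, Real.norm_eq_abs]
    _ = ‖w - (w - r • v)‖ := by rw [sub_sub_cancel]
    _ ≤ ‖w‖ + ‖w - r • v‖ := norm_sub_le _ _
    _ ≤ |a| * (3 / 2) + κ := by
      gcongr
      rw [← hw, norm_smul, Real.norm_eq_abs]
      gcongr
    _ ≤ 4 * κ := by linarith

/-- By the mean value inequality `f t - f s` is within `κ * |t - s|` of `(t - s) • v`, while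
collinearity makes it a multiple of `f s`. So `norm_le_of_smul_near` contradicts `4 * κ < ‖v‖`
unless `t = s`. -/
theorem eq_of_smul_of_deriv_near {f : ℝ → E} (hf : Differentiable ℝ f) {e v : E} {κ η : ℝ}
    (he : ‖e‖ = 1) (hev : ⟪e, v⟫ = 0) (hκ : 4 * κ < ‖v‖)
    (h₁ : ∀ t, |t| ≤ η → ‖deriv f t - v‖ ≤ κ) (h₂ : ∀ t, |t| ≤ η → ‖f t - e‖ ≤ 1 / 2)
    {s t a : ℝ} (hs : |s| ≤ η) (ht : |t| ≤ η) (h : f t = a • f s) : t = s := by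
  have hd : ∀ x, HasDerivAt (fun x => f x - x • v) (deriv f x - v) x := by
    intro x
    have := (hf x).hasDerivAt.fun_sub ((hasDerivAt_id x).smul_const v)
    simpa using this
  have h3 : ‖(f t - t • v) - (f s - s • v)‖ ≤ κ * ‖t - s‖ := by
    refine Convex.norm_image_sub_le_of_norm_hasDerivWithin_le (s := Set.Icc (-η) η)
      (f := fun x => f x - x • v) (f' := fun x => deriv f x - v)
      (fun x _ => (hd x).hasDerivWithinAt) (fun x hx => h₁ x (abs_le.2 hx)) (convex_Icc _ _)
      (abs_le.1 hs) (abs_le.1 ht)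
  have h4 := norm_le_of_smul_near (a := a - 1) (x := f s) (w := f t - f s) (r := t - s)
    (κ := κ * ‖t - s‖) he hev (h₂ s hs) (by rw [sub_smul, one_smul, h]) (by
      convert h3 using 2
      module)
  by_contra hne
  have h5 : 0 < |t - s| := abs_pos.2 (sub_ne_zero.2 hne)
  rw [Real.norm_eq_abs] at h4
  nlinarith

theorem deriv_ne_smul_of_deriv_near {f : ℝ → E} {e v : E} {κ : ℝ}
    (he : ‖e‖ = 1) (hev : ⟪e, v⟫ = 0) (hκ : 4 * κ < ‖v‖) {t : ℝ}
    (h₁ : ‖deriv f t - v‖ ≤ κ) (h₂ : ‖f t - e‖ ≤ 1 / 2) (a : ℝ) : deriv f t ≠ a • f t := by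
  intro h
  have := norm_le_of_smul_near (r := 1) (κ := κ) he hev h₂ h.symm (by rwa [one_smul])
  rw [abs_one, one_mul] at this
  linarith

/-- Noncollinearity is strict inequality in Cauchy–Schwarz, an open condition that is uniform over a
compact set of parameters. -/
theorem exists_noncollinear_nhds {c : ℝ → E} (hc : Continuous c) {e : E} (he : e ≠ 0) {K : Set ℝ}
    (hK : IsCompact K) (hc0 : ∀ t, c t ≠ 0) (h : ∀ t ∈ K, ∀ a : ℝ, c t ≠ a • e) :
    ∃ μ > 0, ∀ x, ‖x - e‖ < μ → ∀ t ∈ K, ∀ a : ℝ, c t ≠ a • x := by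
  have key : ∀ᶠ x in 𝓝 e, ∀ t ∈ K, |⟪x, c t⟫| < ‖x‖ * ‖c t‖ := by
    refine hK.eventually_forall_of_forall_eventually fun t ht => ?_
    have c1 : Continuous fun z : E × ℝ => |⟪z.1, c z.2⟫| := by fun_prop
    have c2 : Continuous fun z : E × ℝ => ‖z.1‖ * ‖c z.2‖ := by fun_prop
    refine c1.continuousAt.eventually_lt c2.continuousAt ?_
    refine lt_of_le_of_ne (abs_real_inner_le_norm _ _) fun heq => ?_
    obtain ⟨r, _, hr⟩ := (norm_inner_eq_norm_iff (𝕜 := ℝ) he (hc0 t)).1 heq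
    exact h t ht r hr
  obtain ⟨μ, hμ, hball⟩ := Metric.eventually_nhds_iff.1 key
  refine ⟨μ, hμ, fun x hx t ht a hcx => ?_⟩
  have h1 := hball (y := x) (by rwa [dist_eq_norm]) t ht
  rw [hcx, inner_smul_right, real_inner_self_eq_norm_sq, norm_smul, abs_mul, Real.norm_eq_abs,
    abs_of_nonneg (sq_nonneg ‖x‖)] at h1
  exact absurd h1 (by rw [not_lt]; apply le_of_eq; ring)

/-- The curve `c` does not return to its part with parameters in `[-δ, δ]`. -/
def NoBaseCrossing (c : ℝ → E) (δ : ℝ) : Prop :=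
  ∀ s t a : ℝ, |s| ≤ δ → c t = a • c s → ∃ k : ℤ, t = s + k

/-- The linear interpolation between `c` and `m` near the integers. -/
def straighten (c m : ℝ → E) (δ : ℝ) (p : ℝ × ℝ) : E :=
  c p.2 + (p.1 * (1 - cutoff 1 δ p.2)) • (m p.2 - c p.2)

theorem contDiff_straighten {c m : ℝ → E} (hc : ContDiff ℝ ∞ c) (hm : ContDiff ℝ ∞ m) {δ : ℝ}
    (hδ : 0 < δ) (hδ1 : δ ≤ 1) : ContDiff ℝ ∞ (straighten c m δ) :=
  (hc.comp contDiff_snd).add ((contDiff_fst.mul (contDiff_const.sub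
    ((contDiff_cutoff one_ne_zero hδ hδ1).comp contDiff_snd))).smul
      ((hm.comp contDiff_snd).sub (hc.comp contDiff_snd)))

theorem straighten_add_one {c m : ℝ → E} {δ ε : ℝ} (hc : ∀ t, c (t + 1) = ε • c t)
    (hm : ∀ t, m (t + 1) = ε • m t) (τ t : ℝ) :
    straighten c m δ (τ, t + 1) = ε • straighten c m δ (τ, t) := by
  simp only [straighten, hc, hm, cutoff_add_one one_ne_zero]
  module

theorem straighten_zero (c m : ℝ → E) (δ t : ℝ) : straighten c m δ (0, t) = c t := by
  simp [straighten]

theorem straighten_eq_left {c m : ℝ → E} {δ : ℝ} (hδ : 0 < δ) (τ : ℝ) {t : ℝ} (ht : δ / 2 ≤ |t|)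
    (ht' : |t| ≤ 1 - δ / 2) : straighten c m δ (τ, t) = c t := by
  simp [straighten, cutoff_one_eq_one hδ ht ht']

theorem straighten_one_eq_right {c m : ℝ → E} {δ : ℝ} (hδ : 0 < δ) (hδ1 : δ ≤ 1) {t : ℝ}
    (ht : |t| < δ / 4) : straighten c m δ (1, t) = m t := by
  simp [straighten, cutoff_eq_zero hδ hδ1 ht]

/-- The curves agree to first order at 0, so on a window of width proportional to `δ` they differ by
at most a small multiple of `δ`. This beats the slope `C / δ` of the cutoff, and all interpolating
curves have velocity close to `v` there. Hence they are embedded near the basepoint, and compactness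
keeps the unmodified remainder away. -/
theorem exists_straighten {ε : ℝ} (hε : ε = 1 ∨ ε = -1) {c m : ℝ → E} (hc : ContDiff ℝ ∞ c)
    (hm : ContDiff ℝ ∞ m) (hcp : ∀ t, c (t + 1) = ε • c t) (hmp : ∀ t, m (t + 1) = ε • m t)
    (h0 : m 0 = c 0) (h0' : deriv m 0 = deriv c 0) (he : ‖c 0‖ = 1)
    (hev : ⟪c 0, deriv c 0⟫ = 0) (hv : deriv c 0 ≠ 0) (hc0 : ∀ t, c t ≠ 0)
    (hbase : ∀ t a : ℝ, 0 < t → t < 1 → c t ≠ a • c 0) :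
    ∃ δ > 0, δ ≤ 1 / 4 ∧ ∀ τ ∈ Set.Icc (0 : ℝ) 1,
      NoBaseCrossing (fun t => straighten c m δ (τ, t)) δ ∧
      ∀ t a : ℝ, |t| ≤ δ →
        deriv (fun t => straighten c m δ (τ, t)) t ≠ a • straighten c m δ (τ, t) := by
  set e := c 0 with hedef
  set v := deriv c 0 with hvdef
  have he0 : e ≠ 0 := hc0 0
  obtain ⟨C, hC0, hC⟩ := exists_deriv_bump_le
  have hvpos : 0 < ‖v‖ := norm_pos_iff.2 hv
  -- The velocities of `c` and `m` will be within `κ` of `v`, and the slope of the cutoff adds at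
  -- most `C * κ`. Four times the total has to stay below `‖v‖`.
  set κ := ‖v‖ / (5 * (1 + C)) with hκdef
  have hκ0 : 0 < κ := by positivity
  have hκ : 4 * (κ + C * κ) < ‖v‖ := by
    have h1 : κ * (5 * (1 + C)) = ‖v‖ := by rw [hκdef]; field_simp
    nlinarith
  have hcc : Continuous (deriv c) := hc.continuous_deriv (by simp)
  have hmc : Continuous (deriv m) := hm.continuous_deriv (by simp)
  have ev : ∀ᶠ t in 𝓝 (0 : ℝ), ‖deriv c t - v‖ < κ ∧ ‖deriv m t - v‖ < κ ∧
      ‖c t - e‖ < 1 / 2 ∧ ‖m t - e‖ < 1 / 2 := by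
    have hcn := hc.continuous
    have hmn := hm.continuous
    refine Filter.Eventually.and ?_ (Filter.Eventually.and ?_ (Filter.Eventually.and ?_ ?_))
    · exact ContinuousAt.eventually_lt (by fun_prop) continuousAt_const (by simpa [hvdef] using hκ0)
    · exact ContinuousAt.eventually_lt (by fun_prop) continuousAt_const (by simpa [h0'] using hκ0)
    · exact ContinuousAt.eventually_lt (by fun_prop) continuousAt_const (by simp [hedef])
    · exact ContinuousAt.eventually_lt (by fun_prop) continuousAt_const (by simp [h0])
  obtain ⟨η₀, hη₀, hev₀⟩ := Metric.eventually_nhds_iff.1 ev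
  set η := min (η₀ / 2) (1 / 4) with hηdef
  have hη : 0 < η := by positivity
  have hη4 : η ≤ 1 / 4 := min_le_right _ _
  have hnear : ∀ t, |t| ≤ η → ‖deriv c t - v‖ < κ ∧ ‖deriv m t - v‖ < κ ∧
      ‖c t - e‖ < 1 / 2 ∧ ‖m t - e‖ < 1 / 2 := by
    intro t ht
    refine hev₀ ?_
    rw [Real.dist_eq, sub_zero]
    have : η ≤ η₀ / 2 := min_le_left _ _
    linarith
  obtain ⟨μ, hμ, hμc⟩ := exists_noncollinear_nhds hc.continuous he0
    (isCompact_Icc (a := η) (b := 1 - η)) hc0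
    (fun t ht a => hbase t a (by linarith [ht.1]) (by linarith [ht.2]))
  have ev2 : ∀ᶠ t in 𝓝 (0 : ℝ), ‖c t - e‖ < μ ∧ ‖m t - e‖ < μ := by
    have hcn := hc.continuous
    have hmn := hm.continuous
    refine Filter.Eventually.and ?_ ?_
    · exact ContinuousAt.eventually_lt (by fun_prop) continuousAt_const (by simpa [hedef] using hμ)
    · exact ContinuousAt.eventually_lt (by fun_prop) continuousAt_const (by simpa [h0] using hμ)
  obtain ⟨δ₀, hδ₀, hev3⟩ := Metric.eventually_nhds_iff.1 ev2
  -- There are two scales. Up to `η` the velocity estimate separates points of the curve. Beyond `η`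
  -- the curve is unmodified and stays off the lines through all vectors within `μ` of `e`; the
  -- window `δ` is so short that its points are such vectors.
  set δ := min (δ₀ / 2) η with hδdef
  have hδ : 0 < δ := by positivity
  have hδη : δ ≤ η := min_le_right _ _
  have hδ1 : δ ≤ 1 := by linarith
  have hnear2 : ∀ t, |t| ≤ δ → ‖c t - e‖ < μ ∧ ‖m t - e‖ < μ := by
    intro t ht
    refine hev3 ?_
    rw [Real.dist_eq, sub_zero]
    have : δ ≤ δ₀ / 2 := min_le_left _ _
    linarith
  have hdc : ∀ t, HasDerivAt c (deriv c t) t := fun t =>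
    (hc.differentiable (by simp) t).hasDerivAt
  have hdm : ∀ t, HasDerivAt m (deriv m t) t := fun t =>
    (hm.differentiable (by simp) t).hasDerivAt
  have hdiff : ∀ t, |t| ≤ δ / 2 → ‖m t - c t‖ ≤ κ * δ := by
    intro t ht
    have h1 : ‖(m t - c t) - (m 0 - c 0)‖ ≤ 2 * κ * ‖t - 0‖ := by
      refine Convex.norm_image_sub_le_of_norm_hasDerivWithin_le (s := Set.Icc (-η) η)
        (f := fun x => m x - c x) (f' := fun x => deriv m x - deriv c x)
        (fun x _ => ((hdm x).sub (hdc x)).hasDerivWithinAt) (fun x hx => ?_) (convex_Icc _ _)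
        ⟨by linarith, by linarith⟩ (abs_le.1 (by linarith))
      obtain ⟨k1, k2, -, -⟩ := hnear x (abs_le.2 hx)
      calc ‖deriv m x - deriv c x‖ = ‖(deriv m x - v) - (deriv c x - v)‖ := by
            rw [sub_sub_sub_cancel_right]
        _ ≤ ‖deriv m x - v‖ + ‖deriv c x - v‖ := norm_sub_le _ _
        _ ≤ 2 * κ := by linarith
    rw [h0, sub_self, sub_zero, sub_zero, Real.norm_eq_abs] at h1
    nlinarith
  refine ⟨δ, hδ, by linarith, fun τ hτ => ?_⟩
  have hs : ContDiff ℝ ∞ fun t => straighten c m δ (τ, t) :=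
    (contDiff_straighten hc hm hδ hδ1).comp (contDiff_const.prodMk contDiff_id)
  have hq : ∀ t, τ * (1 - cutoff 1 δ t) ∈ Set.Icc (0 : ℝ) 1 := fun t => by
    obtain ⟨k1, k2⟩ := cutoff_one_mem (η := δ) t
    exact ⟨mul_nonneg hτ.1 (by linarith), mul_le_one₀ hτ.2 (by linarith) (by linarith)⟩
  have hconv : ∀ (q r : ℝ) (x y z : E), q ∈ Set.Icc (0 : ℝ) 1 → ‖x - z‖ < r → ‖y - z‖ < r →
      ‖x + q • (y - x) - z‖ < r := by
    intro q r x y z hq hx hy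
    have := convex_ball z r (mem_ball_iff_norm.2 hx) (mem_ball_iff_norm.2 hy)
      (sub_nonneg.2 hq.2) hq.1 (by ring)
    rw [mem_ball_iff_norm] at this
    have e1 : x + q • (y - x) - z = (1 - q) • x + q • y - z := by module
    rwa [e1]
  have hs2 : ∀ t, |t| ≤ η → ‖straighten c m δ (τ, t) - e‖ ≤ 1 / 2 := fun t ht =>
    (hconv _ _ _ _ _ (hq t) (hnear t ht).2.2.1 (hnear t ht).2.2.2).le
  have hs1 : ∀ t, |t| ≤ η → ‖deriv (fun t => straighten c m δ (τ, t)) t - v‖ ≤ κ + C * κ := by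
    intro t ht
    have hcut : HasDerivAt (cutoff 1 δ) (deriv (cutoff 1 δ) t) t :=
      ((contDiff_cutoff one_ne_zero hδ hδ1).differentiable (by simp) t).hasDerivAt
    have hd : HasDerivAt (fun t => straighten c m δ (τ, t))
        (deriv c t + ((τ * (1 - cutoff 1 δ t)) • (deriv m t - deriv c t) +
          (τ * -deriv (cutoff 1 δ) t) • (m t - c t))) t :=
      (hdc t).add (((hcut.const_sub 1).const_mul τ).smul ((hdm t).sub (hdc t)))
    rw [hd.deriv]
    have h3 : ‖(τ * -deriv (cutoff 1 δ) t) • (m t - c t)‖ ≤ C * κ := by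
      rcases le_or_gt |t| (δ / 2) with h | h
      · rw [norm_smul, norm_mul, norm_neg, Real.norm_eq_abs, Real.norm_eq_abs, abs_of_nonneg hτ.1]
        calc τ * |deriv (cutoff 1 δ) t| * ‖m t - c t‖ ≤ 1 * (C / δ) * (κ * δ) := by
              gcongr
              · exact hτ.2
              · exact abs_deriv_cutoff_one_le hδ hδ1 hC0 (hC δ hδ) (by linarith)
              · exact hdiff t h
          _ = C * κ := by field_simp
      · have : cutoff 1 δ =ᶠ[𝓝 t] fun _ => 1 := by
          have h1 : ∀ᶠ x in 𝓝 t, δ / 2 < |x| := continuousAt_const.eventually_lt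
            continuous_abs.continuousAt h
          have h2 : ∀ᶠ x in 𝓝 t, |x| < 1 - δ / 2 :=
            continuous_abs.continuousAt.eventually_lt continuousAt_const (by linarith)
          filter_upwards [h1, h2] with x hx1 hx2
          exact cutoff_one_eq_one hδ hx1.le hx2.le
        rw [this.deriv_eq]
        simp only [deriv_const, neg_zero, mul_zero, zero_smul, norm_zero]
        positivity
    have h4 := hconv _ _ _ _ _ (hq t) (hnear t ht).1 (hnear t ht).2.1
    calc _ = ‖(deriv c t + (τ * (1 - cutoff 1 δ t)) • (deriv m t - deriv c t) - v) +
          (τ * -deriv (cutoff 1 δ) t) • (m t - c t)‖ := by congr 1; abel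
      _ ≤ _ := norm_add_le _ _
      _ ≤ κ + C * κ := by linarith
  constructor
  · intro s t a hs' hst
    simp only at hst
    set k := round t with hk
    have hr : |t - k| ≤ 1 / 2 := abs_sub_round t
    set t' := t - (k : ℝ) with ht'
    have hper : ∀ t, straighten c m δ (τ, t + 1) = ε • straighten c m δ (τ, t) :=
      straighten_add_one hcp hmp τ
    have htt : t = t' + k := by rw [ht']; ring
    have hε0 := ne_zero_of_sign hε
    have hz : ε ^ k ≠ 0 := zpow_ne_zero _ hε0
    have h1 : straighten c m δ (τ, t') = ((ε ^ k)⁻¹ * a) • straighten c m δ (τ, s) := by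
      rw [mul_smul, ← hst, htt,
        equivariant_int hε (f := fun t => straighten c m δ (τ, t)) hper, smul_smul,
        inv_mul_cancel₀ hz, one_smul]
    rcases le_or_gt |t'| η with h | h
    · have h2 := eq_of_smul_of_deriv_near (hs.differentiable (by simp)) he hev hκ hs1 hs2
        (hs'.trans hδη) h h1
      exact ⟨k, by rw [htt, h2]⟩
    · exfalso
      rw [straighten_eq_left hδ τ (by linarith) (by linarith)] at h1
      have h3 : ‖straighten c m δ (τ, s) - e‖ < μ :=
        hconv _ _ _ _ _ (hq s) (hnear2 s hs').1 (hnear2 s hs').2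
      rcases lt_or_ge t' 0 with h4 | h4
      · rw [abs_of_neg h4] at h hr
        refine hμc _ h3 (t' + 1) ⟨by linarith, by linarith⟩ (ε * ((ε ^ k)⁻¹ * a)) ?_
        rw [hcp, h1, smul_smul]
      · rw [abs_of_nonneg h4] at h hr
        exact hμc _ h3 t' ⟨by linarith, by linarith⟩ _ h1
  · intro t a ht
    exact deriv_ne_smul_of_deriv_near (f := fun t => straighten c m δ (τ, t)) he hev hκ
      (hs1 t (ht.trans hδη)) (hs2 t (ht.trans hδη)) a

end Straighten

/-! ### Pushing a monotone curve away from the basepoint -/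

theorem not_int_of_mem_Ioo {x : ℝ} (h0 : 0 < x) (h1 : x < 1) (k : ℤ) : x ≠ k := by
  rintro rfl
  have h2 : 0 < k := by exact_mod_cast h0
  have h3 : k < 1 := by exact_mod_cast h1
  omega

section Push

variable {E : Type*} [NormedAddCommGroup E] [InnerProductSpace ℝ E]

theorem NoBaseCrossing.ne_smul {c : ℝ → E} {δ : ℝ} (h : NoBaseCrossing c δ) {s t : ℝ}
    (hs : |s| ≤ δ) (h0 : s < t) (h1 : t < s + 1) (a : ℝ) : c t ≠ a • c s := by
  intro hc
  obtain ⟨k, hk⟩ := h s t a hs hc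
  exact not_int_of_mem_Ioo (x := t - s) (by linarith) (by linarith) k (by linarith)

theorem NoBaseCrossing.mono {c : ℝ → E} {δ δ' : ℝ} (h : NoBaseCrossing c δ) (hδ : δ' ≤ δ) :
    NoBaseCrossing c δ' :=
  fun s t a hs => h s t a (hs.trans hδ)

/-- Both branches of a crossing are away from the basepoint. -/
theorem NoBaseCrossing.lt {ε : ℝ} {c : ℝ → E} {δ : ℝ} (h : NoBaseCrossing c δ)
    (hc : ∀ t, c (t + 1) = ε • c t) (hc0 : ∀ t, c t ≠ 0) {s t a : ℝ} (hs : 0 ≤ s) (hst : s < t)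
    (ht : t < 1) (hct : c t = a • c s) : δ < s ∧ t < 1 - δ := by
  have ha : a ≠ 0 := by
    rintro rfl
    rw [zero_smul] at hct
    exact hc0 t hct
  constructor
  · by_contra hcon
    exact h.ne_smul (abs_le.2 ⟨by linarith, not_lt.1 hcon⟩) hst (by linarith) a hct
  · by_contra hcon
    have h1 : c t = ε • c (t - 1) := by rw [← hc, sub_add_cancel]
    refine h.ne_smul (s := t - 1) (t := s) (abs_le.2 ⟨by linarith, by linarith⟩) (by linarith)
      (by linarith) (a⁻¹ * ε) ?_
    rw [mul_smul, ← h1, hct, smul_smul, inv_mul_cancel₀ ha, one_smul]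

/-- The linear interpolation between `c` and the point opposite to `c 0`, away from the
integers. -/
def pushAway (ε : ℝ) (c : ℝ → E) (δ : ℝ) (p : ℝ × ℝ) : E :=
  (1 - p.1 * cutoff 1 δ p.2) • c p.2 - (p.1 * cutoff ε δ p.2) • c 0

theorem contDiff_pushAway {ε : ℝ} (hε : ε ≠ 0) {c : ℝ → E} (hc : ContDiff ℝ ∞ c) {δ : ℝ}
    (hδ : 0 < δ) (hδ1 : δ ≤ 1) : ContDiff ℝ ∞ (pushAway ε c δ) :=
  ((contDiff_const.sub (contDiff_fst.mul
    ((contDiff_cutoff one_ne_zero hδ hδ1).comp contDiff_snd))).smul (hc.comp contDiff_snd)).sub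
  ((contDiff_fst.mul ((contDiff_cutoff hε hδ hδ1).comp contDiff_snd)).smul contDiff_const)

/-- The factor `c t` carries the sign `ε` itself, so its coefficient is periodic; the vector `c 0`
is constant, so its coefficient has to carry the sign. -/
theorem pushAway_add_one {ε : ℝ} (hε : ε ≠ 0) {c : ℝ → E} {δ : ℝ}
    (hc : ∀ t, c (t + 1) = ε • c t) (τ t : ℝ) :
    pushAway ε c δ (τ, t + 1) = ε • pushAway ε c δ (τ, t) := by
  simp only [pushAway, hc, cutoff_add_one one_ne_zero, cutoff_add_one hε]
  module

theorem pushAway_zero (ε : ℝ) (c : ℝ → E) (δ t : ℝ) : pushAway ε c δ (0, t) = c t := by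
  simp [pushAway]

theorem pushAway_eq_left {ε : ℝ} {c : ℝ → E} {δ : ℝ} (hδ : 0 < δ) (hδ1 : δ ≤ 1) (τ : ℝ) {t : ℝ}
    (ht : |t| < δ / 4) : pushAway ε c δ (τ, t) = c t := by
  simp [pushAway, cutoff_eq_zero hδ hδ1 ht]

theorem pushAway_of_mem {ε : ℝ} {c : ℝ → E} {δ : ℝ} (τ : ℝ) {t : ℝ} (h0 : 0 ≤ t) (h1 : t < 1) :
    pushAway ε c δ (τ, t) = (1 - τ * bump δ t) • c t - (τ * bump δ t) • c 0 := by
  simp [pushAway, cutoff_of_mem h0 h1]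

/-- The segment from `x` to `-e` meets the line of `e` only at `-e`, which lies on the opposite ray.
The case `a = 0` says that the segment avoids the origin. -/
theorem interpolate_ne_smul {x e : E} (he : e ≠ 0) (hx : ∀ a : ℝ, x ≠ a • e) {q a : ℝ}
    (hq : q ∈ Set.Icc (0 : ℝ) 1) (ha : 0 ≤ a) : (1 - q) • x - q • e ≠ a • e := by
  intro h
  rcases eq_or_lt_of_le hq.2 with h1 | h1
  · rw [h1, sub_self, zero_smul, zero_sub, one_smul] at h
    have h2 : (a + 1) • e = 0 := by rw [add_smul, ← h, one_smul]; abel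
    rcases smul_eq_zero.1 h2 with h3 | h3
    · linarith
    · exact he h3
  · have h2 : 1 - q ≠ 0 := by linarith
    refine hx ((1 - q)⁻¹ * (a + q)) ?_
    have h3 : (a + q) • e = (1 - q) • x := by rw [add_smul, ← h]; abel
    rw [mul_smul, h3, smul_smul, inv_mul_cancel₀ h2, one_smul]

end Push

/-- Crossings created by the push are resolved by the model height wherever it is monotone at the
first branch. The zone near the basepoint where it is cut off is so short that the projection there
is still `c`, which is immersed and has no crossing with itself there. -/
theorem exists_isKnotPair_pushAway {ε : ℝ} (hε : ε = 1 ∨ ε = -1)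
    {c : ℝ → EuclideanSpace ℝ (Fin 3)} (hc : ContDiff ℝ ∞ c) (hcp : ∀ t, c (t + 1) = ε • c t)
    (hc0 : ∀ t, c t ≠ 0) {δ : ℝ} (hδ : 0 < δ) (hδ1 : δ ≤ 1 / 2) (hbase : NoBaseCrossing c δ)
    (himm : ∀ t a : ℝ, |t| ≤ δ → deriv c t ≠ a • c t) :
    ∃ δ₀ > 0, ∀ δ' > 0, δ' ≤ δ₀ → ∀ τ ∈ Set.Icc (0 : ℝ) 1,
      IsKnotPair ε (fun t => pushAway ε c δ (τ, t)) (modelHeight ε δ') := by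
  have hε0 := ne_zero_of_sign hε
  have hδ1' : δ ≤ 1 := by linarith
  set e := c 0 with he
  have he0 : e ≠ 0 := hc0 0
  have hce : ∀ t, 0 < t → t < 1 → ∀ a : ℝ, c t ≠ a • e := fun t h0 h1 a =>
    hbase.ne_smul (s := 0) (by simpa using hδ.le) h0 (by linarith) a
  have hq : ∀ τ ∈ Set.Icc (0 : ℝ) 1, ∀ t, τ * bump δ t ∈ Set.Icc (0 : ℝ) 1 := fun τ hτ t =>
    ⟨mul_nonneg hτ.1 (bump_nonneg _ _), mul_le_one₀ hτ.2 (bump_nonneg _ _) (bump_le_one _ _)⟩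
  have hne : ∀ τ ∈ Set.Icc (0 : ℝ) 1, ∀ t, 0 < t → t < 1 → ∀ a : ℝ, 0 ≤ a →
      pushAway ε c δ (τ, t) ≠ a • e := by
    intro τ hτ t h0 h1 a ha
    rw [pushAway_of_mem τ h0.le h1]
    exact interpolate_ne_smul he0 (hce t h0 h1) (hq τ hτ t) ha
  have hpc : Continuous (pushAway ε c δ) := (contDiff_pushAway hε0 hc hδ hδ1').continuous
  have hcn := hc.continuous
  -- Strictness in Cauchy–Schwarz excludes nonnegative multiples. It holds at `c 0` by
  -- `interpolate_ne_smul` and persists for `c s` with `s` near 0 by compactness.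
  have key : ∀ᶠ s in 𝓝 (0 : ℝ), ∀ p ∈ Set.Icc (0 : ℝ) 1 ×ˢ Set.Icc (δ / 4) (1 - δ / 4),
      ⟪pushAway ε c δ p, c s⟫ < ‖pushAway ε c δ p‖ * ‖c s‖ := by
    refine (isCompact_Icc.prod isCompact_Icc).eventually_forall_of_forall_eventually ?_
    rintro ⟨τ, t⟩ ⟨hτ, ht⟩
    have c1 : Continuous fun z : ℝ × (ℝ × ℝ) => ⟪pushAway ε c δ z.2, c z.1⟫ := by fun_prop
    have c2 : Continuous fun z : ℝ × (ℝ × ℝ) => ‖pushAway ε c δ z.2‖ * ‖c z.1‖ := by fun_prop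
    refine c1.continuousAt.eventually_lt c2.continuousAt ?_
    refine lt_of_le_of_ne (real_inner_le_norm _ _) fun heq => ?_
    have h1 := inner_eq_norm_mul_iff_real.1 heq
    simp only [← he] at h1
    refine hne τ hτ t (by linarith [ht.1]) (by linarith [ht.2])
      (‖e‖⁻¹ * ‖pushAway ε c δ (τ, t)‖) (by positivity) ?_
    rw [mul_smul, ← h1, smul_smul, inv_mul_cancel₀ (norm_ne_zero_iff.2 he0), one_smul]
  obtain ⟨δ₁, hδ₁, hball⟩ := Metric.eventually_nhds_iff.1 key
  refine ⟨min δ₁ (δ / 4), by positivity, fun δ' hδ' hle τ hτ => ?_⟩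
  have hle1 : δ' ≤ δ₁ := hle.trans (min_le_left _ _)
  have hle2 : δ' ≤ δ / 4 := hle.trans (min_le_right _ _)
  have hps : ContDiff ℝ ∞ fun t => pushAway ε c δ (τ, t) :=
    (contDiff_pushAway hε0 hc hδ hδ1').comp (contDiff_const.prodMk contDiff_id)
  have hper : ∀ t, pushAway ε c δ (τ, t + 1) = ε • pushAway ε c δ (τ, t) :=
    pushAway_add_one hε0 hcp τ
  have hp0 : ∀ t, pushAway ε c δ (τ, t) ≠ 0 := by
    intro t
    have h1 : pushAway ε c δ (τ, t) = ε ^ ⌊t⌋ • pushAway ε c δ (τ, Int.fract t) := by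
      rw [← equivariant_int hε (f := fun t => pushAway ε c δ (τ, t)) hper, Int.fract_add_floor]
    rw [h1]
    refine smul_ne_zero (zpow_ne_zero _ hε0) ?_
    rcases (Int.fract_nonneg t).eq_or_lt with h | h
    · rw [← h, pushAway_eq_left hδ hδ1' τ (by simpa using hδ)]
      exact he0
    · have := hne τ hτ _ h (Int.fract_lt_one t) 0 le_rfl
      rwa [zero_smul] at this
  have hleft : ∀ t, |t| < δ / 4 → pushAway ε c δ (τ, t) = c t := fun t ht =>
    pushAway_eq_left hδ hδ1' τ ht
  have hleft' : ∀ t, |t - 1| < δ / 4 → pushAway ε c δ (τ, t) = c t := fun t ht => by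
    have h1 := hper (t - 1)
    rw [sub_add_cancel, hleft _ ht, ← hcp, sub_add_cancel] at h1
    exact h1
  refine ⟨hps, contDiff_modelHeight hε0 hδ' (by linarith), hper, modelHeight_add_one hε0, hp0,
    fun t => ?_, ?_⟩
  · have hfr : t + ((-⌊t⌋ : ℤ) : ℝ) = Int.fract t := by
      rw [Int.fract]; push_cast; ring
    by_cases hmid : δ' / 2 < Int.fract t ∧ Int.fract t < 1 - δ' / 2
    -- Here the projection may stand still, but the height has slope `-1`.
    · refine ⟨-⌊t⌋, fun a _ => ?_⟩
      rw [hfr, deriv_modelHeight hδ' hmid.1 hmid.2]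
      norm_num
    · obtain ⟨k, hk⟩ : ∃ k : ℤ, |t + k| ≤ δ' / 2 := by
        rcases le_or_gt (Int.fract t) (δ' / 2) with h | h
        · refine ⟨-⌊t⌋, ?_⟩
          rw [hfr, abs_of_nonneg (Int.fract_nonneg t)]; exact h
        · have h2 : 1 - δ' / 2 ≤ Int.fract t := by
            by_contra h3
            exact hmid ⟨h, not_le.1 h3⟩
          refine ⟨-⌊t⌋ - 1, ?_⟩
          have h3 : t + ((-⌊t⌋ - 1 : ℤ) : ℝ) = Int.fract t - 1 := by
            rw [← hfr]; push_cast; ring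
          rw [h3, abs_le]
          have := Int.fract_lt_one t
          constructor <;> linarith
      refine ⟨k, fun a hder => absurd hder ?_⟩
      have hev : (fun t => pushAway ε c δ (τ, t)) =ᶠ[𝓝 (t + k)] c := by
        have h1 : ∀ᶠ x in 𝓝 (t + k), |x| < δ / 4 :=
          continuous_abs.continuousAt.eventually_lt continuousAt_const (by linarith)
        filter_upwards [h1] with x hx
        exact hleft x hx
      rw [hev.deriv_eq, hleft _ (by linarith)]
      exact himm _ a (by linarith)
  · intro s t a hs hst ht hct
    have ha : a ≠ 0 := by
      rintro rfl
      rw [zero_smul] at hct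
      exact hp0 t hct
    -- If the first branch lies in the initial cutoff zone, its height is known only to be
    -- nonnegative, and the position of the second branch has to be used.
    rcases lt_or_ge s (δ' / 2) with h1 | h1
    · have hsa : |s| < δ' / 2 := abs_lt.2 ⟨by linarith, h1⟩
      rw [hleft s (by linarith)] at hct
      by_cases hmid : δ / 4 ≤ t ∧ t ≤ 1 - δ / 4
      -- For `a < 0` the positive height of the second branch acquires the wrong sign for a
      -- coincidence; for `a ≥ 0` such a crossing is excluded by `key`.
      · rcases lt_or_ge a 0 with h2 | h2
        · have h3 : 0 ≤ modelHeight ε δ' s := modelHeight_nonneg hs (by linarith)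
          have h4 : modelHeight ε δ' t = 2 - t :=
            modelHeight_eq hδ' (by linarith [hmid.1]) (by linarith [hmid.2])
          have h5 : 0 ≤ |a| * modelHeight ε δ' s := mul_nonneg (abs_nonneg a) h3
          have h6 : a * modelHeight ε δ' t < 0 := by
            rw [h4]
            exact mul_neg_of_neg_of_pos h2 (by linarith)
          exact (h6.trans_le h5).ne'
        · exfalso
          have h3 := hball (y := s) (by rw [Real.dist_eq, sub_zero]; linarith) (τ, t) ⟨hτ, hmid⟩
          rw [hct, real_inner_smul_left, real_inner_self_eq_norm_sq, norm_smul,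
            Real.norm_of_nonneg h2] at h3
          exact absurd h3 (by rw [not_lt]; apply le_of_eq; ring)
      · exfalso
        have h3 : pushAway ε c δ (τ, t) = c t := by
          rcases lt_or_ge t (δ / 4) with h4 | h4
          · exact hleft t (abs_lt.2 ⟨by linarith, h4⟩)
          · have h5 : 1 - δ / 4 < t := by
              by_contra h6
              exact hmid ⟨h4, not_lt.1 h6⟩
            exact hleft' t (abs_lt.2 ⟨by linarith, by linarith⟩)
        rw [h3] at hct
        exact hbase.ne_smul (by linarith) hst (by linarith) a hct
    · rcases le_or_gt s (1 - δ' / 2) with h2 | h2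
      · exact (modelHeight_lt hδ' ha h1 h2 hst ht).ne'
      · exfalso
        rw [hleft' s (abs_lt.2 ⟨by linarith, by linarith⟩),
          hleft' t (abs_lt.2 ⟨by linarith, by linarith⟩)] at hct
        have := (hbase.lt hcp hc0 hs hst ht hct).2
        linarith

/-! ### Descending curves are unknotted -/

/-- At each crossing of `c`, the branch passed first is above the other one, measured by the
height `ζ` and the direction of `c` at the first branch. -/
def IsDescendingPair (c : ℝ → EuclideanSpace ℝ (Fin 3)) (ζ : ℝ → ℝ) : Prop :=
  ∀ s t a : ℝ, 0 < s → s < t → t < 1 → c t = a • c s → a * ζ t < |a| * ζ s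

theorem NoBaseCrossing.isDescendingPair_modelHeight {ε : ℝ}
    {c : ℝ → EuclideanSpace ℝ (Fin 3)} (hcp : ∀ t, c (t + 1) = ε • c t) (hc0 : ∀ t, c t ≠ 0)
    {δ : ℝ} (h : NoBaseCrossing c δ) {η : ℝ} (hη : 0 < η) (hηδ : η ≤ δ) :
    IsDescendingPair c (modelHeight ε η) := by
  intro s t a hs hst ht hct
  obtain ⟨h1, h2⟩ := h.lt hcp hc0 hs.le hst ht hct
  refine modelHeight_lt hη ?_ (by linarith) (by linarith) hst ht
  rintro rfl
  rw [zero_smul] at hct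
  exact hc0 t hct

theorem IsDescendingPair.isKnotPair {ε : ℝ} {c : ℝ → EuclideanSpace ℝ (Fin 3)}
    {ζ : ℝ → ℝ} (hc : ContDiff ℝ ∞ c) (hζ : ContDiff ℝ ∞ ζ) (hcp : ∀ t, c (t + 1) = ε • c t)
    (hζp : ∀ t, ζ (t + 1) = ε * ζ t) (hc0 : ∀ t, c t ≠ 0)
    (himm : ∀ t, ∃ k : ℤ, ∀ a : ℝ, deriv c (t + k) ≠ a • c (t + k))
    (hbase : ∀ t a : ℝ, 0 < t → t < 1 → c t ≠ a • c 0) (h : IsDescendingPair c ζ) :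
    IsKnotPair ε c ζ := by
  refine ⟨hc, hζ, hcp, hζp, hc0, fun t => ?_, fun s t a hs hst ht hct => ?_⟩
  · obtain ⟨k, hk⟩ := himm t
    exact ⟨k, fun a ha => absurd ha (hk a)⟩
  · rcases hs.eq_or_lt with rfl | hs
    · exact absurd hct (hbase t a hst ht)
    · exact (h s t a hs hst ht hct).ne'

/-- Two descending heights over the same curve give isotopic knots. -/
theorem IsDescendingPair.ambientIsotopic {ε : ℝ} (hε : ε = 1 ∨ ε = -1)
    {c : ℝ → EuclideanSpace ℝ (Fin 3)} {ζ ξ : ℝ → ℝ} (hc : ContDiff ℝ ∞ c)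
    (hζ : ContDiff ℝ ∞ ζ) (hξ : ContDiff ℝ ∞ ξ) (hcp : ∀ t, c (t + 1) = ε • c t)
    (hζp : ∀ t, ζ (t + 1) = ε * ζ t) (hξp : ∀ t, ξ (t + 1) = ε * ξ t) (hc0 : ∀ t, c t ≠ 0)
    (himm : ∀ t, ∃ k : ℤ, ∀ a : ℝ, deriv c (t + k) ≠ a • c (t + k))
    (hbase : ∀ t a : ℝ, 0 < t → t < 1 → c t ≠ a • c 0) (h : IsDescendingPair c ζ)
    (h' : IsDescendingPair c ξ) :
    AmbientIsotopic (curveSet (knotCurve c ζ)) (curveSet (knotCurve c ξ)) := by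
  -- The descending inequalities are linear in the height, so the segment between two descending
  -- heights consists of descending heights.
  have key := ambientIsotopic_of_knotPair hε (c := fun p => c p.2)
    (ζ := fun p => (1 - p.1) * ζ p.2 + p.1 * ξ p.2) (hc.comp contDiff_snd)
    (((contDiff_const.sub contDiff_fst).mul (hζ.comp contDiff_snd)).add
      (contDiff_fst.mul (hξ.comp contDiff_snd))) fun τ hτ => by
      have hs : ContDiff ℝ ∞ fun t => (1 - τ) * ζ t + τ * ξ t :=
        (contDiff_const.mul hζ).add (contDiff_const.mul hξ)
      refine IsDescendingPair.isKnotPair hc hs hcp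
        (fun t => by simp only [hζp, hξp]; ring) hc0 himm hbase ?_
      intro s t a hs hst ht hct
      have h1 := h s t a hs hst ht hct
      have h2 := h' s t a hs hst ht hct
      rcases eq_or_lt_of_le hτ.1 with h3 | h3
      · simp only [← h3]
        linarith
      · nlinarith [mul_pos h3 (sub_pos.2 h2), mul_nonneg (sub_nonneg.2 hτ.2) (sub_pos.2 h1).le]
  simpa using key

/-- A descending knot is isotopic to a plane curve with the same behaviour at the basepoint. -/
theorem IsDescendingPair.ambientIsotopic_model {ε : ℝ} (hε : ε = 1 ∨ ε = -1)
    {c m : ℝ → EuclideanSpace ℝ (Fin 3)} {ζ : ℝ → ℝ} (hc : ContDiff ℝ ∞ c)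
    (hζ : ContDiff ℝ ∞ ζ) (hcp : ∀ t, c (t + 1) = ε • c t) (hζp : ∀ t, ζ (t + 1) = ε * ζ t)
    (hunit : ∀ t, ‖c t‖ = 1) (himm : ∀ t, deriv c t ≠ 0)
    (hbase : ∀ t a : ℝ, 0 < t → t < 1 → c t ≠ a • c 0) (h : IsDescendingPair c ζ)
    (hm : ContDiff ℝ ∞ m) (hmp : ∀ t, m (t + 1) = ε • m t) (h0 : m 0 = c 0)
    (h0' : deriv m 0 = deriv c 0) (hm0 : ∀ t, m t ≠ 0)
    (hminj : ∀ s t a : ℝ, m t = a • m s → ∃ k : ℤ, t = s + k)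
    (hmimm : ∀ t a : ℝ, deriv m t ≠ a • m t) :
    AmbientIsotopic (curveSet (knotCurve c ζ)) (curveSet (knotCurve m fun _ => 0)) := by
  have hε0 := ne_zero_of_sign hε
  have hc0 : ∀ t, c t ≠ 0 := fun t h1 => by simpa [h1] using hunit t
  have horth : ∀ t, ⟪c t, deriv c t⟫ = 0 := by
    intro t
    have h1 : HasDerivAt c (deriv c t) t := (hc.differentiable (by simp) t).hasDerivAt
    have h2 := h1.norm_sq
    simp only [hunit] at h2
    have h3 := h2.unique (hasDerivAt_const t ((1 : ℝ) ^ 2))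
    linarith
  have himm' : ∀ t a : ℝ, deriv c t ≠ a • c t := by
    intro t a h1
    have h2 := horth t
    rw [h1, inner_smul_right, real_inner_self_eq_norm_sq, hunit] at h2
    have h3 : a = 0 := by linarith
    exact himm t (by rw [h1, h3, zero_smul])
  obtain ⟨δ, hδ, hδ4, hstr⟩ := exists_straighten hε hc hm hcp hmp h0 h0' (hunit 0) (horth 0)
    (himm 0) hc0 hbase
  have hδ1 : δ ≤ 1 := by linarith
  have hss := contDiff_straighten hc hm hδ hδ1
  have hss' : ∀ τ, ContDiff ℝ ∞ fun t => straighten c m δ (τ, t) := fun τ =>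
    hss.comp (contDiff_const.prodMk contDiff_id)
  have hsp : ∀ τ t, straighten c m δ (τ, t + 1) = ε • straighten c m δ (τ, t) :=
    straighten_add_one hcp hmp
  have hsl : ∀ τ t, δ ≤ |t| → |t| ≤ 1 - δ → straighten c m δ (τ, t) = c t := fun τ t h1 h2 =>
    straighten_eq_left hδ τ (by linarith) (by linarith)
  have hs0 : ∀ τ ∈ Set.Icc (0 : ℝ) 1, ∀ t, straighten c m δ (τ, t) ≠ 0 := by
    intro τ hτ t ht
    -- A zero at `t` would be the multiple by 0 of the points at both 0 and `δ`, which would make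
    -- both `t` and `t - δ` integers.
    obtain ⟨k, hk⟩ := (hstr τ hτ).1 0 t 0 (by simpa using hδ.le) (by simpa using ht)
    obtain ⟨l, hl⟩ := (hstr τ hτ).1 δ t 0 (abs_of_pos hδ).le (by simpa using ht)
    exact not_int_of_mem_Ioo hδ (by linarith) (k - l) (by push_cast; linarith)
  have hsimm : ∀ τ ∈ Set.Icc (0 : ℝ) 1, ∀ t, ∃ k : ℤ, ∀ a : ℝ,
      deriv (fun t => straighten c m δ (τ, t)) (t + k) ≠ a • straighten c m δ (τ, t + k) := by
    intro τ hτ t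
    refine ⟨-round t, fun a => ?_⟩
    have hr : |t + ((-round t : ℤ) : ℝ)| ≤ 1 / 2 := by
      have := abs_sub_round t
      rwa [Int.cast_neg, ← sub_eq_add_neg]
    set u := t + ((-round t : ℤ) : ℝ)
    rcases le_or_gt |u| δ with h1 | h1
    · exact (hstr τ hτ).2 u a h1
    · have hev : (fun t => straighten c m δ (τ, t)) =ᶠ[𝓝 u] c := by
        have h2 : ∀ᶠ x in 𝓝 u, δ < |x| :=
          continuousAt_const.eventually_lt continuous_abs.continuousAt h1
        have h3 : ∀ᶠ x in 𝓝 u, |x| < 1 - δ :=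
          continuous_abs.continuousAt.eventually_lt continuousAt_const (by linarith)
        filter_upwards [h2, h3] with x hx1 hx2
        exact hsl τ x hx1.le hx2.le
      rw [hev.deriv_eq, hsl τ u h1.le (by linarith)]
      exact himm' u a
  have hsbase : ∀ τ ∈ Set.Icc (0 : ℝ) 1, ∀ t a : ℝ, 0 < t → t < 1 →
      straighten c m δ (τ, t) ≠ a • straighten c m δ (τ, 0) := fun τ hτ t a ht ht' =>
    (hstr τ hτ).1.ne_smul (s := 0) (by simpa using hδ.le) ht (by linarith) a
  -- Every crossing of a straightened curve has both branches outside the modified window, so it is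
  -- a crossing of `c`.
  have hsdesc : ∀ τ ∈ Set.Icc (0 : ℝ) 1,
      IsDescendingPair (fun t => straighten c m δ (τ, t)) ζ := by
    intro τ hτ s t a hs hst ht hct
    obtain ⟨h1, h2⟩ := (hstr τ hτ).1.lt (hsp τ) (hs0 τ hτ) hs.le hst ht hct
    simp only at hct
    rw [hsl τ t (by rw [abs_of_pos (by linarith)]; linarith)
        (by rw [abs_of_pos (by linarith)]; linarith),
      hsl τ s (by rw [abs_of_pos hs]; linarith) (by rw [abs_of_pos hs]; linarith)] at hct
    exact h s t a hs hst ht hct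
  have step1 : AmbientIsotopic (curveSet (knotCurve c ζ))
      (curveSet (knotCurve (fun t => straighten c m δ (1, t)) ζ)) := by
    have key := ambientIsotopic_of_knotPair hε (c := straighten c m δ) (ζ := fun p => ζ p.2) hss
      (hζ.comp contDiff_snd) fun τ hτ =>
        (hsdesc τ hτ).isKnotPair (hss' τ) hζ (hsp τ) hζp (hs0 τ hτ) (hsimm τ hτ) (hsbase τ hτ)
    simpa only [straighten_zero] using key
  have hI : (1 : ℝ) ∈ Set.Icc (0 : ℝ) 1 := by simp
  set d : ℝ → EuclideanSpace ℝ (Fin 3) := fun t => straighten c m δ (1, t) with hd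
  have hmb : ∀ η, NoBaseCrossing m η := fun η s t a _ hst => hminj s t a hst
  -- The push uses the width `δ / 2` so that its cutoff is already 1 for `|t| ≥ δ / 4`, while `d =
  -- m` holds for `|t| < δ / 4`.
  obtain ⟨η₁, hη₁, hpush₁⟩ := exists_isKnotPair_pushAway hε (hss' 1) (hsp 1) (hs0 1 hI)
    (δ := δ / 2) (by linarith) (by linarith) ((hstr 1 hI).1.mono (by linarith))
    (fun t a ht => (hstr 1 hI).2 t a (by linarith))
  obtain ⟨η₂, hη₂, hpush₂⟩ := exists_isKnotPair_pushAway hε hm hmp hm0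
    (δ := δ / 2) (by linarith) (by linarith) (hmb _) (fun t a _ => hmimm t a)
  set η := min (min η₁ η₂) δ with hη
  have hη0 : 0 < η := by positivity
  have hηδ : η ≤ δ := min_le_right _ _
  have hη1 : η ≤ η₁ := (min_le_left _ _).trans (min_le_left _ _)
  have hη2 : η ≤ η₂ := (min_le_left _ _).trans (min_le_right _ _)
  have hmod : ContDiff ℝ ∞ (modelHeight ε η) := contDiff_modelHeight hε0 hη0 (by linarith)
  have step2 : AmbientIsotopic (curveSet (knotCurve d ζ))
      (curveSet (knotCurve d (modelHeight ε η))) :=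
    (hsdesc 1 hI).ambientIsotopic hε (hss' 1) hζ hmod (hsp 1) hζp (modelHeight_add_one hε0)
      (hs0 1 hI) (hsimm 1 hI) (hsbase 1 hI)
      ((hstr 1 hI).1.isDescendingPair_modelHeight (hsp 1) (hs0 1 hI) hη0 hηδ)
  have push : ∀ f : ℝ → EuclideanSpace ℝ (Fin 3), ContDiff ℝ ∞ f →
      (∀ τ ∈ Set.Icc (0 : ℝ) 1,
        IsKnotPair ε (fun t => pushAway ε f (δ / 2) (τ, t)) (modelHeight ε η)) →
      AmbientIsotopic (curveSet (knotCurve f (modelHeight ε η)))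
        (curveSet (knotCurve (fun t => pushAway ε f (δ / 2) (1, t)) (modelHeight ε η))) := by
    intro f hf hk
    have key := ambientIsotopic_of_knotPair hε (c := pushAway ε f (δ / 2))
      (ζ := fun p => modelHeight ε η p.2)
      (contDiff_pushAway hε0 hf (by linarith) (by linarith)) (hmod.comp contDiff_snd) hk
    simpa only [pushAway_zero] using key
  -- Near the integers `d` and `m` agree; elsewhere the push at time 1 has removed their
  -- contribution altogether.
  have hend : (fun t => pushAway ε d (δ / 2) (1, t)) = fun t => pushAway ε m (δ / 2) (1, t) := by
    funext t
    have hd0 : d 0 = m 0 := straighten_one_eq_right hδ hδ1 (by simpa using hδ)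
    have hr : |t - round t| ≤ 1 / 2 := abs_sub_round t
    set u := t - (round t : ℝ) with hu
    have htu : t = u + (round t : ℤ) := by rw [hu]; ring
    have hcut : cutoff 1 (δ / 2) t = cutoff 1 (δ / 2) u := by
      rw [htu, equivariant_int (ε := 1) (Or.inl rfl) (f := cutoff 1 (δ / 2))
        (cutoff_add_one one_ne_zero)]
      simp
    simp only [pushAway, hd0, hcut, one_mul]
    congr 1
    rcases lt_or_ge |u| (δ / 4) with h1 | h1
    · have h2 : d t = m t := by
        rw [htu, equivariant_int hε (f := d) (hsp 1), equivariant_int hε hmp]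
        congr 1
        exact straighten_one_eq_right hδ hδ1 h1
      rw [h2]
    · rw [cutoff_one_eq_one (by linarith) (by linarith) (by linarith)]
      simp
  have step3 := push d (hss' 1) (hpush₁ η hη0 hη1)
  have step4 := push m hm (hpush₂ η hη0 hη2)
  rw [hend] at step3
  have hnone : ∀ s t a : ℝ, 0 ≤ s → s < t → t < 1 → m t ≠ a • m s := fun s t a hs hst ht =>
    (hmb |s|).ne_smul le_rfl hst (by linarith) a
  -- The model has no crossings, so every height over it is descending, in particular the zero
  -- height.
  have step5 : AmbientIsotopic (curveSet (knotCurve m (modelHeight ε η)))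
      (curveSet (knotCurve m fun _ => 0)) :=
    IsDescendingPair.ambientIsotopic hε hm hmod contDiff_const hmp (modelHeight_add_one hε0)
      (fun t => by simp) hm0 (fun t => ⟨0, hmimm _⟩) (fun t a ht ht' => hnone 0 t a le_rfl ht ht')
      (fun s t a hs hst ht hct => absurd hct (hnone s t a hs.le hst ht))
      (fun s t a hs hst ht hct => absurd hct (hnone s t a hs.le hst ht))
  exact step1.trans (step2.trans (step3.trans (step4.symm.trans step5)))

/-! ### The plane model curves -/

/-- The three vectors are linearly independent. -/
def IsIndependent (e v n : EuclideanSpace ℝ (Fin 3)) : Prop :=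
  ∀ a b d : ℝ, a • e + b • v + d • n = 0 → a = 0 ∧ b = 0 ∧ d = 0

theorem exists_linearEquiv_embL {p q r : EuclideanSpace ℝ (Fin 3)} (h : IsIndependent p q r) :
    ∃ A : (Fin 4 → ℝ) ≃ₗ[ℝ] (Fin 4 → ℝ),
      ∀ x, A x = embL (x 0 • p + x 1 • q + x 3 • r, x 2) := by
  let f : (Fin 4 → ℝ) →ₗ[ℝ] (Fin 4 → ℝ) :=
    { toFun := fun x => embL (x 0 • p + x 1 • q + x 3 • r, x 2)
      map_add' := fun x y => by
        rw [← map_add]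
        congr 1
        refine Prod.ext ?_ rfl
        simp only [Pi.add_apply, Prod.fst_add]
        module
      map_smul' := fun a x => by
        rw [RingHom.id_apply, ← map_smul]
        congr 1
        refine Prod.ext ?_ rfl
        simp only [Pi.smul_apply, Prod.smul_fst, smul_eq_mul]
        module }
  have hf : Function.Injective f := by
    rw [injective_iff_map_eq_zero]
    intro x hx
    have h1 : embL (x 0 • p + x 1 • q + x 3 • r, x 2) = embL (0, 0) := by
      rw [show ((0 : EuclideanSpace ℝ (Fin 3)), (0 : ℝ)) = 0 from rfl, map_zero]
      exact hx
    have h2 := Prod.mk.inj (embL_injective h1)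
    obtain ⟨h3, h4, h5⟩ := h _ _ _ h2.1
    ext i
    fin_cases i
    exacts [h3, h4, h2.2, h5]
  exact ⟨LinearEquiv.ofInjectiveEndo f hf, fun x => rfl⟩

theorem curveSet_eq_linPerm_image {γ : ℝ → Fin 4 → ℝ} {X : Set (Fin 4 → ℝ)}
    (A : (Fin 4 → ℝ) ≃ₗ[ℝ] (Fin 4 → ℝ)) (h₁ : ∀ t, ∃ x ∈ X, A x = γ t)
    (h₂ : ∀ x ∈ X, x ≠ 0 → ∃ r t : ℝ, A x = r • γ t) :
    curveSet γ = linPerm A '' projSet X := by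
  apply Set.Subset.antisymm
  · rintro _ ⟨t, ht, rfl⟩
    obtain ⟨x, hx, hxt⟩ := h₁ t
    have hx0 : x ≠ 0 := by
      rintro rfl
      rw [map_zero] at hxt
      exact ht hxt.symm
    refine ⟨_, ⟨x, hx0, hx, rfl⟩, ?_⟩
    simp only [linPerm_mk, hxt]
  · rintro _ ⟨_, ⟨x, hx0, hx, rfl⟩, rfl⟩
    obtain ⟨r, t, hrt⟩ := h₂ x hx hx0
    have hA : A x ≠ 0 := (isHomogeneous_of_linear A).ne_zero x hx0
    have ht : γ t ≠ 0 := by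
      intro h
      rw [hrt, h, smul_zero] at hA
      exact hA rfl
    refine ⟨t, ht, ?_⟩
    rw [linPerm_mk, Projectivization.mk_eq_mk_iff']
    exact ⟨r, hrt.symm⟩

section Model

variable {e v n : EuclideanSpace ℝ (Fin 3)}

/-- A conic through `e` with velocity `v`. -/
def conicModel (e v n : EuclideanSpace ℝ (Fin 3)) (t : ℝ) : EuclideanSpace ℝ (Fin 3) :=
  e + (Real.sin (2 * Real.pi * t) / (2 * Real.pi)) • v + (1 - Real.cos (2 * Real.pi * t)) • n

/-- A line through `e` with velocity `v`. -/
def lineModel (e v : EuclideanSpace ℝ (Fin 3)) (t : ℝ) : EuclideanSpace ℝ (Fin 3) :=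
  Real.cos (Real.pi * t) • e + (Real.sin (Real.pi * t) / Real.pi) • v

theorem eq_of_independent (h : IsIndependent e v n)
    {a b d a' b' d' : ℝ} (heq : a • e + b • v + d • n = a' • e + b' • v + d' • n) :
    a = a' ∧ b = b' ∧ d = d' := by
  have h1 : (a - a') • e + (b - b') • v + (d - d') • n = 0 := by
    rw [← sub_eq_zero] at heq
    rw [← heq]
    module
  obtain ⟨h2, h3, h4⟩ := h _ _ _ h1
  exact ⟨sub_eq_zero.1 h2, sub_eq_zero.1 h3, sub_eq_zero.1 h4⟩

theorem contDiff_conicModel (e v n : EuclideanSpace ℝ (Fin 3)) :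
    ContDiff ℝ ∞ (conicModel e v n) := by
  unfold conicModel
  have h1 : ContDiff ℝ ∞ fun t : ℝ => Real.sin (2 * Real.pi * t) :=
    Real.contDiff_sin.comp (contDiff_const.mul contDiff_id)
  have h2 : ContDiff ℝ ∞ fun t : ℝ => Real.cos (2 * Real.pi * t) :=
    Real.contDiff_cos.comp (contDiff_const.mul contDiff_id)
  exact (contDiff_const.add ((h1.div_const _).smul contDiff_const)).add
    ((contDiff_const.sub h2).smul contDiff_const)

theorem contDiff_lineModel (e v : EuclideanSpace ℝ (Fin 3)) : ContDiff ℝ ∞ (lineModel e v) := by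
  unfold lineModel
  have h1 : ContDiff ℝ ∞ fun t : ℝ => Real.sin (Real.pi * t) :=
    Real.contDiff_sin.comp (contDiff_const.mul contDiff_id)
  have h2 : ContDiff ℝ ∞ fun t : ℝ => Real.cos (Real.pi * t) :=
    Real.contDiff_cos.comp (contDiff_const.mul contDiff_id)
  exact (h2.smul contDiff_const).add ((h1.div_const _).smul contDiff_const)

theorem deriv_conicModel (t : ℝ) : deriv (conicModel e v n) t =
    (0 : ℝ) • e + Real.cos (2 * Real.pi * t) • v +
      (2 * Real.pi * Real.sin (2 * Real.pi * t)) • n := by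
  have h0 : HasDerivAt (fun t : ℝ => 2 * Real.pi * t) (2 * Real.pi) t := by
    simpa using (hasDerivAt_id t).const_mul (2 * Real.pi)
  have h1 := (h0.sin.div_const (2 * Real.pi)).smul_const v
  have h2 := (h0.cos.const_sub 1).smul_const n
  have h3 : HasDerivAt (conicModel e v n) _ t := (h1.const_add e).add h2
  rw [h3.deriv, zero_smul, zero_add]
  congr 2
  · field_simp
  · ring

theorem deriv_lineModel (t : ℝ) : deriv (lineModel e v) t =
    (-(Real.pi * Real.sin (Real.pi * t))) • e + Real.cos (Real.pi * t) • v := by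
  have h0 : HasDerivAt (fun t : ℝ => Real.pi * t) Real.pi t := by
    simpa using (hasDerivAt_id t).const_mul Real.pi
  have h1 := (h0.sin.div_const Real.pi).smul_const v
  have h2 := h0.cos.smul_const e
  have h3 : HasDerivAt (lineModel e v) _ t := h2.add h1
  rw [h3.deriv]
  congr 2
  · ring
  · field_simp

theorem conicModel_add_one (t : ℝ) : conicModel e v n (t + 1) = (1 : ℝ) • conicModel e v n t := by
  have h1 : 2 * Real.pi * (t + 1) = 2 * Real.pi * t + 2 * Real.pi := by ring
  rw [conicModel, conicModel, h1, Real.sin_add_two_pi, Real.cos_add_two_pi, one_smul]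

theorem lineModel_add_one (t : ℝ) : lineModel e v (t + 1) = (-1 : ℝ) • lineModel e v t := by
  have h1 : Real.pi * (t + 1) = Real.pi * t + Real.pi := by ring
  rw [lineModel, lineModel, h1, Real.sin_add_pi, Real.cos_add_pi]
  module

theorem conicModel_eq (t : ℝ) : conicModel e v n t =
    (1 : ℝ) • e + (Real.sin (2 * Real.pi * t) / (2 * Real.pi)) • v +
      (1 - Real.cos (2 * Real.pi * t)) • n := by
  rw [conicModel, one_smul]

theorem lineModel_eq (t : ℝ) : lineModel e v t =
    Real.cos (Real.pi * t) • e + (Real.sin (Real.pi * t) / Real.pi) • v + (0 : ℝ) • n := by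
  rw [lineModel, zero_smul, add_zero]

theorem smul_triple (a x y z : ℝ) :
    a • (x • e + y • v + z • n) = (a * x) • e + (a * y) • v + (a * z) • n := by
  module

theorem conicModel_inj (h : IsIndependent e v n) (s t a : ℝ)
    (hst : conicModel e v n t = a • conicModel e v n s) :
    ∃ k : ℤ, t = s + k := by
  rw [conicModel_eq, conicModel_eq, smul_triple] at hst
  obtain ⟨h1, h2, h3⟩ := eq_of_independent h hst
  have ha : a = 1 := by linarith
  rw [ha, one_mul] at h2 h3
  have hs : Real.sin (2 * Real.pi * t) = Real.sin (2 * Real.pi * s) := by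
    field_simp at h2
    exact h2
  have hc : Real.cos (2 * Real.pi * t) = Real.cos (2 * Real.pi * s) := by linarith
  have h4 : Real.cos (2 * Real.pi * t - 2 * Real.pi * s) = 1 := by
    rw [Real.cos_sub, hs, hc]
    nlinarith [Real.sin_sq_add_cos_sq (2 * Real.pi * s)]
  obtain ⟨k, hk⟩ := (Real.cos_eq_one_iff _).1 h4
  refine ⟨k, ?_⟩
  have h5 : 2 * Real.pi * (t - s - k) = 0 := by linarith
  have h6 := (mul_eq_zero.1 h5).resolve_left (by positivity)
  linarith

theorem lineModel_inj (h : IsIndependent e v n) (s t a : ℝ)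
    (hst : lineModel e v t = a • lineModel e v s) :
    ∃ k : ℤ, t = s + k := by
  rw [lineModel_eq (n := n), lineModel_eq (n := n), smul_triple] at hst
  obtain ⟨h1, h2, -⟩ := eq_of_independent h hst
  have hs : Real.sin (Real.pi * t) = a * Real.sin (Real.pi * s) := by
    field_simp at h2
    exact h2
  have h4 : Real.sin (Real.pi * t - Real.pi * s) = 0 := by
    rw [Real.sin_sub, hs, h1]
    ring
  obtain ⟨k, hk⟩ := Real.sin_eq_zero_iff.1 h4
  refine ⟨k, ?_⟩
  have h5 : Real.pi * (t - s - k) = 0 := by linarith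
  have h6 := (mul_eq_zero.1 h5).resolve_left (by positivity)
  linarith

theorem deriv_conicModel_ne (h : IsIndependent e v n) (t a : ℝ) :
    deriv (conicModel e v n) t ≠ a • conicModel e v n t := by
  intro hst
  rw [deriv_conicModel, conicModel_eq, smul_triple] at hst
  obtain ⟨h1, h2, h3⟩ := eq_of_independent h hst
  have ha : a = 0 := by linarith
  rw [ha, zero_mul] at h2 h3
  have hs : Real.sin (2 * Real.pi * t) = 0 :=
    (mul_eq_zero.1 h3).resolve_left (by positivity)
  have := Real.sin_sq_add_cos_sq (2 * Real.pi * t)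
  rw [hs, h2] at this
  norm_num at this

theorem deriv_lineModel_ne (h : IsIndependent e v n) (t a : ℝ) :
    deriv (lineModel e v) t ≠ a • lineModel e v t := by
  intro hst
  have h0 : deriv (lineModel e v) t = (-(Real.pi * Real.sin (Real.pi * t))) • e +
      Real.cos (Real.pi * t) • v + (0 : ℝ) • n := by rw [deriv_lineModel, zero_smul, add_zero]
  rw [h0, lineModel_eq (n := n), smul_triple] at hst
  obtain ⟨h1, h2, -⟩ := eq_of_independent h hst
  have h3 : Real.pi * Real.cos (Real.pi * t) = a * Real.sin (Real.pi * t) := by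
    field_simp at h2
    linarith
  have h4 := Real.sin_sq_add_cos_sq (Real.pi * t)
  have h5 : Real.pi = 0 := by
    linear_combination Real.cos (Real.pi * t) * h3 - Real.sin (Real.pi * t) * h1 - Real.pi * h4
  exact Real.pi_ne_zero h5

theorem conicModel_ne_zero (h : IsIndependent e v n) (t : ℝ) : conicModel e v n t ≠ 0 := by
  rw [conicModel_eq]
  intro h0
  exact one_ne_zero (h _ _ _ h0).1

theorem lineModel_ne_zero (h : IsIndependent e v n) (t : ℝ) : lineModel e v t ≠ 0 := by
  rw [lineModel_eq (n := n)]
  intro h0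
  obtain ⟨h1, h2, -⟩ := h _ _ _ h0
  have hs : Real.sin (Real.pi * t) = 0 := by
    field_simp at h2
    simpa using h2
  have := Real.sin_sq_add_cos_sq (Real.pi * t)
  rw [hs, h1] at this
  norm_num at this

/-! ### Identification of the models with linear images of the standard unknots. -/

theorem exists_polar (x y : ℝ) : ∃ r θ : ℝ, r ^ 2 = x ^ 2 + y ^ 2 ∧ 0 ≤ r ∧
    x = r * Real.cos θ ∧ y = r * Real.sin θ := by
  refine ⟨‖(⟨x, y⟩ : ℂ)‖, Complex.arg ⟨x, y⟩, ?_, norm_nonneg _, ?_, ?_⟩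
  · rw [Complex.sq_norm, Complex.normSq_mk]; ring
  · rw [Complex.norm_mul_cos_arg]
  · rw [Complex.norm_mul_sin_arg]

theorem ambientIsotopic_lineModel (h : IsIndependent e v n) :
    AmbientIsotopic (curveSet (knotCurve (lineModel e v) fun _ => 0)) projectiveLine := by
  obtain ⟨A, hA⟩ := exists_linearEquiv_embL (p := e) (q := n) (r := v) (fun a b d habd => by
    obtain ⟨h1, h2, h3⟩ := h a d b (by rw [← habd]; abel)
    exact ⟨h1, h3, h2⟩)
  have hset : curveSet (knotCurve (lineModel e v) fun _ => 0) = linPerm A '' projectiveLine := by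
    rw [projectiveLine_eq_projSet]
    refine curveSet_eq_linPerm_image A (fun t => ?_) ?_
    · refine ⟨![Real.cos (Real.pi * t), 0, 0, Real.sin (Real.pi * t) / Real.pi], by simp, ?_⟩
      rw [hA, knotCurve, lineModel]
      simp
    · rintro x ⟨hx1, hx2⟩ -
      obtain ⟨r, θ, -, -, hr1, hr2⟩ := exists_polar (x 0) (Real.pi * x 3)
      refine ⟨r, θ / Real.pi, ?_⟩
      rw [hA, knotCurve, lineModel, embL_eq_smul]
      have h1 : Real.pi * (θ / Real.pi) = θ := by field_simp
      have h2 : x 3 = r * (Real.sin θ / Real.pi) := by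
        field_simp
        linarith
      rw [h1, hx1, hx2, hr1, h2]
      refine ⟨by module, by simp⟩
  rw [hset]
  exact ambientIsotopic_linPerm_projectiveLine A

theorem ambientIsotopic_conicModel (h : IsIndependent e v n) :
    AmbientIsotopic (curveSet (knotCurve (conicModel e v n) fun _ => 0)) planarCircle := by
  -- The conic is `(e + n) - cos • n + (sin / (2π)) • v`, the image under `B` of the circle point
  -- `(-cos, sin, 0, 1)` divided by `2π`.
  obtain ⟨B, hB⟩ := exists_linearEquiv_embL (p := (2 * Real.pi) • n) (q := v)
    (r := (2 * Real.pi) • (e + n)) (fun a b d habd => by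
      obtain ⟨h1, h2, h3⟩ := h (d * (2 * Real.pi)) b (a * (2 * Real.pi) + d * (2 * Real.pi))
        (by rw [← habd]; module)
      rw [h1, add_zero] at h3
      exact ⟨(mul_eq_zero.1 h3).resolve_right (by positivity), h2,
        (mul_eq_zero.1 h1).resolve_right (by positivity)⟩)
  have hset : curveSet (knotCurve (conicModel e v n) fun _ => 0) = linPerm B '' planarCircle := by
    rw [planarCircle_eq_projSet]
    refine curveSet_eq_linPerm_image B (fun t => ?_) ?_
    · refine ⟨(2 * Real.pi)⁻¹ •
        ![-Real.cos (2 * Real.pi * t), Real.sin (2 * Real.pi * t), 0, 1], ⟨by simp, ?_⟩, ?_⟩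
      · simp only [Pi.smul_apply, smul_eq_mul, Matrix.cons_val]
        linear_combination ((2 * Real.pi)⁻¹) ^ 2 * Real.sin_sq_add_cos_sq (2 * Real.pi * t)
      · rw [map_smul, hB, knotCurve, conicModel, ← map_smul, mul_zero]
        congr 1
        refine Prod.ext ?_ (by simp)
        simp only [Matrix.cons_val, Prod.smul_mk]
        have h2 : (2 * Real.pi)⁻¹ * (2 * Real.pi) = 1 := inv_mul_cancel₀ (by positivity)
        simp only [smul_add, smul_smul, one_mul]
        rw [show (2 * Real.pi)⁻¹ * (-Real.cos (2 * Real.pi * t) * (2 * Real.pi)) =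
          -Real.cos (2 * Real.pi * t) by linear_combination -Real.cos (2 * Real.pi * t) * h2, h2]
        module
    · rintro x ⟨hx2, hx⟩ hx0
      have h3 : x 3 ≠ 0 := by
        intro h3
        rw [h3] at hx
        apply hx0
        have e0 : x 0 = 0 := by nlinarith [sq_nonneg (x 0), sq_nonneg (x 1)]
        have e1 : x 1 = 0 := by nlinarith [sq_nonneg (x 0), sq_nonneg (x 1)]
        ext i
        fin_cases i
        exacts [e0, e1, hx2, h3]
      obtain ⟨r, θ, hr, hr0, hr1, hr2⟩ := exists_polar (-(x 0 / x 3)) (x 1 / x 3)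
      have hr' : r = 1 := by
        have : r ^ 2 = 1 := by
          rw [hr]
          field_simp
          linarith
        nlinarith
      rw [hr', one_mul] at hr1 hr2
      have e0 : x 0 = -(x 3 * Real.cos θ) := by rw [← hr1]; field_simp
      have e1 : x 1 = x 3 * Real.sin θ := by rw [← hr2]; field_simp
      refine ⟨x 3 * (2 * Real.pi), θ / (2 * Real.pi), ?_⟩
      rw [hB, knotCurve, conicModel, embL_eq_smul, hx2]
      have h1 : 2 * Real.pi * (θ / (2 * Real.pi)) = θ := by field_simp
      rw [h1, e0, e1]
      refine ⟨?_, by simp⟩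
      have h2 : x 3 * Real.sin θ = x 3 * (2 * Real.pi) * (Real.sin θ / (2 * Real.pi)) := by
        field_simp
      rw [h2]
      module
  rw [hset]
  exact ambientIsotopic_linPerm_planarCircle B

end Model

theorem exists_independent {e v : EuclideanSpace ℝ (Fin 3)} (he : e ≠ 0) (hv : v ≠ 0)
    (hev : ⟪e, v⟫ = 0) : ∃ n : EuclideanSpace ℝ (Fin 3), IsIndependent e v n := by
  have h1 : LinearIndependent ℝ ![e, v] := by
    rw [LinearIndependent.pair_iff]
    intro s t hst
    have h2 := congrArg (fun x => ⟪e, x⟫) hst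
    have h3 := congrArg (fun x => ⟪v, x⟫) hst
    simp only [inner_add_right, inner_smul_right, hev, real_inner_comm e v, mul_zero, add_zero,
      zero_add, inner_zero_right, mul_eq_zero, inner_self_eq_zero, he, hv, or_false] at h2 h3
    exact ⟨h2, h3⟩
  obtain ⟨n, hn⟩ := exists_linearIndependent_cons_of_lt_finrank h1 (by simp)
  refine ⟨n, fun a b d habd => ?_⟩
  have h2 := Fintype.linearIndependent_iff.1 hn ![d, a, b] (by
    rw [Fin.sum_univ_three, ← habd]
    simp [Fin.cons]
    abel)
  exact ⟨h2 1, h2 2, h2 0⟩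

/-- A descending knot is an unknot. -/
theorem IsDescendingPair.isUnknot {ε : ℝ} (hε : ε = 1 ∨ ε = -1)
    {c : ℝ → EuclideanSpace ℝ (Fin 3)} {ζ : ℝ → ℝ} (hc : ContDiff ℝ ∞ c)
    (hζ : ContDiff ℝ ∞ ζ) (hcp : ∀ t, c (t + 1) = ε • c t) (hζp : ∀ t, ζ (t + 1) = ε * ζ t)
    (hunit : ∀ t, ‖c t‖ = 1) (himm : ∀ t, deriv c t ≠ 0)
    (hbase : ∀ t a : ℝ, 0 < t → t < 1 → c t ≠ a • c 0) (h : IsDescendingPair c ζ) :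
    AmbientIsotopic (curveSet (knotCurve c ζ)) planarCircle ∨
      AmbientIsotopic (curveSet (knotCurve c ζ)) projectiveLine := by
  have he : c 0 ≠ 0 := fun h1 => by simpa [h1] using hunit 0
  have horth : ⟪c 0, deriv c 0⟫ = 0 := by
    have h1 : HasDerivAt c (deriv c 0) 0 := (hc.differentiable (by simp) 0).hasDerivAt
    have h2 := h1.norm_sq
    simp only [hunit] at h2
    have h3 := h2.unique (hasDerivAt_const 0 ((1 : ℝ) ^ 2))
    linarith
  obtain ⟨n, hn⟩ := exists_independent he (himm 0) horth
  -- The sign of the lift selects the model, since straightening needs a model with the same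
  -- equivariance: a conic closes up in the sphere, a line only up to sign.
  rcases hε with rfl | rfl
  · left
    refine (h.ambientIsotopic_model (Or.inl rfl) hc hζ hcp hζp hunit himm hbase
      (contDiff_conicModel (c 0) (deriv c 0) n) conicModel_add_one ?_ ?_ (conicModel_ne_zero hn)
      (conicModel_inj hn) (deriv_conicModel_ne hn)).trans (ambientIsotopic_conicModel hn)
    · simp [conicModel]
    · simp [deriv_conicModel]
  · right
    refine (h.ambientIsotopic_model (Or.inr rfl) hc hζ hcp hζp hunit himm hbase
      (contDiff_lineModel (c 0) (deriv c 0)) lineModel_add_one ?_ ?_ (lineModel_ne_zero hn)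
      (lineModel_inj hn) (deriv_lineModel_ne hn)).trans (ambientIsotopic_lineModel hn)
    · simp [lineModel]
    · simp [deriv_lineModel]

/-! ### Sign changes at transverse zeros -/

/-- Zeros with nonvanishing derivative are isolated, and a bounded infinite set would have an
accumulation point. -/
theorem finite_zeros {w : ℝ → ℝ} (hw : Differentiable ℝ w) (hz : ∀ t, w t = 0 → deriv w t ≠ 0)
    (s : ℝ) : {u | 0 ≤ u ∧ u < s ∧ w u = 0}.Finite := by
  by_contra hinf
  obtain ⟨x, _, hx⟩ := Set.Infinite.exists_accPt_of_subset_isCompact (s := {u | 0 ≤ u ∧ u < s ∧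
    w u = 0}) hinf (isCompact_Icc (a := (0 : ℝ)) (b := s)) fun u hu => ⟨hu.1, hu.2.1.le⟩
  rw [accPt_iff_frequently_nhdsNE] at hx
  refine hx ?_
  have hne : ∀ᶠ u in 𝓝[≠] x, w u ≠ 0 := by
    by_cases h0 : w x = 0
    · exact (hw x).hasDerivAt.eventually_ne (hz x h0)
    · exact nhdsWithin_le_nhds ((hw x).continuousAt.eventually_ne h0)
  filter_upwards [hne] with u hu hu'
  exact hu hu'.2.2

/-- Around a transverse zero, the function changes its sign. -/
theorem exists_sign_change {w : ℝ → ℝ} {z : ℝ} (hz : w z = 0) (hd : deriv w z ≠ 0) :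
    ∃ η > 0, (∀ u, z - η < u → u < z → w u ≠ 0) ∧
      ∀ u u', z - η < u → u < z → z < u' → u' < z + η → w u * w u' < 0 := by
  rcases lt_or_gt_of_ne hd with h | h
  · obtain ⟨η, hη, hη'⟩ :=
      Metric.eventually_nhds_iff.1 (eventually_nhdsWithin_sign_eq_of_deriv_neg h hz)
    have hl : ∀ u, z - η < u → u < z → 0 < w u := fun u h1 h2 => by
      have := hη' (y := u) (by rw [Real.dist_eq, abs_lt]; constructor <;> linarith)
      rw [sign_pos (by linarith : 0 < z - u)] at this
      exact sign_eq_one_iff.1 this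
    have hr : ∀ u, z < u → u < z + η → w u < 0 := fun u h1 h2 => by
      have := hη' (y := u) (by rw [Real.dist_eq, abs_lt]; constructor <;> linarith)
      rw [sign_neg (by linarith : z - u < 0)] at this
      exact sign_eq_neg_one_iff.1 this
    exact ⟨η, hη, fun u h1 h2 => (hl u h1 h2).ne',
      fun u u' h1 h2 h3 h4 => mul_neg_of_pos_of_neg (hl u h1 h2) (hr u' h3 h4)⟩
  · obtain ⟨η, hη, hη'⟩ :=
      Metric.eventually_nhds_iff.1 (eventually_nhdsWithin_sign_eq_of_deriv_pos h hz)
    have hl : ∀ u, z - η < u → u < z → w u < 0 := fun u h1 h2 => by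
      have := hη' (y := u) (by rw [Real.dist_eq, abs_lt]; constructor <;> linarith)
      rw [sign_neg (by linarith : u - z < 0)] at this
      exact sign_eq_neg_one_iff.1 this
    have hr : ∀ u, z < u → u < z + η → 0 < w u := fun u h1 h2 => by
      have := hη' (y := u) (by rw [Real.dist_eq, abs_lt]; constructor <;> linarith)
      rw [sign_pos (by linarith : 0 < u - z)] at this
      exact sign_eq_one_iff.1 this
    exact ⟨η, hη, fun u h1 h2 => (hl u h1 h2).ne,
      fun u u' h1 h2 h3 h4 => mul_neg_of_neg_of_pos (hl u h1 h2) (hr u' h3 h4)⟩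

theorem mul_pos_of_no_zero {w : ℝ → ℝ} (hw : Continuous w) {a b : ℝ} (hab : a ≤ b)
    (h : ∀ u, a ≤ u → u ≤ b → w u ≠ 0) : 0 < w a * w b := by
  by_contra hcon
  rcases lt_or_gt_of_ne (h a le_rfl hab) with ha | ha
  · have hb : 0 ≤ w b := by
      by_contra hb
      exact hcon (mul_pos_of_neg_of_neg ha (not_le.1 hb))
    obtain ⟨u, hu, hu0⟩ := intermediate_value_Icc hab hw.continuousOn ⟨ha.le, hb⟩
    exact h u hu.1 hu.2 hu0
  · have hb : w b ≤ 0 := by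
      by_contra hb
      exact hcon (mul_pos ha (not_le.1 hb))
    obtain ⟨u, hu, hu0⟩ := intermediate_value_Icc' hab hw.continuousOn ⟨hb, ha.le⟩
    exact h u hu.1 hu.2 hu0

/-- The number of transverse zeros determines the sign. -/
theorem even_ncard_zeros_iff {w : ℝ → ℝ} (hw : Differentiable ℝ w)
    (hz : ∀ t, w t = 0 → deriv w t ≠ 0) (h0 : 0 < w 0) {s : ℝ} (hs : 0 ≤ s) (hws : w s ≠ 0) :
    Even {u | 0 ≤ u ∧ u < s ∧ w u = 0}.ncard ↔ 0 < w s := by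
  generalize hn : {u | 0 ≤ u ∧ u < s ∧ w u = 0}.ncard = n
  induction n generalizing s with
  | zero =>
    have hempty := (Set.ncard_eq_zero (finite_zeros hw hz s)).1 hn
    have h1 : 0 < w 0 * w s := by
      refine mul_pos_of_no_zero hw.continuous hs fun u hu hu' hu0 => ?_
      rcases hu'.eq_or_lt with rfl | hlt
      · exact hws hu0
      · exact Set.eq_empty_iff_forall_notMem.1 hempty u ⟨hu, hlt, hu0⟩
    exact iff_of_true (by simp) (pos_of_mul_pos_right h1 h0.le)
  | succ n ih =>
    set Z := {u | 0 ≤ u ∧ u < s ∧ w u = 0} with hZ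
    have hfin : Z.Finite := finite_zeros hw hz s
    have hne : Z.Nonempty := by
      rw [← Set.ncard_pos hfin, hn]
      omega
    -- Remove the last zero `z` before `s`. The sign is constant from just after `z` up to `s` and
    -- flips across `z`, and the induction hypothesis applies just before `z`.
    obtain ⟨z, hzZ, hmax⟩ := Set.exists_max_image Z id hfin hne
    obtain ⟨hz0, hzs, hwz⟩ := hzZ
    have hzpos : 0 < z := by
      rcases hz0.eq_or_lt with rfl | h
      · exact absurd hwz h0.ne'
      · exact h
    obtain ⟨η, hη, hη1, hη2⟩ := exists_sign_change hwz (hz z hwz)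
    obtain ⟨u, hu1, hu2⟩ := exists_between (max_lt hzpos (by linarith : z - η < z))
    obtain ⟨u', hu1', hu2'⟩ := exists_between (lt_min hzs (by linarith : z < z + η))
    have hu0 : 0 < u := (le_max_left _ _).trans_lt hu1
    have huη : z - η < u := (le_max_right _ _).trans_lt hu1
    have hneg : w u * w u' < 0 := hη2 u u' huη hu2 hu1' (hu2'.trans_le (min_le_right _ _))
    have hpos : 0 < w u' * w s := by
      have hus : u' < s := hu2'.trans_le (min_le_left _ _)
      refine mul_pos_of_no_zero hw.continuous hus.le fun x hx hx' hx0 => ?_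
      rcases hx'.eq_or_lt with rfl | hlt
      · exact hws hx0
      · have := hmax x ⟨by linarith, hlt, hx0⟩
        simp only [id] at this
        linarith
    have hset : Z = insert z {x | 0 ≤ x ∧ x < u ∧ w x = 0} := by
      ext x
      simp only [hZ, Set.mem_insert_iff, Set.mem_ofPred_eq]
      constructor
      · rintro ⟨h1, h2, h3⟩
        have h4 : x ≤ z := hmax x ⟨h1, h2, h3⟩
        rcases h4.eq_or_lt with h5 | h5
        · exact Or.inl h5
        · refine Or.inr ⟨h1, ?_, h3⟩
          by_contra h6
          exact hη1 x (by linarith) h5 h3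
      · rintro (rfl | ⟨h1, h2, h3⟩)
        · exact ⟨hz0, hzs, hwz⟩
        · exact ⟨h1, by linarith, h3⟩
    rw [hset, Set.ncard_insert_of_notMem (fun h => absurd h.2.1 (by linarith))
      (finite_zeros hw hz u), Nat.add_right_cancel_iff] at hn
    have hwu : w u ≠ 0 := hη1 u huη hu2
    rw [Nat.even_add_one, ih hu0.le hwu hn]
    constructor
    · intro h
      have h1 : w u < 0 := lt_of_le_of_ne (not_lt.1 h) hwu
      have h2 : 0 < w u' := pos_of_mul_neg_right hneg h1.le
      exact pos_of_mul_pos_right hpos h2.le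
    · intro h h1
      have h2 : w u' < 0 := neg_of_mul_neg_right hneg h1.le
      exact absurd hpos (not_lt.2 (mul_nonpos_of_nonpos_of_nonneg h2.le h.le))

/-! ### Normalized lifts of diagrams -/

/-- A lift of the net of `D` to the unit sphere, starting at the basepoint. -/
structure NormalizedLift (D : KnotDiagram) where
  /-- the parameter of the basepoint -/
  start : ℝ
  /-- the sign by which the lift changes along the circle -/
  sign : ℝ
  /-- the lift -/
  curve : ℝ → EuclideanSpace ℝ (Fin 3)
  start_eq : (start : UnitAddCircle) = D.basepoint
  sign_eq : sign = 1 ∨ sign = -1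
  smooth : ContDiff ℝ ∞ curve
  unit : ∀ t, ‖curve t‖ = 1
  periodic : ∀ t, curve (t + 1) = sign • curve t
  immersed : ∀ t, deriv curve t ≠ 0
  net_eq : ∀ t, ∃ h : (curve t).ofLp ≠ 0,
    D.net ((start + t : ℝ) : UnitAddCircle) = Projectivization.mk ℝ (curve t).ofLp h
  pos : 0 < curve 0 2
  transverse : ∀ t, curve t 2 = 0 → deriv (fun t => curve t 2) t ≠ 0

theorem mk_mem_lineAtInfinity (v : Fin 3 → ℝ) (hv : v ≠ 0) :
    Projectivization.mk ℝ v hv ∈ lineAtInfinity ↔ v 2 = 0 := by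
  simp only [lineAtInfinity, Set.mem_ofPred_eq, Projectivization.submodule_mk]
  constructor
  · exact fun h => h v (Submodule.mem_span_singleton_self v)
  · intro h w hw
    obtain ⟨a, rfl⟩ := Submodule.mem_span_singleton.1 hw
    simp [h]

/-- The factor at `t` is the inner product of `c t` and `c (t + 1)`. It is continuous in `t` with
square 1, hence constant. -/
theorem exists_sign_of_smul {c : ℝ → EuclideanSpace ℝ (Fin 3)} (hc : Continuous c)
    (hunit : ∀ t, ‖c t‖ = 1) (h : ∀ t, ∃ a : ℝ, c (t + 1) = a • c t) :
    ∃ ε : ℝ, (ε = 1 ∨ ε = -1) ∧ ∀ t, c (t + 1) = ε • c t := by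
  have hval : ∀ t, c (t + 1) = ⟪c t, c (t + 1)⟫ • c t ∧ ⟪c t, c (t + 1)⟫ ^ 2 = 1 := by
    intro t
    obtain ⟨a, ha⟩ := h t
    have h1 : ⟪c t, c (t + 1)⟫ = a := by
      rw [ha, inner_smul_right, real_inner_self_eq_norm_sq, hunit]; ring
    have h2 : ‖c (t + 1)‖ = |a| * ‖c t‖ := by rw [ha, norm_smul, Real.norm_eq_abs]
    rw [hunit, hunit, mul_one] at h2
    rw [h1, ← sq_abs, ← h2]
    exact ⟨ha, by norm_num⟩
  have hcont : Continuous fun t => ⟪c t, c (t + 1)⟫ := by fun_prop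
  rcases isPreconnected_univ.eq_one_or_eq_neg_one_of_sq_eq hcont.continuousOn
    (fun t _ => (hval t).2) with h1 | h1
  · refine ⟨1, Or.inl rfl, fun t => ?_⟩
    have h2 := h1 (Set.mem_univ t)
    simp only [Pi.one_apply] at h2
    have h3 := (hval t).1
    rwa [h2] at h3
  · refine ⟨-1, Or.inr rfl, fun t => ?_⟩
    have h2 := h1 (Set.mem_univ t)
    simp only [Pi.neg_apply, Pi.one_apply] at h2
    have h3 := (hval t).1
    rwa [h2] at h3

theorem KnotDiagram.nonempty_normalizedLift (D : KnotDiagram) : Nonempty (NormalizedLift D) := by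
  obtain ⟨γ, ⟨hγ, hγ'⟩, -, htr⟩ := D.generic
  obtain ⟨b, hb⟩ := QuotientAddGroup.mk_surjective D.basepoint
  have hb' : (b : UnitAddCircle) = D.basepoint := hb
  let L : EuclideanSpace ℝ (Fin 3) ≃L[ℝ] (Fin 3 → ℝ) := EuclideanSpace.equiv (Fin 3) ℝ
  set g : ℝ → EuclideanSpace ℝ (Fin 3) := fun t => L.symm (γ (b + t)) with hg
  have hγs : ContDiff ℝ ∞ fun t => γ (b + t) := hγ.comp (contDiff_const.add contDiff_id)
  have hgs : ContDiff ℝ ∞ g := L.symm.contDiff.comp hγs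
  have hγ0 : ∀ t, γ t ≠ 0 := fun t => (hγ' t).2.1
  have hg0 : ∀ t, g t ≠ 0 := fun t => by simpa [hg] using hγ0 (b + t)
  have hn0 : ∀ t, ‖g t‖ ≠ 0 := fun t => norm_ne_zero_iff.2 (hg0 t)
  have hb2 : γ b 2 ≠ 0 := by
    have h1 := D.basepoint_not_at_infinity
    obtain ⟨h2, h3⟩ := (hγ' b).2
    rw [← hb', h3, mk_mem_lineAtInfinity] at h1
    exact h1
  -- Of the two opposite lifts, the one with `w > 0` at the basepoint is taken, so that even arc
  -- distance corresponds to `w > 0`.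
  obtain ⟨σ, hσ, hσ2⟩ : ∃ σ : ℝ, (σ = 1 ∨ σ = -1) ∧ 0 < σ * γ b 2 := by
    rcases lt_or_gt_of_ne hb2 with h | h
    · exact ⟨-1, Or.inr rfl, by linarith⟩
    · exact ⟨1, Or.inl rfl, by linarith⟩
  have hσ0 := ne_zero_of_sign hσ
  have hσ1 : |σ| = 1 := by rcases hσ with h | h <;> simp [h]
  set ρ : ℝ → ℝ := fun t => σ * ‖g t‖⁻¹ with hρ
  have hρ0 : ∀ t, ρ t ≠ 0 := fun t => mul_ne_zero hσ0 (inv_ne_zero (hn0 t))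
  have hρs : ContDiff ℝ ∞ ρ := contDiff_const.mul ((hgs.norm ℝ hg0).inv hn0)
  have hρd : ∀ t, HasDerivAt ρ (deriv ρ t) t := fun t =>
    (hρs.differentiable (by simp) t).hasDerivAt
  have hγd : ∀ t, HasDerivAt (fun t => γ (b + t)) (deriv γ (b + t)) t := fun t => by
    have h1 := (hγ.differentiable (by simp) (b + t)).hasDerivAt
    exact h1.comp_const_add b t
  set c : ℝ → EuclideanSpace ℝ (Fin 3) := fun t => ρ t • g t with hc
  have hcs : ContDiff ℝ ∞ c := hρs.smul hgs
  have hcunit : ∀ t, ‖c t‖ = 1 := fun t => by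
    rw [hc, norm_smul, hρ, Real.norm_eq_abs, abs_mul, hσ1, one_mul, abs_inv, abs_norm,
      inv_mul_cancel₀ (hn0 t)]
  have hnet : ∀ t, ∃ h : (c t).ofLp ≠ 0,
      D.net ((b + t : ℝ) : UnitAddCircle) = Projectivization.mk ℝ (c t).ofLp h := by
    intro t
    have h1 : (c t).ofLp = ρ t • γ (b + t) := rfl
    obtain ⟨h2, h3⟩ := (hγ' (b + t)).2
    refine ⟨by rw [h1]; exact smul_ne_zero (hρ0 t) h2, ?_⟩
    rw [h3, Projectivization.mk_eq_mk_iff']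
    exact ⟨(ρ t)⁻¹, by rw [h1, smul_smul, inv_mul_cancel₀ (hρ0 t), one_smul]⟩
  obtain ⟨ε, hε, hper⟩ := exists_sign_of_smul hcs.continuous hcunit fun t => by
    obtain ⟨h1, h2⟩ := hnet t
    obtain ⟨h3, h4⟩ := hnet (t + 1)
    have h5 : ((b + (t + 1) : ℝ) : UnitAddCircle) = ((b + t : ℝ) : UnitAddCircle) := by
      rw [← add_assoc, AddCircle.coe_add_period]
    rw [h5, h2] at h4
    obtain ⟨a, ha⟩ := (Projectivization.mk_eq_mk_iff' ℝ _ _ h3 h1).1 h4.symm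
    refine ⟨a, ?_⟩
    ext i
    exact (congrFun ha i).symm
  refine ⟨⟨b, ε, c, hb', hε, hcs, hcunit, hper, fun t ht => ?_, hnet, ?_, fun t ht => ?_⟩⟩
  · have hgd : HasDerivAt g (L.symm (deriv γ (b + t))) t :=
      L.symm.hasFDerivAt.comp_hasDerivAt t (hγd t)
    have h1 : HasDerivAt c (ρ t • L.symm (deriv γ (b + t)) + deriv ρ t • g t) t :=
      (hρd t).smul hgd
    rw [h1.deriv] at ht
    have h2 : ρ t • deriv γ (b + t) + deriv ρ t • γ (b + t) = 0 := by
      have := congrArg L ht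
      simpa [hg] using this
    have h3 := (LinearIndependent.pair_iff' (hγ0 (b + t))).1 (hγ' (b + t)).1
      (-((ρ t)⁻¹ * deriv ρ t))
    apply h3
    have h4 : deriv ρ t • γ (b + t) = -(ρ t • deriv γ (b + t)) :=
      eq_neg_of_add_eq_zero_right h2
    rw [neg_smul, mul_smul, h4, smul_neg, neg_neg, smul_smul, inv_mul_cancel₀ (hρ0 t), one_smul]
  · have h1 : c 0 2 = ‖g 0‖⁻¹ * (σ * γ b 2) := by
      change (σ * ‖g 0‖⁻¹) * γ (b + 0) 2 = _
      rw [add_zero]; ring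
    rw [h1]
    exact mul_pos (inv_pos.2 (norm_pos_iff.2 (hg0 0))) hσ2
  · have h1 : (fun t => c t 2) = fun t => ρ t * γ (b + t) 2 := rfl
    have h2 : ρ t * γ (b + t) 2 = 0 := ht
    have h3 : γ (b + t) 2 = 0 := (mul_eq_zero.1 h2).resolve_left (hρ0 t)
    have h4 : HasDerivAt (fun t => ρ t * γ (b + t) 2)
        (deriv ρ t * γ (b + t) 2 + ρ t * deriv γ (b + t) 2) t :=
      (hρd t).mul (hasDerivAt_pi.1 (hγd t) 2)
    rw [h1, h4.deriv, h3, mul_zero, zero_add]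
    exact mul_ne_zero (hρ0 t) (htr _ h3)

/-! ### From diagrams to descending curves -/

theorem projectsTo_mk_embL {x : EuclideanSpace ℝ (Fin 3)} {z : ℝ} (h : embL (x, z) ≠ 0)
    {u : Fin 3 → ℝ} (hu : u ≠ 0) :
    ProjectsTo (Projectivization.mk ℝ (embL (x, z)) h) (Projectivization.mk ℝ u hu) ↔
      ∃ a : ℝˣ, a • x.ofLp = u := by
  have hx : LinearMap.funLeft ℝ ℝ ![(0 : Fin 4), 1, 3] (embL (x, z)) = x.ofLp := by
    ext i
    rw [LinearMap.funLeft_apply, embL_apply]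
    fin_cases i <;> rfl
  rw [ProjectsTo, Projectivization.submodule_mk, Projectivization.submodule_mk,
    Submodule.map_span, Set.image_singleton, hx, Submodule.span_singleton_eq_span_singleton]

namespace NormalizedLift

variable {D : KnotDiagram} (N : NormalizedLift D)

/-- The point of the circle that is reached from the basepoint in time `t`. -/
def point (t : ℝ) : UnitAddCircle := ((N.start + t : ℝ) : UnitAddCircle)

theorem travelTime_point (t : ℝ) : travelTime D.basepoint (N.point t) = Int.fract t := by
  have h : N.point t - D.basepoint = (t : UnitAddCircle) := by
    rw [point, ← N.start_eq, AddCircle.coe_add, add_sub_cancel_left]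
  rw [travelTime, h, AddCircle.coe_equivIco_mk_apply]
  simp

theorem travelTime_point_of_mem {t : ℝ} (ht : t ∈ Set.Ico (0 : ℝ) 1) :
    travelTime D.basepoint (N.point t) = t := by
  rw [travelTime_point, Int.fract_eq_self.2 ht]

theorem point_eq_point_iff_int {s t : ℝ} : N.point s = N.point t ↔ ∃ k : ℤ, s = t + k := by
  rw [point, point, ← sub_eq_zero, ← AddCircle.coe_sub, AddCircle.coe_eq_zero_iff]
  refine exists_congr fun k => ?_
  rw [zsmul_eq_mul, mul_one]
  constructor <;> intro h <;> linarith

theorem point_eq_point_iff {s t : ℝ} (hs : s ∈ Set.Ico (0 : ℝ) 1) (ht : t ∈ Set.Ico (0 : ℝ) 1) :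
    N.point s = N.point t ↔ s = t := by
  refine ⟨fun h => ?_, fun h => h ▸ rfl⟩
  rw [← N.travelTime_point_of_mem hs, h, N.travelTime_point_of_mem ht]

theorem point_surjective : Function.Surjective N.point := by
  intro p
  obtain ⟨x, rfl⟩ := QuotientAddGroup.mk_surjective p
  exact ⟨x - N.start, congrArg _ (add_sub_cancel _ _)⟩

theorem exists_point_eq (p : UnitAddCircle) : ∃ t ∈ Set.Ico (0 : ℝ) 1, N.point t = p := by
  obtain ⟨x, rfl⟩ := N.point_surjective p
  exact ⟨Int.fract x, ⟨Int.fract_nonneg _, Int.fract_lt_one _⟩,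
    N.point_eq_point_iff_int.2 ⟨-⌊x⌋, by rw [Int.cast_neg, ← sub_eq_add_neg]; rfl⟩⟩

theorem curve_ne_zero (t : ℝ) : N.curve t ≠ 0 := fun h => by simpa [h] using N.unit t

theorem net_point_eq_iff {s t : ℝ} :
    D.net (N.point s) = D.net (N.point t) ↔ ∃ a : ℝ, N.curve t = a • N.curve s := by
  obtain ⟨h1, h2⟩ := N.net_eq s
  obtain ⟨h3, h4⟩ := N.net_eq t
  rw [point, point, h2, h4, eq_comm, Projectivization.mk_eq_mk_iff']
  refine exists_congr fun a => ⟨fun h => ?_, fun h => ?_⟩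
  · ext i
    exact (congrFun h i).symm
  · rw [h]; rfl

theorem net_point_mem_lineAtInfinity {t : ℝ} :
    D.net (N.point t) ∈ lineAtInfinity ↔ N.curve t 2 = 0 := by
  obtain ⟨h1, h2⟩ := N.net_eq t
  rw [point, h2, mk_mem_lineAtInfinity]

theorem isCrossing_point_iff {s t : ℝ} (hs : s ∈ Set.Ico (0 : ℝ) 1)
    (ht : t ∈ Set.Ico (0 : ℝ) 1) : D.IsCrossing (N.point s) (N.point t) ↔
      s ≠ t ∧ ∃ a : ℝ, N.curve t = a • N.curve s := by
  rw [KnotDiagram.IsCrossing, net_point_eq_iff, Ne, N.point_eq_point_iff hs ht]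

theorem sq_eq_one {s t a : ℝ} (h : N.curve t = a • N.curve s) : a ^ 2 = 1 := by
  have h1 := N.unit t
  rw [h, norm_smul, N.unit, mul_one, Real.norm_eq_abs] at h1
  rw [← sq_abs, h1, one_pow]

theorem abs_eq_one {s t a : ℝ} (h : N.curve t = a • N.curve s) : |a| = 1 := by
  rw [← Real.sqrt_sq_eq_abs, N.sq_eq_one h, Real.sqrt_one]

theorem curve_two_ne_zero {s t : ℝ} (h : D.IsCrossing (N.point s) (N.point t)) :
    N.curve s 2 ≠ 0 := by
  rw [Ne, ← N.net_point_mem_lineAtInfinity]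
  exact D.no_crossing_at_infinity _ _ h.1 h.2

theorem ne_smul_curve_zero (t a : ℝ) (h0 : 0 < t) (h1 : t < 1) :
    N.curve t ≠ a • N.curve 0 := by
  intro h
  have hb : N.point 0 = D.basepoint := by rw [point, add_zero, N.start_eq]
  refine D.basepoint_not_crossing (N.point t) ?_ ?_
  · rw [← hb, Ne, N.point_eq_point_iff ⟨h0.le, h1⟩ (by simp)]
    exact h0.ne'
  · rw [← hb]
    exact (N.net_point_eq_iff.2 ⟨a, h⟩).symm

theorem even_arcDistance_iff {s : ℝ} (hs : s ∈ Set.Ico (0 : ℝ) 1) (hs0 : N.curve s 2 ≠ 0) :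
    Even (D.arcDistance D.basepoint (N.point s)) ↔ 0 < N.curve s 2 := by
  have hw : Differentiable ℝ fun t => N.curve t 2 :=
    ((EuclideanSpace.proj (𝕜 := ℝ) (2 : Fin 3)).contDiff.comp N.smooth).differentiable (by simp)
  rw [← even_ncard_zeros_iff hw N.transverse N.pos hs.1 hs0]
  suffices h : D.arcDistance D.basepoint (N.point s) =
      {u | 0 ≤ u ∧ u < s ∧ N.curve u 2 = 0}.ncard by rw [h]
  symm
  refine Set.ncard_congr (fun u _ => N.point u) ?_ ?_ ?_
  · rintro u ⟨h1, h2, h3⟩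
    refine ⟨N.net_point_mem_lineAtInfinity.2 h3, ?_⟩
    rwa [N.travelTime_point_of_mem ⟨h1, h2.trans hs.2⟩, N.travelTime_point_of_mem hs]
  · rintro u v ⟨h1, h2, -⟩ ⟨h3, h4, -⟩ h
    exact (N.point_eq_point_iff ⟨h1, h2.trans hs.2⟩ ⟨h3, h4.trans hs.2⟩).1 h
  · rintro p ⟨h1, h2⟩
    obtain ⟨u, hu, rfl⟩ := N.exists_point_eq p
    rw [N.travelTime_point_of_mem hu, N.travelTime_point_of_mem hs] at h2
    exact ⟨u, ⟨hu.1, h2, N.net_point_mem_lineAtInfinity.1 h1⟩, rfl⟩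

/-- In a descending diagram, the sign of the last coordinate determines the over-branch. -/
theorem isOver_of_isDescending (hD : D.IsDescending) {s t a : ℝ} (hs : 0 ≤ s) (hst : s < t)
    (ht : t < 1) (h : N.curve t = a • N.curve s) :
    (0 < N.curve s 2 → D.isOver (N.point s) (N.point t)) ∧
      (N.curve s 2 < 0 → D.isOver (N.point t) (N.point s)) := by
  have hs' : s ∈ Set.Ico (0 : ℝ) 1 := ⟨hs, hst.trans ht⟩
  have ht' : t ∈ Set.Ico (0 : ℝ) 1 := ⟨hs.trans hst.le, ht⟩
  have hcr := (N.isCrossing_point_iff hs' ht').2 ⟨hst.ne, a, h⟩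
  have hd := hD _ _ hcr (by rwa [N.travelTime_point_of_mem hs', N.travelTime_point_of_mem ht'])
  rw [← Nat.not_even_iff_odd, N.even_arcDistance_iff hs' (N.curve_two_ne_zero hcr)] at hd
  exact ⟨hd.1, fun h => hd.2 h.not_gt⟩

theorem deriv_ne_smul (t a : ℝ) : deriv N.curve t ≠ a • N.curve t := by
  intro h1
  have h2 : HasDerivAt N.curve (deriv N.curve t) t :=
    (N.smooth.differentiable (by simp) t).hasDerivAt
  have h3 := h2.norm_sq
  simp only [N.unit] at h3
  have h4 := h3.unique (hasDerivAt_const t ((1 : ℝ) ^ 2))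
  rw [h1, inner_smul_right, real_inner_self_eq_norm_sq, N.unit] at h4
  have h5 : a = 0 := by linarith
  exact N.immersed t (by rw [h1, h5, zero_smul])

/-- `ζ` is the height function of the knot `K` over the normalized lift. -/
def IsHeight (K : Knot) (ζ : ℝ → ℝ) : Prop :=
  ∀ t, ∃ h : embL (N.curve t, ζ t) ≠ 0,
    K.toFun (N.point t) = Projectivization.mk ℝ (embL (N.curve t, ζ t)) h

theorem IsHeight.height_eq {K : Knot} {ζ : ℝ → ℝ} (h : N.IsHeight K ζ) (t : ℝ) :
    height (K.toFun (N.point t)) = ζ t / N.curve t 2 := by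
  obtain ⟨h1, h2⟩ := h t
  rw [h2, height_mk, embL_apply]
  rfl

/-- As `a` is a sign, `ζ t / (a * w) = a * ζ t / w`, which puts the heights of both branches over
the denominator `w` of the first branch. -/
theorem IsHeight.height_lt_iff {K : Knot} {ζ : ℝ → ℝ} (h : N.IsHeight K ζ) {s t a : ℝ}
    (hst : N.curve t = a • N.curve s) (hs : N.curve s 2 ≠ 0) :
    (height (K.toFun (N.point t)) < height (K.toFun (N.point s)) ↔
        a * ζ t / N.curve s 2 < ζ s / N.curve s 2) ∧
      (height (K.toFun (N.point s)) < height (K.toFun (N.point t)) ↔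
        ζ s / N.curve s 2 < a * ζ t / N.curve s 2) := by
  have ha := N.sq_eq_one hst
  have h1 : N.curve t 2 = a * N.curve s 2 := by rw [hst]; rfl
  have ha0 : a ≠ 0 := by rintro rfl; norm_num at ha
  have h2 : ζ t / N.curve t 2 = a * ζ t / N.curve s 2 := by
    rw [h1, div_eq_div_iff (mul_ne_zero ha0 hs) hs]
    linear_combination (-ζ t * N.curve s 2) * ha
  rw [h.height_eq, h.height_eq, h2]
  exact ⟨Iff.rfl, Iff.rfl⟩

/-- The sign of `w` at the first branch decides which branch is over, and also whether multiplying
by `w` reverses the inequality of heights. The two effects cancel, so both parities give the same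
condition on `ζ`. -/
theorem isDescendingPair {K : Knot} {ζ : ℝ → ℝ} (h : N.IsHeight K ζ) (hD : D.IsDescending)
    (hK : D.IsDiagramOf K) : IsDescendingPair N.curve ζ := by
  intro s t a hs hst ht hct
  have hcr := (N.isCrossing_point_iff ⟨hs.le, hst.trans ht⟩ ⟨(hs.trans hst).le, ht⟩).2
    ⟨hst.ne, a, hct⟩
  have hw := N.curve_two_ne_zero hcr
  have hov := N.isOver_of_isDescending hD hs.le hst ht hct
  have hlt := h.height_lt_iff N hct hw
  rw [N.abs_eq_one hct, one_mul]
  rcases lt_or_gt_of_ne hw with hw' | hw'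
  · have h1 := hlt.2.1 ((hK.2 _ _ ⟨hcr.1.symm, hcr.2.symm⟩).1 (hov.2 hw'))
    exact (div_lt_div_right_of_neg hw').1 h1
  · have h1 := hlt.1.1 ((hK.2 _ _ hcr).1 (hov.1 hw'))
    exact (div_lt_div_iff_of_pos_right hw').1 h1

/-- A lift of the knot projects to a nonvanishing multiple of the normalized curve. The factor is an
inner product with that unit curve, hence smooth, and dividing the third coordinate by it gives the
height. -/
theorem exists_isHeight {K : Knot} (hK : ∀ p, ProjectsTo (K.toFun p) (D.net p)) :
    ∃ ζ : ℝ → ℝ, ContDiff ℝ ∞ ζ ∧ (∀ t, ζ (t + 1) = N.sign * ζ t) ∧ N.IsHeight K ζ := by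
  obtain ⟨γ, hγ, hγ'⟩ := K.smooth_immersion
  set g : ℝ → Fin 4 → ℝ := fun t => γ (N.start + t) with hg
  have hgs : ContDiff ℝ ∞ g := hγ.comp (contDiff_const.add contDiff_id)
  set x : ℝ → EuclideanSpace ℝ (Fin 3) := fun t => !₂[g t 0, g t 1, g t 3] with hx
  have hxs : ContDiff ℝ ∞ x := by
    have hi : ∀ i, ContDiff ℝ ∞ fun t => g t i := contDiff_pi.1 hgs
    rw [contDiff_euclidean]
    intro i
    fin_cases i
    exacts [hi 0, hi 1, hi 3]
  have hgx : ∀ t, g t = embL (x t, g t 2) := by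
    intro t
    rw [embL_apply]
    ext i
    fin_cases i <;> rfl
  have hgK : ∀ t, ∃ h : embL (x t, g t 2) ≠ 0,
      K.toFun (N.point t) = Projectivization.mk ℝ (embL (x t, g t 2)) h := by
    intro t
    have h := (hγ' (N.start + t)).2
    change ∃ h : g t ≠ 0, K.toFun (N.point t) = Projectivization.mk ℝ (g t) h at h
    simpa only [← hgx] using h
  have hxc : ∀ t, ∃ a : ℝ, a ≠ 0 ∧ x t = a • N.curve t := by
    intro t
    obtain ⟨h1, h2⟩ := hgK t
    obtain ⟨h3, h4⟩ := N.net_eq t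
    have h5 := hK (N.point t)
    rw [h2, point, h4, projectsTo_mk_embL] at h5
    obtain ⟨a, ha⟩ := h5
    refine ⟨(a⁻¹ : ℝˣ), a⁻¹.ne_zero, ?_⟩
    ext i
    have h6 := congrFun ha i
    simp only [Pi.smul_apply, Units.smul_def, smul_eq_mul] at h6
    simp [← h6]
  set μ : ℝ → ℝ := fun t => ⟪N.curve t, x t⟫ with hμ
  have hμs : ContDiff ℝ ∞ μ := N.smooth.inner ℝ hxs
  have hxμ : ∀ t, μ t ≠ 0 ∧ x t = μ t • N.curve t := by
    intro t
    obtain ⟨a, ha, h⟩ := hxc t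
    have h1 : μ t = a := by
      rw [hμ]
      simp only
      rw [h, inner_smul_right, real_inner_self_eq_norm_sq, N.unit]
      ring
    rw [h1]
    exact ⟨ha, h⟩
  have hheight : N.IsHeight K fun t => g t 2 / μ t := by
    intro t
    obtain ⟨h1, h2⟩ := hgK t
    have h3 : embL (x t, g t 2) = μ t • embL (N.curve t, g t 2 / μ t) :=
      embL_eq_smul.2 ⟨(hxμ t).2, (mul_div_cancel₀ _ (hxμ t).1).symm⟩
    refine ⟨fun h => h1 (by rw [h3, h, smul_zero]), ?_⟩
    rw [h2, Projectivization.mk_eq_mk_iff']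
    exact ⟨μ t, h3.symm⟩
  refine ⟨fun t => g t 2 / μ t, (contDiff_pi.1 hgs 2).div hμs fun t => (hxμ t).1, fun t => ?_,
    hheight⟩
  -- No equivariance is assumed of the lift `γ`. That of the height is read off from the equality of
  -- the points at `t` and `t + 1`, whose factor is determined by the projection.
  obtain ⟨h1, h2⟩ := hheight t
  obtain ⟨h3, h4⟩ := hheight (t + 1)
  have hp : N.point (t + 1) = N.point t := N.point_eq_point_iff_int.2 ⟨1, by simp⟩
  rw [hp, h2] at h4
  obtain ⟨a, ha⟩ := (Projectivization.mk_eq_mk_iff' ℝ _ _ h3 h1).1 h4.symm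
  obtain ⟨h5, h6⟩ := embL_eq_smul.1 ha.symm
  rw [N.periodic] at h5
  rw [h6, smul_left_injective ℝ (N.curve_ne_zero t) h5]

theorem isUnknot_of_isDiagramOf (N : NormalizedLift D) (hD : D.IsDescending) {K : Knot}
    (hK : D.IsDiagramOf K) : K.IsUnknot := by
  obtain ⟨ζ, hζ, hζp, hh⟩ := N.exists_isHeight hK.1
  have hset : Set.range K.toFun = curveSet (knotCurve N.curve ζ) := by
    have hkc : ∀ t, knotCurve N.curve ζ t = embL (N.curve t, ζ t) := fun t => by
      rw [knotCurve, N.unit, one_mul]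
    ext P
    simp only [curveSet, hkc, Set.mem_range, Set.mem_ofPred_eq, N.point_surjective.exists]
    refine exists_congr fun t => ?_
    obtain ⟨h1, h2⟩ := hh t
    rw [h2]
    exact ⟨fun h => ⟨h1, h.symm⟩, fun ⟨_, h⟩ => h.symm⟩
  rw [Knot.IsUnknot, hset]
  exact (N.isDescendingPair hh hD hK).isUnknot N.sign_eq N.smooth hζ N.periodic hζp N.unit
    N.immersed N.ne_smul_curve_zero

/-! ### Existence of a knot with a given descending diagram. -/

theorem exists_isDescendingPair : ∃ ζ : ℝ → ℝ, ContDiff ℝ ∞ ζ ∧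
    (∀ t, ζ (t + 1) = N.sign * ζ t) ∧ IsDescendingPair N.curve ζ := by
  have horth : ⟪N.curve 0, deriv N.curve 0⟫ = 0 := by
    have h2 := ((N.smooth.differentiable (by simp) 0).hasDerivAt).norm_sq
    simp only [N.unit] at h2
    have h3 := h2.unique (hasDerivAt_const (0 : ℝ) ((1 : ℝ) ^ 2))
    linarith
  -- The curve is straightened to itself merely to obtain a neighbourhood of the basepoint without
  -- crossings, inside which the model height may be cut off.
  obtain ⟨δ, hδ, hδ1, h⟩ := exists_straighten N.sign_eq N.smooth N.smooth N.periodic N.periodic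
    rfl rfl (N.unit 0) horth (N.immersed 0) N.curve_ne_zero N.ne_smul_curve_zero
  have hb := (h 0 (by simp)).1
  simp only [straighten_zero] at hb
  have hε0 := ne_zero_of_sign N.sign_eq
  exact ⟨modelHeight N.sign δ, contDiff_modelHeight hε0 hδ (by linarith),
    modelHeight_add_one hε0,
    NoBaseCrossing.isDescendingPair_modelHeight N.periodic N.curve_ne_zero hb hδ le_rfl⟩

theorem exists_knot {ζ : ℝ → ℝ} (h : IsClosedCurve N.sign fun t => embL (N.curve t, ζ t)) :
    ∃ K : Knot, N.IsHeight K ζ := by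
  set f : UnitAddCircle → RP3 := fun p =>
    Projectivization.mk ℝ _ (h.ne_zero (travelTime D.basepoint p)) with hf
  have hfp : ∀ t, f (N.point t) = Projectivization.mk ℝ _ (h.ne_zero t) := by
    intro t
    rw [hf, Projectivization.mk_eq_mk_iff']
    refine ⟨N.sign ^ (-⌊t⌋), ?_⟩
    have h1 := equivariant_int (f := fun t => embL (N.curve t, ζ t)) N.sign_eq h.periodic (-⌊t⌋) t
    rw [Int.cast_neg, ← sub_eq_add_neg, Int.self_sub_floor] at h1
    rw [N.travelTime_point]
    exact h1.symm
  refine ⟨⟨f, ⟨fun x => embL (N.curve (x - N.start), ζ (x - N.start)), ?_, fun x => ⟨?_, ?_⟩⟩,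
    ?_⟩, fun t => ⟨h.ne_zero t, hfp t⟩⟩
  · exact h.smooth.comp (contDiff_id.sub contDiff_const)
  · rw [LinearIndependent.pair_iff' (h.ne_zero (x - N.start))]
    intro a ha
    rw [deriv_comp_sub_const (f := fun t => embL (N.curve t, ζ t))] at ha
    exact h.immersed _ a ha.symm
  · refine ⟨h.ne_zero (x - N.start), ?_⟩
    rw [← hfp, point, add_sub_cancel]
  · intro p q hpq
    obtain ⟨s, rfl⟩ := N.point_surjective p
    obtain ⟨t, rfl⟩ := N.point_surjective q
    rw [hfp, hfp] at hpq
    obtain ⟨a, ha⟩ := (Projectivization.mk_eq_mk_iff' ℝ _ _ (h.ne_zero s) (h.ne_zero t)).1 hpq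
    exact N.point_eq_point_iff_int.2 (h.inj s t a ha.symm)

theorem exists_isDiagramOf (N : NormalizedLift D) (hD : D.IsDescending) :
    ∃ K : Knot, D.IsDiagramOf K := by
  obtain ⟨ζ, hζ, hζp, hd⟩ := N.exists_isDescendingPair
  have hcl : IsClosedCurve N.sign fun t => embL (N.curve t, ζ t) := by
    have h1 := (hd.isKnotPair N.smooth hζ N.periodic hζp N.curve_ne_zero
      (fun t => ⟨0, fun a => N.deriv_ne_smul _ a⟩) N.ne_smul_curve_zero).isClosedCurve N.sign_eq
    have h2 : knotCurve N.curve ζ = fun t => embL (N.curve t, ζ t) := by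
      ext1 t
      rw [knotCurve, N.unit, one_mul]
    rwa [h2] at h1
  obtain ⟨K, hK⟩ := N.exists_knot hcl
  have key : ∀ s t : ℝ, 0 ≤ s → s < t → t < 1 → D.IsCrossing (N.point s) (N.point t) →
      (D.isOver (N.point s) (N.point t) ↔
        height (K.toFun (N.point t)) < height (K.toFun (N.point s))) ∧
      (D.isOver (N.point t) (N.point s) ↔
        height (K.toFun (N.point s)) < height (K.toFun (N.point t))) := by
    intro s t hs hst ht hcr
    obtain ⟨a, hct⟩ := N.net_point_eq_iff.1 hcr.2
    have hs' : 0 < s := hs.lt_of_ne fun h => by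
      subst h
      exact N.ne_smul_curve_zero t a hst ht hct
    have hw := N.curve_two_ne_zero hcr
    have hov := N.isOver_of_isDescending hD hs hst ht hct
    have hlt := hK.height_lt_iff N hct hw
    -- Descending only names the over-branch; that the other branch is not over as well comes from
    -- this exclusivity.
    have hex := D.isOver_iff _ _ hcr.1 hcr.2
    have hd' := hd s t a hs' hst ht hct
    rw [N.abs_eq_one hct, one_mul] at hd'
    rcases lt_or_gt_of_ne hw with hw' | hw'
    · have h1 := hov.2 hw'
      have h2 := hlt.2.2 ((div_lt_div_right_of_neg hw').2 hd')
      exact ⟨iff_of_false (fun h => hex.1 h h1) h2.not_gt, iff_of_true h1 h2⟩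
    · have h1 := hov.1 hw'
      have h2 := hlt.1.2 ((div_lt_div_iff_of_pos_right hw').2 hd')
      exact ⟨iff_of_true h1 h2, iff_of_false (hex.1 h1) h2.not_gt⟩
  refine ⟨K, fun p => ?_, fun p q hpq => ?_⟩
  · obtain ⟨t, rfl⟩ := N.point_surjective p
    obtain ⟨h1, h2⟩ := hK t
    obtain ⟨h3, h4⟩ := N.net_eq t
    rw [h2, point, h4, projectsTo_mk_embL]
    exact ⟨1, one_smul _ _⟩
  · obtain ⟨s, hs, rfl⟩ := N.exists_point_eq p
    obtain ⟨t, ht, rfl⟩ := N.exists_point_eq q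
    rcases lt_trichotomy s t with h | h | h
    · exact (key s t hs.1 h ht.2 hpq).1
    · exact absurd (congrArg _ h) hpq.1
    · exact (key t s ht.1 h hs.2 ⟨hpq.1.symm, hpq.2.symm⟩).2

end NormalizedLift

end ProjKnot

end

theorem mainTheorem4 (D : ProjKnot.KnotDiagram) (hD : D.IsDescending) :
    (∃ K : ProjKnot.Knot, D.IsDiagramOf K) ∧
      ∀ K : ProjKnot.Knot, D.IsDiagramOf K → K.IsUnknot := by
  obtain ⟨N⟩ := D.nonempty_normalizedLift
  exact ⟨N.exists_isDiagramOf hD, fun K hK => N.isUnknot_of_isDiagramOf hD hK⟩
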